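/- Conventions. $H(x)=-x\log_2x-(1-x)\log_2(1-x)$; $S(\rho)=-\mathrm{Tr}\,\rho\log_2\rho$; $\sigma_0=\mathbb 1$ and $\sigma_1,\sigma_2,\sigma_3$ are the Pauli matrices. For a two-qubit state $\rho$, $\mathrm{Con}(\rho)$ is the convex roof (infimum of averages over all finite pure-state ensembles of $\rho$) of $2\sqrt{S_2(\rho_1)}$, where $\rho_1$ is the first reduced state and $S_2(A)=\frac12[(\mathrm{Tr}A)^2-\mathrm{Tr}A^2]$; the entanglement of formation $E(\rho)$ is the convex roof of $S(\rho_1)$. For a two-qubit state $\rho^{AB}$, a measurement $\{M_k\}_{k<n}$ on $A$ ($M_k\ge0$, $\sum_kM_k=\mathbb 1$, $n$ arbitrary) yields the states $\rho^B_k=\mathrm{Tr}_A[(M_k\otimes\mathbb 1)\rho^{AB}]/p_k$ with probabilities $p_k=\mathrm{Tr}[(M_k\otimes\mathbb 1)\rho^{AB}]$, and $\overline S_{\min}$ is the minimum of $\sum_kp_kS(\rho^B_k)$ over all such measurements. Von Neumann measurements are $M_\pm=\frac12\mathbb 1\pm(x_1\sigma_1+x_2\sigma_2+x_3\sigma_3)$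 with $x_1^2+x_2^2+x_3^2=\frac14$. Let $\lambda_0,\lambda_1>0$, $\lambda_0+\lambda_1=1$, and let $a_k,b_k,c,d$ be real with $a_k^2+b_k^2=1$ ($k=0,1$), $c^2+d^2=1$. Put $|\eta\rangle=c|0\rangle+d|1\rangle$, $|\eta^\perp\rangle=-d|0\rangle+c|1\rangle$, $|\psi_0\rangle=a_0|0\rangle|0\rangle+b_0|\eta\rangle|1\rangle$, $|\psi_1\rangle=a_1|1\rangle|0\rangle+b_1|\eta^\perp\rangle|1\rangle$, $|\Psi\rangle=\sqrt{\lambda_0}|\psi_0\rangle|0\rangle+\sqrt{\lambda_1}|\psi_1\rangle|1\rangle$, and $\rho^{BC}=\mathrm{Tr}_A|\Psi\rangle\langle\Psi|$. Then $\mathrm{Tr}_C|\Psi\rangle\langle\Psi|=\rho^{AB}:=\lambda_0|\psi_0\rangle\langle\psi_0|+\lambda_1|\psi_1\rangle\langle\psi_1|$, and the following hold. (1) $\mathrm{Con}^2(\rho^{BC})=4\lambda_0\lambda_1d^2(a_0b_1+a_1b_0)^2$ if (i) $c^2(a_0b_1-a_1b_0)^2\ge4a_0a_1b_0b_1d^2$,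 and $\mathrm{Con}^2(\rho^{BC})=4\lambda_0\lambda_1(a_0b_1-a_1b_0)^2$ if (ii) $c^2(a_0b_1-a_1b_0)^2<4a_0a_1b_0b_1d^2$. Moreover $E(\rho^{BC})=H\big(\tfrac{1+\sqrt{1-\mathrm{Con}^2(\rho^{BC})}}2\big)$. (2) Suppose that $\rho^{AB}$ is entangled (not separable). Then $R=(\mathrm{Tr}[\rho^{AB}\sigma_\mu\otimes\sigma_\nu])_{\mu,\nu=0}^3$ is invertible. Let $\mathfrak E=\{\vec y\in\mathbb R^3:\mathbf y^TR^{-1}\,\mathrm{diag}(1,-1,-1,-1)\,R^{-T}\mathbf y=0,\ \mathbf y=(1,\vec y)\}$ be the steering ellipsoid. Put $f_3=\sqrt{\lambda_0\lambda_1}(a_1b_0+a_0b_1)$, $f_6=\sqrt{\lambda_0\lambda_1}(a_0a_1-b_0b_1)$, and let $\theta$ be an angle with $\sqrt{c^2f_3^2+f_6^2}\,\sin\theta=-cf_3$ and $\sqrt{c^2f_3^2+f_6^2}\,\cos\theta=f_6$. Let $\mathfrak E'$ and $B'$ be the images of $\mathfrak E$ and of the Bloch vector of $\rho^B$ under the rotation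 $(y_1,y_2,y_3)\mapsto(y_1\cos\theta+y_3\sin\theta,\ y_2,\ -y_1\sin\theta+y_3\cos\theta)$. The line through $B'$ parallel to the $y_1$ axis meets $\mathfrak E'$ in exactly two points $M\ne N$, the line through $B'$ parallel to the $y_2$ axis meets $\mathfrak E'$ in exactly two points $P\ne Q$, and $B'=p_MM+p_NN=p_PP+p_QQ$ with positive weights, $p_M+p_N=p_P+p_Q=1$. Each of the two decompositions is (up to the rotation) the ensemble of Bloch vectors and probabilities on $B$ produced by a von Neumann measurement on $A$. The lengths are $$|M|^2=|N|^2=1-4\lambda_0\lambda_1d^2(a_0b_1+a_1b_0)^2,\qquad |P|^2=|Q|^2=1-4\lambda_0\lambda_1(a_0b_1-a_1b_0)^2.$$ Hence $\overline S_{MN}:=p_MH(\frac{1+|M|}2)+p_NH(\frac{1+|N|}2)$ and $\overline S_{PQ}$ (defined likewise) equal $H(\frac{1+\sqrt{1-t}}2)$ with $t=4\lambda_0\lambda_1d^2(a_0b_1+a_1b_0)^2$ and $t=4\lambda_0\lambda_1(a_0b_1-a_1b_0)^2$ respectively. In case (i) $\overline S_{MN}=E(\rho^{BC})=\overline S_{\min}$,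 and in case (ii) $\overline S_{PQ}=E(\rho^{BC})=\overline S_{\min}$. (3) Let $q\in(0,1)$, $\alpha,\beta\in(0,\frac\pi2]$, $|\psi\rangle=\cos\alpha|0\rangle+\sin\alpha|1\rangle$, $|\phi\rangle=\cos\beta|0\rangle+\sin\beta|1\rangle$, $\rho^{AB}=q|00\rangle\langle00|+(1-q)|\psi\phi\rangle\langle\psi\phi|$, and let $\rho^{BC}$ be the reduced state of its purification $\sqrt q|000\rangle+\sqrt{1-q}|\psi\phi1\rangle$. Then $\mathrm{Con}(\rho^{BC})=2\sqrt{q(1-q)}\cos\alpha\sin\beta$ and $$\overline S_{\min}=E(\rho^{BC})=H\Big(\frac{1+y_{\max}}2\Big),\qquad y_{\max}=\sqrt{1-4q(1-q)\cos^2\alpha\sin^2\beta}.$$ For every von Neumann measurement on $A$ both outcomes have positive probability, and the Bloch vectors $\vec y_\pm$ of the two postmeasurement states of $B$, as well as the Bloch vector of $\rho^B$, lie on the line $y_2=0$, $y_3+y_1\tan\beta=1$ (for $\beta=\frac\pi2$: $y_2=0$, $y_1=0$). Among the von Neumann measurements with $\vec y_+\ne\vec y_-$ and $|\vec y_+|=|\vec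 y_-|$, the maximal value of $|\vec y_+|$ exists and equals $y_{\max}$, and every such measurement with $|\vec y_\pm|=y_{\max}$ has average entropy $H(\frac{1+y_{\max}}2)=\overline S_{\min}$. -/

import Mathlib

open scoped Matrix Kronecker ComplexOrder

noncomputable section

namespace QState

/-! ### States, partial traces, entropies -/

/-- The computational basis vectors of a qubit. -/
def ket (i : Fin 2) : Fin 2 → ℂ := Pi.single i 1

/-- Tensor product of vectors. -/
def tensor {ι κ : Type*} (u : ι → ℂ) (v : κ → ℂ) : ι × κ → ℂ := fun x => u x.1 * v x.2

/-- Tensor product of a vector of the system `AB` with a vector of `C`, as a vector of `ABC`. -/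
def tensorAB (u : Fin 2 × Fin 2 → ℂ) (v : Fin 2 → ℂ) : Fin 2 × Fin 2 × Fin 2 → ℂ :=
  fun x => u (x.1, x.2.1) * v x.2.2

/-- The rank-one operator `|φ⟩⟨φ|`. -/
def proj {ι : Type*} (φ : ι → ℂ) : Matrix ι ι ℂ := Matrix.vecMulVec φ (star φ)

/-- Partial trace over the first factor. -/
def ptraceFst {ι κ : Type*} [Fintype ι] (ρ : Matrix (ι × κ) (ι × κ) ℂ) : Matrix κ κ ℂ :=
  Matrix.of fun b b' => ∑ a, ρ (a, b) (a, b')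

/-- Partial trace over the second factor. -/
def ptraceSnd {ι κ : Type*} [Fintype κ] (ρ : Matrix (ι × κ) (ι × κ) ℂ) : Matrix ι ι ℂ :=
  Matrix.of fun a a' => ∑ b, ρ (a, b) (a', b)

/-- `Tr_C` of an operator on `ABC`. -/
def ptraceC (ρ : Matrix (Fin 2 × Fin 2 × Fin 2) (Fin 2 × Fin 2 × Fin 2) ℂ) :
    Matrix (Fin 2 × Fin 2) (Fin 2 × Fin 2) ℂ :=
  Matrix.of fun x y => ∑ c, ρ (x.1, x.2, c) (y.1, y.2, c)

/-- The complement state `ρ^{BC} = Tr_A |Ψ⟩⟨Ψ|` attached to a vector `Ψ` of `ABC`. -/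
def complementState (Ψ : Fin 2 × Fin 2 × Fin 2 → ℂ) :
    Matrix (Fin 2 × Fin 2) (Fin 2 × Fin 2) ℂ :=
  ptraceFst (proj Ψ)

/-- Density operators: positive semidefinite of trace one. -/
def IsDensity {ι : Type*} [Fintype ι] (ρ : Matrix ι ι ℂ) : Prop :=
  ρ.PosSemidef ∧ ρ.trace = 1

/-- Separability: a finite convex combination of product states. -/
def IsSeparable (ρ : Matrix (Fin 2 × Fin 2) (Fin 2 × Fin 2) ℂ) : Prop :=
  ∃ (n : ℕ) (p : Fin n → ℝ) (σ τ : Fin n → Matrix (Fin 2) (Fin 2) ℂ),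
    (∀ k, 0 ≤ p k) ∧ ∑ k, p k = 1 ∧ (∀ k, IsDensity (σ k)) ∧ (∀ k, IsDensity (τ k)) ∧
      ρ = ∑ k, (p k : ℂ) • (σ k ⊗ₖ τ k)

/-- The binary entropy with logarithms to base two. -/
def H (x : ℝ) : ℝ := -x * Real.logb 2 x - (1 - x) * Real.logb 2 (1 - x)

open Classical in
/-- Von Neumann entropy `-Tr ρ log₂ ρ` of a Hermitian matrix, through its eigenvalues. -/
def entropy {ι : Type*} [Fintype ι] [DecidableEq ι] (ρ : Matrix ι ι ℂ) : ℝ :=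
  if h : ρ.IsHermitian then -∑ i, h.eigenvalues i * Real.logb 2 (h.eigenvalues i) else 0

/-- The second symmetric function `S₂(A) = ((Tr A)² - Tr A²) / 2` (real for Hermitian `A`). -/
def secondSymm {ι : Type*} [Fintype ι] (A : Matrix ι ι ℂ) : ℝ :=
  ((A.trace ^ 2 - (A * A).trace) / 2).re

/-- Convex roof of a function `f` of unit vectors, at the state `ρ`: the infimum of the averages
of `f` over all finite pure-state ensembles of `ρ`. -/
def convexRoof {ι : Type*} [Fintype ι] (f : (ι → ℂ) → ℝ) (ρ : Matrix ι ι ℂ) : ℝ :=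
  sInf {s : ℝ | ∃ (n : ℕ) (p : Fin n → ℝ) (φ : Fin n → ι → ℂ),
    (∀ k, 0 ≤ p k) ∧ ∑ k, p k = 1 ∧ (∀ k, star (φ k) ⬝ᵥ φ k = 1) ∧
      ρ = ∑ k, (p k : ℂ) • proj (φ k) ∧ s = ∑ k, p k * f (φ k)}

/-- Concurrence: convex roof of `2 √(S₂(ρ₁))`. -/
def concurrence (ρ : Matrix (Fin 2 × Fin 2) (Fin 2 × Fin 2) ℂ) : ℝ :=
  convexRoof (fun φ => 2 * √(secondSymm (ptraceSnd (proj φ)))) ρ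

/-- Entanglement of formation: convex roof of the entropy of the first reduced state. -/
def eof (ρ : Matrix (Fin 2 × Fin 2) (Fin 2 × Fin 2) ℂ) : ℝ :=
  convexRoof (fun φ => entropy (ptraceSnd (proj φ))) ρ

/-! ### Measurements on `A` and the induced ensembles on `B` -/

/-- Measurements with `n` operation elements on the qubit `A`. -/
def IsPOVM {n : ℕ} (M : Fin n → Matrix (Fin 2) (Fin 2) ℂ) : Prop :=
  (∀ k, (M k).PosSemidef) ∧ ∑ k, M k = 1

/-- Probability `Tr[(M ⊗ 1) ρ]` of the outcome `M`. -/
def postProb (ρ : Matrix (Fin 2 × Fin 2) (Fin 2 × Fin 2) ℂ) (M : Matrix (Fin 2) (Fin 2) ℂ) : ℝ :=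
  (((M ⊗ₖ (1 : Matrix (Fin 2) (Fin 2) ℂ)) * ρ).trace).re

/-- Postmeasurement state `Tr_A[(M ⊗ 1) ρ] / p` of `B` for the outcome `M`. -/
def postState (ρ : Matrix (Fin 2 × Fin 2) (Fin 2 × Fin 2) ℂ) (M : Matrix (Fin 2) (Fin 2) ℂ) :
    Matrix (Fin 2) (Fin 2) ℂ :=
  ((postProb ρ M : ℂ)⁻¹) • ptraceFst ((M ⊗ₖ (1 : Matrix (Fin 2) (Fin 2) ℂ)) * ρ)

/-- Average entropy `∑ₖ pₖ S(ρₖ^B)` of the postmeasurement ensemble. -/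
def avgEntropy {n : ℕ} (ρ : Matrix (Fin 2 × Fin 2) (Fin 2 × Fin 2) ℂ)
    (M : Fin n → Matrix (Fin 2) (Fin 2) ℂ) : ℝ :=
  ∑ k, postProb ρ (M k) * entropy (postState ρ (M k))

/-- All average entropies of `B` reachable by a measurement on `A`; the minimal average entropy is
the least element of this set. -/
def avgEntropies (ρ : Matrix (Fin 2 × Fin 2) (Fin 2 × Fin 2) ℂ) : Set ℝ :=
  {s | ∃ (n : ℕ) (M : Fin n → Matrix (Fin 2) (Fin 2) ℂ), IsPOVM M ∧ s = avgEntropy ρ M}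

/-! ### Bloch vectors and the steering ellipsoid -/

/-- Three-dimensional Euclidean space; the coordinates `0, 1, 2` are `y₁, y₂, y₃`. -/
abbrev E3 := EuclideanSpace ℝ (Fin 3)

/-- `σ₀` is the identity, `σ₁, σ₂, σ₃` are the Pauli matrices. -/
def pauli : Fin 4 → Matrix (Fin 2) (Fin 2) ℂ :=
  ![1, !![0, 1; 1, 0], !![0, -Complex.I; Complex.I, 0], !![1, 0; 0, -1]]

/-- Bloch vector `(Tr ρσ₁, Tr ρσ₂, Tr ρσ₃)`. -/
def bloch (ρ : Matrix (Fin 2) (Fin 2) ℂ) : E3 :=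
  WithLp.toLp 2 fun i : Fin 3 => ((ρ * pauli i.succ).trace).re

/-- The operator `1/2 + x₁σ₁ + x₂σ₂ + x₃σ₃`. -/
def effect (x : E3) : Matrix (Fin 2) (Fin 2) ℂ :=
  (1 / 2 : ℂ) • pauli 0 + ∑ i : Fin 3, (x i : ℂ) • pauli i.succ

/-- The parameters `x` for which `effect x, effect (-x)` is a von Neumann measurement:
`x₁² + x₂² + x₃² = 1/4`. -/
def IsVonNeumann (x : E3) : Prop := x 0 ^ 2 + x 1 ^ 2 + x 2 ^ 2 = 1 / 4

/-- The matrix `R_{μν} = Tr(ρ σ_μ ⊗ σ_ν)`. -/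
def rMatrix (ρ : Matrix (Fin 2 × Fin 2) (Fin 2 × Fin 2) ℂ) : Matrix (Fin 4) (Fin 4) ℝ :=
  Matrix.of fun μ ν => ((ρ * (pauli μ ⊗ₖ pauli ν)).trace).re

/-- The Minkowski form `diag(1, -1, -1, -1)`. -/
def minkowski : Matrix (Fin 4) (Fin 4) ℝ := Matrix.diagonal ![1, -1, -1, -1]

/-- The surface `𝐲ᵀ R⁻¹ η R⁻ᵀ 𝐲 = 0`, with `𝐲 = (1, y₁, y₂, y₃)`. -/
def steeringEllipsoid (ρ : Matrix (Fin 2 × Fin 2) (Fin 2 × Fin 2) ℂ) : Set E3 :=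
  {y | ![1, y 0, y 1, y 2] ⬝ᵥ
    (((rMatrix ρ)⁻¹ * minkowski * ((rMatrix ρ)⁻¹)ᵀ) *ᵥ ![1, y 0, y 1, y 2]) = 0}

/-- The rotation of points
`(y₁, y₃) ↦ (y₁ cos η + y₃ sin η, -y₁ sin η + y₃ cos η)` about the `y₂` axis. -/
def rot (η : ℝ) (y : E3) : E3 :=
  !₂[Real.cos η * y 0 + Real.sin η * y 2, y 1, -Real.sin η * y 0 + Real.cos η * y 2]

/-- The line through `B` with direction `e` meets the surface `S` exactly in two points `M ≠ N`,
and `B = p M + p' N` is a convex combination of them with positive weights. -/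
def IsChordDecomposition (S : Set E3) (B e : E3) (p p' : ℝ) (M N : E3) : Prop :=
  M ≠ N ∧ {y : E3 | y ∈ S ∧ ∃ t : ℝ, y = B + t • e} = {M, N} ∧
    0 < p ∧ 0 < p' ∧ p + p' = 1 ∧ B = p • M + p' • N

/-- Some von Neumann measurement on `A` produces on `B` the states whose Bloch vectors, rotated by
`η`, are `M` and `N`, with probabilities `p` and `p'`. -/
def IsRealized (ρ : Matrix (Fin 2 × Fin 2) (Fin 2 × Fin 2) ℂ) (η p p' : ℝ) (M N : E3) : Prop :=
  ∃ x : E3, IsVonNeumann x ∧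
    postProb ρ (effect x) = p ∧ postProb ρ (effect (-x)) = p' ∧
    rot η (bloch (postState ρ (effect x))) = M ∧ rot η (bloch (postState ρ (effect (-x)))) = N

/-- Average entropy `p H((1+|M|)/2) + p' H((1+|N|)/2)`. -/
def chordEntropy (p p' : ℝ) (M N : E3) : ℝ :=
  p * H ((1 + ‖M‖) / 2) + p' * H ((1 + ‖N‖) / 2)

/-! ### Rank-two states with real parameters -/

/-- The real parameters of a two-qubit state of rank two in canonical form. -/
structure RealParams where
  l0 : ℝ
  l1 : ℝ
  a0 : ℝ
  b0 : ℝ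
  a1 : ℝ
  b1 : ℝ
  c : ℝ
  d : ℝ

namespace RealParams

/-- The normalization of the parameters. -/
def Valid (P : RealParams) : Prop :=
  0 < P.l0 ∧ 0 < P.l1 ∧ P.l0 + P.l1 = 1 ∧ P.a0 ^ 2 + P.b0 ^ 2 = 1 ∧ P.a1 ^ 2 + P.b1 ^ 2 = 1 ∧
    P.c ^ 2 + P.d ^ 2 = 1

/-- `|η⟩ = c|0⟩ + d|1⟩`. -/
def eta (P : RealParams) : Fin 2 → ℂ := (P.c : ℂ) • ket 0 + (P.d : ℂ) • ket 1

/-- `|η^⊥⟩ = -d|0⟩ + c|1⟩`. -/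
def etaPerp (P : RealParams) : Fin 2 → ℂ := -(P.d : ℂ) • ket 0 + (P.c : ℂ) • ket 1

/-- `|ψ₀⟩ = a₀|0⟩|0⟩ + b₀|η⟩|1⟩`. -/
def psi0 (P : RealParams) : Fin 2 × Fin 2 → ℂ :=
  (P.a0 : ℂ) • tensor (ket 0) (ket 0) + (P.b0 : ℂ) • tensor P.eta (ket 1)

/-- `|ψ₁⟩ = a₁|1⟩|0⟩ + b₁|η^⊥⟩|1⟩`. -/
def psi1 (P : RealParams) : Fin 2 × Fin 2 → ℂ :=
  (P.a1 : ℂ) • tensor (ket 1) (ket 0) + (P.b1 : ℂ) • tensor P.etaPerp (ket 1)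

/-- `ρ^{AB} = λ₀|ψ₀⟩⟨ψ₀| + λ₁|ψ₁⟩⟨ψ₁|`. -/
def rhoAB (P : RealParams) : Matrix (Fin 2 × Fin 2) (Fin 2 × Fin 2) ℂ :=
  (P.l0 : ℂ) • proj P.psi0 + (P.l1 : ℂ) • proj P.psi1

/-- The purification `√λ₀ |ψ₀⟩|0⟩ + √λ₁ |ψ₁⟩|1⟩` of `ρ^{AB}`. -/
def purification (P : RealParams) : Fin 2 × Fin 2 × Fin 2 → ℂ :=
  (√P.l0 : ℂ) • tensorAB P.psi0 (ket 0) + (√P.l1 : ℂ) • tensorAB P.psi1 (ket 1)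

/-- `f₃ = √(λ₀λ₁) (a₁b₀ + a₀b₁)`. -/
def f3 (P : RealParams) : ℝ := √(P.l0 * P.l1) * (P.a1 * P.b0 + P.a0 * P.b1)

/-- `f₆ = √(λ₀λ₁) (a₀a₁ - b₀b₁)`. -/
def f6 (P : RealParams) : ℝ := √(P.l0 * P.l1) * (P.a0 * P.a1 - P.b0 * P.b1)

/-- `η` is a rotation angle with `sin η = -c f₃ / √(c²f₃² + f₆²)` and
`cos η = f₆ / √(c²f₃² + f₆²)`; every angle is admitted when `c f₃ = f₆ = 0`. -/
def IsAngle (P : RealParams) (η : ℝ) : Prop :=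
  √(P.c ^ 2 * P.f3 ^ 2 + P.f6 ^ 2) * Real.sin η = -(P.c * P.f3) ∧
    √(P.c ^ 2 * P.f3 ^ 2 + P.f6 ^ 2) * Real.cos η = P.f6

end RealParams

/-! ### Separable states of rank two -/

/-- The qubit vector `cos t |0⟩ + sin t |1⟩`. -/
def qubit (t : ℝ) : Fin 2 → ℂ := (Real.cos t : ℂ) • ket 0 + (Real.sin t : ℂ) • ket 1

/-- `q |0⟩⟨0| ⊗ |0⟩⟨0| + (1-q) |ψ⟩⟨ψ| ⊗ |φ⟩⟨φ|` with `ψ = cos α|0⟩ + sin α|1⟩` and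
`φ = cos β|0⟩ + sin β|1⟩`. -/
def sepState (q α β : ℝ) : Matrix (Fin 2 × Fin 2) (Fin 2 × Fin 2) ℂ :=
  (q : ℂ) • (proj (ket 0) ⊗ₖ proj (ket 0)) +
    ((1 - q : ℝ) : ℂ) • (proj (qubit α) ⊗ₖ proj (qubit β))

/-- The purification `√q |0⟩|0⟩|0⟩ + √(1-q) |ψ⟩|φ⟩|1⟩` of `sepState q α β`. -/
def sepPurification (q α β : ℝ) : Fin 2 × Fin 2 × Fin 2 → ℂ :=
  (√q : ℂ) • tensorAB (tensor (ket 0) (ket 0)) (ket 0) +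
    (√(1 - q) : ℂ) • tensorAB (tensor (qubit α) (qubit β)) (ket 1)

/-- The line `y₂ = 0`, `y₃ cos β + y₁ sin β = cos β`; that is, `y₃ + y₁ tan β = 1` when
`β ≠ π/2`, and `y₁ = 0` when `β = π/2`. -/
def steeringLine (β : ℝ) : Set E3 :=
  {y | y 1 = 0 ∧ y 2 * Real.cos β + y 0 * Real.sin β = Real.cos β ∧
    (β ≠ Real.pi / 2 → y 2 + y 0 * Real.tan β = 1)}

/-- The von Neumann measurement `effect x, effect (-x)` on `A` gives an equi-entropy decomposition
of `ρ^B` into two distinct states: both outcomes occur, and the two Bloch vectors are distinct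
and of the same length. -/
def IsEquiEntropyMeasurement (ρ : Matrix (Fin 2 × Fin 2) (Fin 2 × Fin 2) ℂ) (x : E3) : Prop :=
  IsVonNeumann x ∧ 0 < postProb ρ (effect x) ∧ 0 < postProb ρ (effect (-x)) ∧
    bloch (postState ρ (effect x)) ≠ bloch (postState ρ (effect (-x))) ∧
    ‖bloch (postState ρ (effect x))‖ = ‖bloch (postState ρ (effect (-x)))‖

end QState

end

noncomputable section

namespace QState

/-! ### The binary entropy as a function of the concurrence -/

/-! Every state considered is a reduction of a three-qubit vector with real coefficients `T`. A
rank-one operator on A built from `u` steers BC to the pure state `∑ uₐ φₐ`, where `φₐ` are the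
A-slices; its unnormalized concurrence is `|uᵀ τ u|` for one real symmetric 2×2 matrix `tau T`. Pure
ensembles of `ρ^{BC}` and measurements on A thus lead to the same minimization, and every entropy
involved is `concEntropy` of a concurrence.

Let `t₁, t₂` be the eigenvalues of `τ`. In an eigenbasis the reverse triangle inequality gives
`|t₁u₁² + t₂u₂²| ≥ ±(|t₁||u₁|² - |t₂||u₂|²)`. The right side is linear in the measurement operator,
so over a complete measurement it sums to `||t₁| - |t₂||`: this is `|tr τ|` if `det τ ≤ 0` and
`√((tr τ)² - 4 det τ)` if `det τ > 0`. The linear functional is `exists_conc_witness`. Since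
`concEntropy` is convex and nondecreasing on `[0, 1]`, the bound on average concurrence becomes a
bound on average entropy (`concEntropy_le_sum`). Both bounds are attained by a von Neumann
measurement whose two outcomes have equal concurrence (`exists_hasConcSq`): a real one if `det τ ≤
0`, the one along `σ₂` otherwise. This yields `concurrence_eq`, `eof_eq` and `isLeast_avgEntropies`;
cases (i) and (ii) are the two signs of `det τ`.

For the geometry, `Rᵀ` sends `(1/2, x)` to `p (1, y)`, with `y` the Bloch vector of the outcome, and
`(1, 0)` to `(1, B)`. The steering ellipsoid is therefore the projective image of the light cone,
and each von Neumann measurement cuts out a chord through `B`. The angle is the one for which the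
real equal-concurrence measurement gives the chord parallel to the `y₁` axis
(`RealParams.chord_direction`). Invertibility of `R` comes from a factorization of `det R`: each
vanishing factor lets `ρ^{AB}` be written as a sum of two product vectors.

In the separable family one slice is a product vector, so `det τ ≤ 0` throughout, and the ellipsoid
degenerates to a piece of a line. -/

theorem H_eq_binEntropy (x : ℝ) : H x = Real.binEntropy x / Real.log 2 := by
  simp only [H, Real.binEntropy, Real.logb, Real.log_inv]
  ring

theorem H_one_sub (x : ℝ) : H (1 - x) = H x := by
  simp only [H_eq_binEntropy, Real.binEntropy_one_sub]

/-- The entropy of a qubit state `ρ` with `2 √(det ρ) = C`. -/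
def concEntropy (C : ℝ) : ℝ := H ((1 + √(1 - C ^ 2)) / 2)

theorem continuous_concEntropy : Continuous concEntropy := by
  have : concEntropy = fun C => Real.binEntropy ((1 + √(1 - C ^ 2)) / 2) / Real.log 2 := by
    funext C; simp only [concEntropy, H_eq_binEntropy]
  rw [this]
  have := Real.binEntropy_continuous
  fun_prop

theorem hasDerivAt_sqrt_one_sub_sq {C : ℝ} (hC : C ∈ Set.Ioo (0 : ℝ) 1) :
    HasDerivAt (fun C : ℝ => √(1 - C ^ 2)) (-C / √(1 - C ^ 2)) C := by
  have h1 : 1 - C ^ 2 ≠ 0 := by nlinarith [hC.1, hC.2]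
  have h2 := (((hasDerivAt_id C).pow 2).const_sub 1).sqrt (by simpa using h1)
  refine h2.congr_deriv ?_
  have : √(1 - C ^ 2) ≠ 0 := by
    rw [Real.sqrt_ne_zero']; nlinarith [hC.1, hC.2]
  simp
  field_simp

theorem sqrt_one_sub_sq_mem {C : ℝ} (hC : C ∈ Set.Ioo (0 : ℝ) 1) :
    √(1 - C ^ 2) ∈ Set.Ioo (0 : ℝ) 1 := by
  have : 0 < 1 - C ^ 2 := by nlinarith [hC.1, hC.2]
  refine ⟨Real.sqrt_pos.2 this, ?_⟩
  rw [Real.sqrt_lt' one_pos]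
  nlinarith [hC.1]

/-- The derivative of `concEntropy` on `(0, 1)`. -/
def concEntropyDeriv (C : ℝ) : ℝ :=
  C * (Real.log (1 + √(1 - C ^ 2)) - Real.log (1 - √(1 - C ^ 2))) /
    (2 * √(1 - C ^ 2) * Real.log 2)

theorem hasDerivAt_concEntropy {C : ℝ} (hC : C ∈ Set.Ioo (0 : ℝ) 1) :
    HasDerivAt concEntropy (concEntropyDeriv C) C := by
  have hs := sqrt_one_sub_sq_mem hC
  have hd := hasDerivAt_sqrt_one_sub_sq hC
  have h1 : HasDerivAt (fun C : ℝ => (1 + √(1 - C ^ 2)) / 2) (-C / √(1 - C ^ 2) / 2) C :=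
    (hd.const_add 1).div_const 2
  have h2 := (Real.hasDerivAt_binEntropy (p := (1 + √(1 - C ^ 2)) / 2)
    (by linarith [hs.1]) (by linarith [hs.2])).comp C h1
  have h3 := h2.div_const (Real.log 2)
  have h4 : concEntropy = fun C => (Real.binEntropy ∘ fun C : ℝ => (1 + √(1 - C ^ 2)) / 2) C /
      Real.log 2 := by
    funext C; simp only [concEntropy, H_eq_binEntropy, Function.comp]
  rw [h4]
  refine h3.congr_deriv ?_
  have e1 : 1 - (1 + √(1 - C ^ 2)) / 2 = (1 - √(1 - C ^ 2)) / 2 := by ring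
  rw [e1, Real.log_div (by linarith [hs.2]) two_ne_zero,
    Real.log_div (by linarith [hs.1]) two_ne_zero, concEntropyDeriv]
  have := hs.1.ne'
  have : Real.log 2 ≠ 0 := (Real.log_pos one_lt_two).ne'
  field_simp
  ring

theorem hasDerivAt_concEntropyDeriv {C : ℝ} (hC : C ∈ Set.Ioo (0 : ℝ) 1) :
    HasDerivAt concEntropyDeriv
      ((Real.log (1 + √(1 - C ^ 2)) - Real.log (1 - √(1 - C ^ 2)) - 2 * √(1 - C ^ 2)) /
        (2 * √(1 - C ^ 2) ^ 3 * Real.log 2)) C := by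
  have hs := sqrt_one_sub_sq_mem hC
  have hd := hasDerivAt_sqrt_one_sub_sq hC
  have hsq : √(1 - C ^ 2) ^ 2 = 1 - C ^ 2 := Real.sq_sqrt (by nlinarith [hC.1, hC.2])
  have h1 := (hd.const_add 1).log (by linarith [hs.1])
  have h2 := (hd.const_sub 1).log (by linarith [hs.2])
  have hl : Real.log 2 ≠ 0 := (Real.log_pos one_lt_two).ne'
  have hs0 := hs.1.ne'
  have h3 := ((hasDerivAt_id C).mul (h1.sub h2)).div ((hd.const_mul 2).mul_const (Real.log 2))
    (by positivity)
  refine h3.congr_deriv ?_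
  simp only [id, Pi.sub_apply, Pi.mul_apply]
  set s := √(1 - C ^ 2) with hsdef
  set L := Real.log (1 + s) - Real.log (1 - s) with hL
  have hp : 1 + s ≠ 0 := by linarith [hs.1]
  have hm : 1 - s ≠ 0 := by linarith [hs.2]
  -- The derivative of `L` collapses because `(1 + s)(1 - s) = C ^ 2`.
  have e : -C / s / (1 + s) - -(-C / s) / (1 - s) = -(2 / (C * s)) := by
    have hC0 := hC.1.ne'
    have : C ^ 2 = (1 + s) * (1 - s) := by nlinarith
    field_simp
    rw [this]; ring
  rw [e]
  have hC0 := hC.1.ne'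
  have hC2 : C ^ 2 = 1 - s ^ 2 := by linarith
  field_simp
  rw [hC2]
  ring

/-- The left side is the leading term of the series `2 ∑ s^(2k+1)/(2k+1)`, all of whose terms are
nonnegative. -/
theorem two_mul_le_log_sub_log {s : ℝ} (hs : s ∈ Set.Ioo (0 : ℝ) 1) :
    2 * s ≤ Real.log (1 + s) - Real.log (1 - s) := by
  have h := Real.hasSum_log_sub_log_of_abs_lt_one (x := s) (by rw [abs_of_pos hs.1]; exact hs.2)
  have := le_hasSum h 0 (fun k _ => by have := hs.1; positivity)
  simpa using this

/-- With `s = √(1 - C²)`, the numerator of the second derivative is `log((1+s)/(1-s)) - 2s`, which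
the series bound makes nonnegative. Only the open interval needs derivatives, so the endpoints,
where `s` is 0 or 1, cause no trouble. -/
theorem convexOn_concEntropy : ConvexOn ℝ (Set.Icc 0 1) concEntropy := by
  refine convexOn_of_hasDerivWithinAt2_nonneg (convex_Icc 0 1)
    continuous_concEntropy.continuousOn (f' := concEntropyDeriv) (f'' := fun C =>
      (Real.log (1 + √(1 - C ^ 2)) - Real.log (1 - √(1 - C ^ 2)) - 2 * √(1 - C ^ 2)) /
        (2 * √(1 - C ^ 2) ^ 3 * Real.log 2)) ?_ ?_ ?_
  · intro x hx
    rw [interior_Icc] at hx ⊢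
    exact (hasDerivAt_concEntropy hx).hasDerivWithinAt
  · intro x hx
    rw [interior_Icc] at hx ⊢
    exact (hasDerivAt_concEntropyDeriv hx).hasDerivWithinAt
  · intro x hx
    rw [interior_Icc] at hx
    have hs := sqrt_one_sub_sq_mem hx
    have := two_mul_le_log_sub_log hs
    have hl := Real.log_pos one_lt_two
    have := hs.1
    exact div_nonneg (by linarith) (by positivity)

theorem monotoneOn_concEntropy : MonotoneOn concEntropy (Set.Icc 0 1) := by
  refine monotoneOn_of_deriv_nonneg (convex_Icc 0 1) continuous_concEntropy.continuousOn ?_ ?_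
  · intro x hx
    rw [interior_Icc] at hx
    exact (hasDerivAt_concEntropy hx).differentiableAt.differentiableWithinAt
  · intro x hx
    rw [interior_Icc] at hx
    rw [(hasDerivAt_concEntropy hx).deriv]
    have hs := sqrt_one_sub_sq_mem hx
    have := two_mul_le_log_sub_log hs
    have hl := Real.log_pos one_lt_two
    have := hs.1
    exact div_nonneg (mul_nonneg hx.1.le (by linarith)) (by positivity)

/-- Jensen's inequality for `concEntropy`, combined with its monotonicity. -/
theorem concEntropy_le_sum {ι : Type*} [Fintype ι] {p C : ι → ℝ} {c : ℝ}
    (hp : ∀ k, 0 ≤ p k) (hp1 : ∑ k, p k = 1) (hC : ∀ k, C k ∈ Set.Icc (0 : ℝ) 1)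
    (hc0 : 0 ≤ c) (hc : c ≤ ∑ k, p k * C k) : concEntropy c ≤ ∑ k, p k * concEntropy (C k) := by
  have hj := convexOn_concEntropy.map_sum_le (t := Finset.univ) (w := p) (p := C)
    (fun k _ => hp k) hp1 (fun k _ => hC k)
  have hm := (convex_Icc (0 : ℝ) 1).sum_mem (t := Finset.univ) (w := p) (z := C)
    (fun k _ => hp k) hp1 (fun k _ => hC k)
  simp only [smul_eq_mul] at hj hm
  exact (monotoneOn_concEntropy ⟨hc0, hc.trans hm.2⟩ hm hc).trans hj

/-! ### Positive matrices of size two -/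

theorem isHermitian_fin_two {M : Matrix (Fin 2) (Fin 2) ℂ} (h : M.IsHermitian) :
    M = !![((M 0 0).re : ℂ), (M 0 1).re + (M 0 1).im * Complex.I;
      (M 0 1).re - (M 0 1).im * Complex.I, ((M 1 1).re : ℂ)] := by
  have h0 := h.apply 0 0
  have h1 := h.apply 1 1
  have h2 := h.apply 1 0
  ext i j
  fin_cases i <;> fin_cases j
  · simpa using (Complex.conj_eq_iff_re.1 h0).symm
  · simp [Complex.re_add_im]
  · change M 1 0 = _
    rw [← h2]
    apply Complex.ext <;> simp
  · simpa using (Complex.conj_eq_iff_re.1 h1).symm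

theorem det_fin_two_re {M : Matrix (Fin 2) (Fin 2) ℂ} (h : M.IsHermitian) :
    M.det.re = (M 0 0).re * (M 1 1).re - (M 0 1).re ^ 2 - (M 0 1).im ^ 2 := by
  rw [isHermitian_fin_two h]
  simp [Matrix.det_fin_two]
  ring

theorem det_re_nonneg {M : Matrix (Fin 2) (Fin 2) ℂ} (h : M.PosSemidef) : 0 ≤ M.det.re :=
  (Complex.le_def.1 h.det_nonneg).1

theorem four_det_re_le {M : Matrix (Fin 2) (Fin 2) ℂ} (h : M.IsHermitian) :
    4 * M.det.re ≤ M.trace.re ^ 2 := by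
  rw [det_fin_two_re h, Matrix.trace_fin_two, Complex.add_re]
  nlinarith [sq_nonneg ((M 0 0).re - (M 1 1).re), sq_nonneg (M 0 1).re, sq_nonneg (M 0 1).im]

theorem trace_re_nonneg {M : Matrix (Fin 2) (Fin 2) ℂ} (h : M.PosSemidef) : 0 ≤ M.trace.re :=
  (Complex.le_def.1 h.trace_nonneg).1

theorem trace_eq_ofReal {M : Matrix (Fin 2) (Fin 2) ℂ} (h : M.IsHermitian) :
    M.trace = (M.trace.re : ℂ) := by
  rw [isHermitian_fin_two h]
  apply Complex.ext <;> simp [Matrix.trace_fin_two]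

theorem norm_bloch_sq {M : Matrix (Fin 2) (Fin 2) ℂ} (h : M.IsHermitian) :
    ‖bloch M‖ ^ 2 = M.trace.re ^ 2 - 4 * M.det.re := by
  rw [EuclideanSpace.norm_sq_eq, isHermitian_fin_two h]
  simp [bloch, pauli, Fin.sum_univ_three, Matrix.trace_fin_two, Matrix.det_fin_two]
  ring

/-- The eigenvalues are `x` and `1 - x`, so `1 - 4 det = (2x - 1)²`; the sign lost in the square
root is harmless because `H` is symmetric about `1/2`. -/
theorem entropy_eq_H {M : Matrix (Fin 2) (Fin 2) ℂ} (h : M.IsHermitian) (h1 : M.trace = 1) :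
    entropy M = H ((1 + √(1 - 4 * M.det.re)) / 2) := by
  have hd : entropy M = -∑ i, h.eigenvalues i * Real.logb 2 (h.eigenvalues i) := by
    rw [entropy, dif_pos h]
  have htr := h.trace_eq_sum_eigenvalues
  have hdet := h.det_eq_prod_eigenvalues
  rw [Fin.sum_univ_two] at hd htr
  rw [Fin.prod_univ_two] at hdet
  set x := h.eigenvalues 0
  set y := h.eigenvalues 1
  have hxy : y = 1 - x := by
    rw [h1] at htr
    have := congrArg Complex.re htr
    simp at this
    linarith
  have hdr : M.det.re = x * y := by rw [hdet]; simp
  have hH : entropy M = H x := by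
    rw [hd, H, hxy]; ring
  rw [hH, hdr, hxy, show 1 - 4 * (x * (1 - x)) = (2 * x - 1) ^ 2 by ring, Real.sqrt_sq_eq_abs]
  rcases abs_cases (2 * x - 1) with ⟨e, -⟩ | ⟨e, -⟩
  · rw [e]; congr 1; ring
  · rw [e, ← H_one_sub]; congr 1; ring

/-- The entropy of a normalized positive matrix. -/
theorem entropy_smul {M : Matrix (Fin 2) (Fin 2) ℂ} (h : M.PosSemidef) {p : ℝ} (hp : 0 < p)
    (htr : M.trace.re = p) :
    entropy ((p : ℂ)⁻¹ • M) = concEntropy (2 * √M.det.re / p) := by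
  have hH : ((p : ℂ)⁻¹ • M).IsHermitian := by
    rw [← Complex.ofReal_inv]
    exact h.isHermitian.smul (by simp [IsSelfAdjoint, Complex.conj_ofReal])
  have ht : ((p : ℂ)⁻¹ • M).trace = 1 := by
    rw [Matrix.trace_smul, trace_eq_ofReal h.isHermitian, htr, smul_eq_mul, inv_mul_cancel₀]
    exact_mod_cast hp.ne'
  have hdet : ((p : ℂ)⁻¹ • M).det.re = M.det.re / p ^ 2 := by
    rw [Matrix.det_smul, Fintype.card_fin, ← Complex.ofReal_inv, ← Complex.ofReal_pow,
      Complex.re_ofReal_mul]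
    field_simp
  rw [entropy_eq_H hH ht, hdet, concEntropy]
  congr 4
  rw [div_pow, mul_pow, Real.sq_sqrt (det_re_nonneg h)]
  ring

/-- The inequality `4 det ≤ tr²` places every concurrence in the interval on which `concEntropy` is
convex and monotone. A zero trace is covered by division by zero being zero. -/
theorem conc_mem_Icc {M : Matrix (Fin 2) (Fin 2) ℂ} (h : M.PosSemidef) :
    2 * √M.det.re / M.trace.re ∈ Set.Icc (0 : ℝ) 1 := by
  have h0 := trace_re_nonneg h
  refine ⟨by positivity, div_le_one_of_le₀ ?_ h0⟩
  have := four_det_re_le h.isHermitian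
  refine abs_le_of_sq_le_sq' ?_ h0 |>.2
  rw [mul_pow, Real.sq_sqrt (det_re_nonneg h)]
  linarith

/-- A singular positive matrix of size two has rank one. -/
theorem exists_vecMulVec_of_det_eq_zero {M : Matrix (Fin 2) (Fin 2) ℂ} (h : M.PosSemidef)
    (hd : M.det.re = 0) : ∃ u : Fin 2 → ℂ, M = Matrix.vecMulVec (star u) u := by
  have hA : 0 ≤ (M 0 0).re := (Complex.le_def.1 (h.diag_nonneg (i := 0))).1
  have hB : 0 ≤ (M 1 1).re := (Complex.le_def.1 (h.diag_nonneg (i := 1))).1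
  rw [det_fin_two_re h.isHermitian] at hd
  have hM := isHermitian_fin_two h.isHermitian
  set A := (M 0 0).re
  set B := (M 1 1).re
  set r := (M 0 1).re
  set i := (M 0 1).im
  -- If the corner entry is zero, the vanishing determinant kills the off-diagonal entries;
  -- otherwise the first row divided by `√A` is the required vector.
  rcases hA.eq_or_lt with h0 | h0
  · rw [← h0] at hd hM
    have hr : r = 0 := by nlinarith [sq_nonneg r, sq_nonneg i]
    have hi : i = 0 := by nlinarith [sq_nonneg r, sq_nonneg i]
    have hs : (√B : ℂ) * √B = B := by exact_mod_cast Real.mul_self_sqrt hB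
    refine ⟨![0, √B], ?_⟩
    rw [hM, hr, hi]
    ext a b
    fin_cases a <;> fin_cases b <;> simp [Matrix.vecMulVec_apply, hs]
  · have hs : (√A : ℂ) * √A = A := by exact_mod_cast Real.mul_self_sqrt hA
    have hs0 : (√A : ℂ) ≠ 0 := by exact_mod_cast (Real.sqrt_pos.2 h0).ne'
    have hAc : (A : ℂ) ≠ 0 := by exact_mod_cast h0.ne'
    have hB' : (B : ℂ) * A = r ^ 2 + i ^ 2 := by
      have : B * A = r ^ 2 + i ^ 2 := by linarith
      exact_mod_cast this
    have hI := Complex.I_sq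
    refine ⟨![√A, (r + i * Complex.I) / √A], ?_⟩
    rw [hM]
    ext a b
    fin_cases a <;> fin_cases b <;> simp [Matrix.vecMulVec_apply, hs]
    · field_simp
    · field_simp; ring
    · rw [div_mul_div_comm, hs, eq_div_iff hAc, hB']
      linear_combination (i : ℂ) ^ 2 * hI

/-! ### Three-qubit vectors with real coefficients -/

/-- A vector of `ABC` with real coefficients. -/
def realVec (T : Fin 2 → Fin 2 → Fin 2 → ℝ) : Fin 2 × Fin 2 × Fin 2 → ℂ :=
  fun x => (T x.1 x.2.1 x.2.2 : ℂ)

/-- The reduced state on `AB` of a real vector. -/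
def stateAB (T : Fin 2 → Fin 2 → Fin 2 → ℝ) : Matrix (Fin 2 × Fin 2) (Fin 2 × Fin 2) ℂ :=
  ptraceC (proj (realVec T))

/-- The unnormalized state of `B` after the outcome `M` of a measurement on `A`. -/
def steer (T : Fin 2 → Fin 2 → Fin 2 → ℝ) (M : Matrix (Fin 2) (Fin 2) ℂ) :
    Matrix (Fin 2) (Fin 2) ℂ :=
  ptraceFst ((M ⊗ₖ (1 : Matrix (Fin 2) (Fin 2) ℂ)) * stateAB T)

/-- Gram matrix of the `A`-slices. -/
def gram (T : Fin 2 → Fin 2 → Fin 2 → ℝ) (a a' : Fin 2) : ℝ := ∑ b, ∑ c, T a b c * T a' b c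

/-- The polar form of the determinant of the `A`-slices: on vectors `∑ uₐ φₐ` of `BC` the
concurrence is `|∑ uₐ uₐ' τₐₐ'|`. -/
def tau (T : Fin 2 → Fin 2 → Fin 2 → ℝ) (a a' : Fin 2) : ℝ :=
  T a 0 0 * T a' 1 1 + T a' 0 0 * T a 1 1 - T a 0 1 * T a' 1 0 - T a' 0 1 * T a 1 0

/-- Trace of `tau`. -/
def tauTrace (T : Fin 2 → Fin 2 → Fin 2 → ℝ) : ℝ := tau T 0 0 + tau T 1 1

/-- Determinant of `tau`. -/
def tauDet (T : Fin 2 → Fin 2 → Fin 2 → ℝ) : ℝ := tau T 0 0 * tau T 1 1 - tau T 0 1 ^ 2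

/-- The square of the concurrence of the reduced state on `BC`. -/
def concSq (T : Fin 2 → Fin 2 → Fin 2 → ℝ) : ℝ :=
  if tauDet T ≤ 0 then tauTrace T ^ 2 else tauTrace T ^ 2 - 4 * tauDet T

theorem steer_apply (T : Fin 2 → Fin 2 → Fin 2 → ℝ) (M : Matrix (Fin 2) (Fin 2) ℂ)
    (b b' : Fin 2) :
    steer T M b b' = ∑ a, ∑ a', ∑ c, M a a' * (T a' b c * T a b' c) := by
  simp only [steer, ptraceFst, stateAB, ptraceC, proj, realVec, Matrix.of_apply, Matrix.mul_apply,
    Matrix.kroneckerMap_apply, Fintype.sum_prod_type, Matrix.vecMulVec_apply, Pi.star_apply,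
    Complex.star_def, Complex.conj_ofReal, Matrix.one_apply, Finset.mul_sum]
  simp

theorem trace_ptraceFst {ι κ : Type*} [Fintype ι] [Fintype κ] (X : Matrix (ι × κ) (ι × κ) ℂ) :
    (ptraceFst X).trace = X.trace := by
  simp only [Matrix.trace, ptraceFst, Matrix.diag, Matrix.of_apply, Fintype.sum_prod_type]
  exact Finset.sum_comm

theorem postProb_stateAB (T : Fin 2 → Fin 2 → Fin 2 → ℝ) (M : Matrix (Fin 2) (Fin 2) ℂ) :
    postProb (stateAB T) M = (steer T M).trace.re := by
  rw [postProb, steer, trace_ptraceFst]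

theorem postState_stateAB (T : Fin 2 → Fin 2 → Fin 2 → ℝ) (M : Matrix (Fin 2) (Fin 2) ℂ) :
    postState (stateAB T) M = ((steer T M).trace.re : ℂ)⁻¹ • steer T M := by
  rw [postState, postProb_stateAB, steer]

/-- The C-slices act as Kraus operators on the transpose of `M`; this form makes positivity evident.
-/
theorem steer_eq_sum (T : Fin 2 → Fin 2 → Fin 2 → ℝ) (M : Matrix (Fin 2) (Fin 2) ℂ) :
    steer T M = ∑ c, (Matrix.of fun a b => (T a b c : ℂ))ᴴ * Mᵀ *
      (Matrix.of fun a b => (T a b c : ℂ)) := by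
  ext b b'
  rw [steer_apply]
  simp [Matrix.sum_apply, Matrix.mul_apply, Fin.sum_univ_two]
  ring

theorem steer_posSemidef (T : Fin 2 → Fin 2 → Fin 2 → ℝ) {M : Matrix (Fin 2) (Fin 2) ℂ}
    (h : M.PosSemidef) : (steer T M).PosSemidef := by
  rw [steer_eq_sum]
  exact Matrix.posSemidef_sum _ fun c _ => h.transpose.conjTranspose_mul_mul_same _

theorem steer_add (T : Fin 2 → Fin 2 → Fin 2 → ℝ) (M N : Matrix (Fin 2) (Fin 2) ℂ) :
    steer T (M + N) = steer T M + steer T N := by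
  ext b b'
  simp [steer_apply, add_mul, Finset.sum_add_distrib]

theorem steer_sum (T : Fin 2 → Fin 2 → Fin 2 → ℝ) {ι : Type*} [Fintype ι]
    (M : ι → Matrix (Fin 2) (Fin 2) ℂ) : steer T (∑ k, M k) = ∑ k, steer T (M k) := by
  let f : Matrix (Fin 2) (Fin 2) ℂ →+ Matrix (Fin 2) (Fin 2) ℂ :=
    AddMonoidHom.mk' (steer T) (steer_add T)
  exact map_sum f M _

theorem trace_steer (T : Fin 2 → Fin 2 → Fin 2 → ℝ) {M : Matrix (Fin 2) (Fin 2) ℂ}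
    (h : M.IsHermitian) :
    (steer T M).trace.re = (M 0 0).re * gram T 0 0 + (M 1 1).re * gram T 1 1 +
      2 * (M 0 1).re * gram T 0 1 := by
  rw [isHermitian_fin_two h]
  simp [Matrix.trace_fin_two, steer_apply, Fin.sum_univ_two, gram]
  ring

/-- For a rank-one `M` the last summand is absent and the rest is `|uᵀ τ u|²` written in the entries
of `M`. Keeping the term proportional to `det M` treats measurement operators of any rank at once,
without refining them to rank one. -/
theorem four_det_steer (T : Fin 2 → Fin 2 → Fin 2 → ℝ) {M : Matrix (Fin 2) (Fin 2) ℂ}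
    (h : M.IsHermitian) :
    4 * (steer T M).det.re =
      (tau T 0 0 * (M 0 0).re + tau T 1 1 * (M 1 1).re + 2 * tau T 0 1 * (M 0 1).re) ^ 2 -
        4 * tauDet T * (M 0 1).im ^ 2 +
      (2 * (T 0 0 0 * T 1 1 1 - T 0 1 0 * T 1 0 1 + (T 0 0 1 * T 1 1 0 - T 0 1 1 * T 1 0 0)) ^ 2 +
        4 * (T 0 0 0 * T 1 1 0 - T 0 1 0 * T 1 0 0) ^ 2 +
        4 * (T 0 0 1 * T 1 1 1 - T 0 1 1 * T 1 0 1) ^ 2 - 2 * tauDet T) *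
      ((M 0 0).re * (M 1 1).re - (M 0 1).re ^ 2 - (M 0 1).im ^ 2) := by
  rw [isHermitian_fin_two h]
  simp [Matrix.det_fin_two, steer_apply, Fin.sum_univ_two, tauDet, tau]
  ring

theorem concSq_nonneg (T : Fin 2 → Fin 2 → Fin 2 → ℝ) : 0 ≤ concSq T := by
  rw [concSq]
  split_ifs
  · positivity
  · simp only [tauTrace, tauDet]
    nlinarith [sq_nonneg (tau T 0 0 - tau T 1 1), sq_nonneg (tau T 0 1)]

/-- A linear functional of the measurement operator that bounds the concurrence of the outcome from
below, and whose value at the identity is the concurrence. -/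
theorem exists_conc_witness (T : Fin 2 → Fin 2 → Fin 2 → ℝ) :
    ∃ n₀ n₁ n₂ : ℝ, n₀ + n₁ = √(concSq T) ∧ ∀ M : Matrix (Fin 2) (Fin 2) ℂ, M.PosSemidef →
      n₀ * (M 0 0).re + n₁ * (M 1 1).re + n₂ * (M 0 1).re ≤ 2 * √(steer T M).det.re := by
  have key : ∀ {M : Matrix (Fin 2) (Fin 2) ℂ} {l : ℝ}, M.PosSemidef →
      l ^ 2 ≤ 4 * (steer T M).det.re → l ≤ 2 * √(steer T M).det.re := by
    intro M l hM hl
    have h := det_re_nonneg (steer_posSemidef T hM)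
    refine (abs_le_of_sq_le_sq' ?_ (by positivity)).2
    rwa [mul_pow, Real.sq_sqrt h, show (2 : ℝ) ^ 2 = 4 by norm_num]
  have hdet : ∀ {M : Matrix (Fin 2) (Fin 2) ℂ}, M.PosSemidef →
      0 ≤ (M 0 0).re * (M 1 1).re - (M 0 1).re ^ 2 - (M 0 1).im ^ 2 := fun hM => by
    rw [← det_fin_two_re hM.isHermitian]; exact det_re_nonneg hM
  by_cases hδ : tauDet T ≤ 0
  · obtain ⟨e, he, hs⟩ : ∃ e : ℝ, e ^ 2 = 1 ∧ e * tauTrace T = √(concSq T) := by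
      rw [concSq, if_pos hδ, Real.sqrt_sq_eq_abs]
      rcases abs_cases (tauTrace T) with ⟨h, -⟩ | ⟨h, -⟩
      · exact ⟨1, by norm_num, by rw [h, one_mul]⟩
      · exact ⟨-1, by norm_num, by rw [h]; ring⟩
    -- For `det τ ≤ 0` the functional is `± tr(τ M)`: its square is one summand of `four_det_steer`,
    -- and the other two are nonnegative.
    refine ⟨e * tau T 0 0, e * tau T 1 1, e * (2 * tau T 0 1), by rw [← hs, tauTrace]; ring, ?_⟩
    intro M hM
    refine key hM ?_
    rw [four_det_steer T hM.isHermitian]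
    have h1 := hdet hM
    have h2 : 0 ≤ -tauDet T * (M 0 1).im ^ 2 := mul_nonneg (by linarith) (sq_nonneg _)
    have h3 := mul_nonneg (show 0 ≤ 2 * (T 0 0 0 * T 1 1 1 - T 0 1 0 * T 1 0 1 +
        (T 0 0 1 * T 1 1 0 - T 0 1 1 * T 1 0 0)) ^ 2 +
        4 * (T 0 0 0 * T 1 1 0 - T 0 1 0 * T 1 0 0) ^ 2 +
        4 * (T 0 0 1 * T 1 1 1 - T 0 1 1 * T 1 0 1) ^ 2 - 2 * tauDet T by
      have : 0 ≤ -tauDet T := by linarith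
      nlinarith [sq_nonneg (T 0 0 0 * T 1 1 1 - T 0 1 0 * T 1 0 1 +
        (T 0 0 1 * T 1 1 0 - T 0 1 1 * T 1 0 0)),
        sq_nonneg (T 0 0 0 * T 1 1 0 - T 0 1 0 * T 1 0 0),
        sq_nonneg (T 0 0 1 * T 1 1 1 - T 0 1 1 * T 1 0 1)]) h1
    have h4 : (e * tau T 0 0 * (M 0 0).re + e * tau T 1 1 * (M 1 1).re +
        e * (2 * tau T 0 1) * (M 0 1).re) ^ 2 = (tau T 0 0 * (M 0 0).re +
        tau T 1 1 * (M 1 1).re + 2 * tau T 0 1 * (M 0 1).re) ^ 2 := by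
      linear_combination (tau T 0 0 * (M 0 0).re +
        tau T 1 1 * (M 1 1).re + 2 * tau T 0 1 * (M 0 1).re) ^ 2 * he
    linarith
  · have hc : concSq T = tauTrace T ^ 2 - 4 * tauDet T := by rw [concSq, if_neg hδ]
    push Not at hδ
    -- When the two eigenvalues of `τ` coincide, the bound to be proved is zero and the zero
    -- functional suffices.
    rcases (concSq_nonneg T).eq_or_lt with h0 | h0
    · exact ⟨0, 0, 0, by rw [← h0]; simp, fun M hM => by
        simp only [zero_mul, add_zero]; positivity⟩
    have hr := Real.sqrt_pos.2 h0
    have hr2 : √(concSq T) ^ 2 = concSq T := Real.sq_sqrt h0.le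
    set ρ := √(concSq T)
    -- In an eigenbasis of `τ` this is `±(t₁ M₁₁ - t₂ M₂₂)`, rewritten in terms of `tr τ`, `det τ`
    -- and `ρ = |t₁ - t₂|` so that it makes sense in any basis.
    refine ⟨(tauTrace T * tau T 0 0 - 2 * tauDet T) / ρ,
      (tauTrace T * tau T 1 1 - 2 * tauDet T) / ρ, 2 * tauTrace T * tau T 0 1 / ρ, ?_, ?_⟩
    · rw [← add_div, div_eq_iff hr.ne', ← sq, hr2, hc, tauTrace]; ring
    intro M hM
    refine key hM ?_
    have e1 : (tauTrace T * tau T 0 0 - 2 * tauDet T) / ρ * (M 0 0).re +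
        (tauTrace T * tau T 1 1 - 2 * tauDet T) / ρ * (M 1 1).re +
        2 * tauTrace T * tau T 0 1 / ρ * (M 0 1).re =
        (tauTrace T * (tau T 0 0 * (M 0 0).re + tau T 1 1 * (M 1 1).re +
          2 * tau T 0 1 * (M 0 1).re) - 2 * tauDet T * ((M 0 0).re + (M 1 1).re)) / ρ := by
      field_simp; ring
    rw [e1, div_pow, hr2, div_le_iff₀ h0, four_det_steer T hM.isHermitian, hc]
    have h1 := hdet hM
    have h5 : 0 ≤ (2 * (T 0 0 0 * T 1 1 1 - T 0 1 0 * T 1 0 1 +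
        (T 0 0 1 * T 1 1 0 - T 0 1 1 * T 1 0 0)) ^ 2 +
        4 * (T 0 0 0 * T 1 1 0 - T 0 1 0 * T 1 0 0) ^ 2 +
        4 * (T 0 0 1 * T 1 1 1 - T 0 1 1 * T 1 0 1) ^ 2) := by positivity
    generalize (2 * (T 0 0 0 * T 1 1 1 - T 0 1 0 * T 1 0 1 +
        (T 0 0 1 * T 1 1 0 - T 0 1 1 * T 1 0 0)) ^ 2 +
        4 * (T 0 0 0 * T 1 1 0 - T 0 1 0 * T 1 0 0) ^ 2 +
        4 * (T 0 0 1 * T 1 1 1 - T 0 1 1 * T 1 0 1) ^ 2) = K at h5 ⊢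
    rw [hc] at h0
    have h6 := mul_nonneg (mul_nonneg h5 h0.le) h1
    -- The squared term is the off-diagonal entry of the commutator of `τ` with the real part of
    -- `M`. It and the multiples of `det M` account for all the slack in the inequality.
    have h7 := mul_nonneg hδ.le (add_nonneg (mul_nonneg h1 h0.le) (mul_nonneg zero_le_two
      (sq_nonneg ((tau T 0 0 - tau T 1 1) * (M 0 1).re -
        tau T 0 1 * ((M 0 0).re - (M 1 1).re)))))
    rw [← sub_nonneg]
    refine (add_nonneg h6 (mul_nonneg zero_le_two h7)).trans_eq ?_
    simp only [tauDet, tauTrace]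
    ring

/-! ### Von Neumann measurements -/

theorem effect_eq (x : E3) : effect x = !![1 / 2 + (x 2 : ℂ), x 0 - x 1 * Complex.I;
    x 0 + x 1 * Complex.I, 1 / 2 - x 2] := by
  ext i j
  fin_cases i <;> fin_cases j <;> (simp [effect, pauli, Fin.sum_univ_three]; try ring)

theorem effect_isHermitian (x : E3) : (effect x).IsHermitian := by
  rw [effect_eq]
  ext i j
  fin_cases i <;> fin_cases j <;> simp [Matrix.conjTranspose_apply, Complex.conj_ofReal] <;> ring

theorem effect_apply_re (x : E3) : (effect x 0 0).re = 1 / 2 + x 2 ∧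
    (effect x 1 1).re = 1 / 2 - x 2 ∧ (effect x 0 1).re = x 0 ∧ (effect x 0 1).im = -x 1 := by
  rw [effect_eq]
  simp

theorem effect_add_effect_neg (x : E3) : effect x + effect (-x) = 1 := by
  rw [effect_eq, effect_eq]
  ext i j
  fin_cases i <;> fin_cases j <;> simp <;> ring

theorem IsVonNeumann.neg {x : E3} (hx : IsVonNeumann x) : IsVonNeumann (-x) := by
  simpa [IsVonNeumann] using hx

theorem effect_posSemidef {x : E3} (hx : IsVonNeumann x) : (effect x).PosSemidef := by
  have hp : effect x = (effect x)ᴴ * effect x := by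
    rw [effect_isHermitian x]
    have hx' : (x 0 : ℂ) ^ 2 + (x 1 : ℂ) ^ 2 + (x 2 : ℂ) ^ 2 = 1 / 4 := by
      have := congrArg (fun r : ℝ => (r : ℂ)) hx
      push_cast at this
      exact this
    have hI := Complex.I_sq
    rw [effect_eq]
    ext i j
    fin_cases i <;> fin_cases j <;> simp [Matrix.mul_apply, Fin.sum_univ_two]
    · linear_combination -hx' + (x 1 : ℂ) ^ 2 * hI
    · ring
    · ring
    · linear_combination -hx' + (x 1 : ℂ) ^ 2 * hI
  rw [hp]
  exact Matrix.posSemidef_conjTranspose_mul_self _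

theorem det_effect {x : E3} (hx : IsVonNeumann x) : (effect x).det.re = 0 := by
  obtain ⟨h1, h2, h3, h4⟩ := effect_apply_re x
  rw [det_fin_two_re (effect_isHermitian x), h1, h2, h3, h4]
  unfold IsVonNeumann at hx
  linarith

theorem isPOVM_effect {x : E3} (hx : IsVonNeumann x) : IsPOVM ![effect x, effect (-x)] := by
  refine ⟨?_, by simp [effect_add_effect_neg]⟩
  intro k
  fin_cases k
  · exact effect_posSemidef hx
  · exact effect_posSemidef hx.neg

theorem trace_steer_effect (T : Fin 2 → Fin 2 → Fin 2 → ℝ) (x : E3) :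
    (steer T (effect x)).trace.re = (1 / 2 + x 2) * gram T 0 0 + (1 / 2 - x 2) * gram T 1 1 +
      2 * x 0 * gram T 0 1 := by
  obtain ⟨h1, h2, h3, h4⟩ := effect_apply_re x
  rw [trace_steer T (effect_isHermitian x), h1, h2, h3]

/-- Von Neumann effects have rank one, so the `det M` term of `four_det_steer` disappears. -/
theorem four_det_steer_effect (T : Fin 2 → Fin 2 → Fin 2 → ℝ) {x : E3} (hx : IsVonNeumann x) :
    4 * (steer T (effect x)).det.re = (tau T 0 0 * (1 / 2 + x 2) + tau T 1 1 * (1 / 2 - x 2) +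
      2 * tau T 0 1 * x 0) ^ 2 - 4 * tauDet T * x 1 ^ 2 := by
  obtain ⟨h1, h2, h3, h4⟩ := effect_apply_re x
  have h0 := det_fin_two_re (effect_isHermitian x)
  rw [det_effect hx] at h0
  rw [four_det_steer T (effect_isHermitian x), ← h0, h1, h2, h3, h4]
  ring

/-- A measurement with real coefficients whose direction is orthogonal to a suitable vector produces
two states of the same concurrence. -/
theorem four_det_steer_effect_of_orthogonal {T : Fin 2 → Fin 2 → Fin 2 → ℝ}
    (hT : gram T 0 0 + gram T 1 1 = 1) {x : E3} (hx : IsVonNeumann x) (h1 : x 1 = 0)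
    (hz : x 0 * (2 * tau T 0 1 - 2 * tauTrace T * gram T 0 1) +
      x 2 * (tau T 0 0 - tau T 1 1 - tauTrace T * (gram T 0 0 - gram T 1 1)) = 0) :
    4 * (steer T (effect x)).det.re = tauTrace T ^ 2 * (steer T (effect x)).trace.re ^ 2 := by
  rw [four_det_steer_effect T hx, trace_steer_effect, ← mul_pow, h1]
  have : tau T 0 0 * (1 / 2 + x 2) + tau T 1 1 * (1 / 2 - x 2) + 2 * tau T 0 1 * x 0 =
      tauTrace T * ((1 / 2 + x 2) * gram T 0 0 + (1 / 2 - x 2) * gram T 1 1 +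
        2 * x 0 * gram T 0 1) := by
    rw [← sub_eq_zero, ← hz]
    simp only [tauTrace]
    linear_combination -((tau T 0 0 + tau T 1 1) / 2) * hT
  rw [this]
  ring

theorem trace_steer_effect_y {T : Fin 2 → Fin 2 → Fin 2 → ℝ}
    (hT : gram T 0 0 + gram T 1 1 = 1) {x : E3} (h0 : x 0 = 0) (h2 : x 2 = 0) :
    (steer T (effect x)).trace.re = 1 / 2 := by
  rw [trace_steer_effect, h0, h2]
  linarith

theorem four_det_steer_effect_y {T : Fin 2 → Fin 2 → Fin 2 → ℝ}
    (hT : gram T 0 0 + gram T 1 1 = 1) {x : E3} (hx : IsVonNeumann x) (h0 : x 0 = 0)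
    (h2 : x 2 = 0) :
    4 * (steer T (effect x)).det.re =
      (tauTrace T ^ 2 - 4 * tauDet T) * (steer T (effect x)).trace.re ^ 2 := by
  have h1 : x 1 ^ 2 = 1 / 4 := by
    unfold IsVonNeumann at hx
    rw [h0, h2] at hx
    linarith
  rw [four_det_steer_effect T hx, trace_steer_effect_y hT h0 h2, h0, h2, h1]
  simp only [tauTrace]
  ring

theorem exists_unit_orthogonal (z₁ z₃ : ℝ) :
    ∃ n₁ n₃ : ℝ, n₁ ^ 2 + n₃ ^ 2 = 1 ∧ n₁ * z₁ + n₃ * z₃ = 0 := by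
  by_cases h : z₁ ^ 2 + z₃ ^ 2 = 0
  · have h1 : z₁ = 0 := by nlinarith [sq_nonneg z₁, sq_nonneg z₃]
    have h3 : z₃ = 0 := by nlinarith [sq_nonneg z₁, sq_nonneg z₃]
    exact ⟨1, 0, by norm_num, by rw [h1, h3]; ring⟩
  · have h0 : 0 < z₁ ^ 2 + z₃ ^ 2 := lt_of_le_of_ne (by positivity) (Ne.symm h)
    have hr := Real.sq_sqrt h0.le
    have hr0 := (Real.sqrt_pos.2 h0).ne'
    refine ⟨z₃ / √(z₁ ^ 2 + z₃ ^ 2), -z₁ / √(z₁ ^ 2 + z₃ ^ 2), ?_, by ring⟩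
    rw [div_pow, div_pow, hr, ← add_div, div_eq_one_iff_eq h]
    ring

theorem exists_isVonNeumann_orthogonal (z₁ z₃ : ℝ) :
    ∃ x : E3, IsVonNeumann x ∧ x 1 = 0 ∧ x 0 * z₁ + x 2 * z₃ = 0 := by
  obtain ⟨n₁, n₃, hn, hz⟩ := exists_unit_orthogonal z₁ z₃
  refine ⟨!₂[n₁ / 2, 0, n₃ / 2], ?_, by simp, ?_⟩
  · simp only [IsVonNeumann]
    simp
    linarith
  · simp
    linarith

/-- Both outcomes of the measurement have squared concurrence `κ`. -/
def HasConcSq (T : Fin 2 → Fin 2 → Fin 2 → ℝ) (κ : ℝ) (x : E3) : Prop :=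
  4 * (steer T (effect x)).det.re = κ * (steer T (effect x)).trace.re ^ 2 ∧
    4 * (steer T (effect (-x))).det.re = κ * (steer T (effect (-x))).trace.re ^ 2

theorem hasConcSq_of_orthogonal {T : Fin 2 → Fin 2 → Fin 2 → ℝ}
    (hT : gram T 0 0 + gram T 1 1 = 1) {x : E3} (hx : IsVonNeumann x) (h1 : x 1 = 0)
    (hz : x 0 * (2 * tau T 0 1 - 2 * tauTrace T * gram T 0 1) +
      x 2 * (tau T 0 0 - tau T 1 1 - tauTrace T * (gram T 0 0 - gram T 1 1)) = 0) :
    HasConcSq T (tauTrace T ^ 2) x := by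
  refine ⟨four_det_steer_effect_of_orthogonal hT hx h1 hz,
    four_det_steer_effect_of_orthogonal hT hx.neg (by simp [h1]) ?_⟩
  simp only [PiLp.neg_apply]
  linarith

theorem hasConcSq_y {T : Fin 2 → Fin 2 → Fin 2 → ℝ}
    (hT : gram T 0 0 + gram T 1 1 = 1) {x : E3} (hx : IsVonNeumann x) (h0 : x 0 = 0)
    (h2 : x 2 = 0) : HasConcSq T (tauTrace T ^ 2 - 4 * tauDet T) x :=
  ⟨four_det_steer_effect_y hT hx h0 h2,
    four_det_steer_effect_y hT hx.neg (by simp [h0]) (by simp [h2])⟩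

theorem isVonNeumann_y : IsVonNeumann !₂[0, 1 / 2, 0] := by
  simp [IsVonNeumann]
  norm_num

/-- The minimizing measurement depends on the sign of `det τ`. In a real direction the form is
`(tr(τ M))²`, and one linear condition on the direction makes `tr(τ M)` equal to `tr τ` times the
probability. Along `σ₂` the outcomes are equiprobable and the extra term `-4 det τ · x₁²` produces
the discriminant. -/
theorem exists_hasConcSq {T : Fin 2 → Fin 2 → Fin 2 → ℝ}
    (hT : gram T 0 0 + gram T 1 1 = 1) :
    ∃ x : E3, IsVonNeumann x ∧ HasConcSq T (concSq T) x := by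
  by_cases hδ : tauDet T ≤ 0
  · obtain ⟨x, hx, h1, hz⟩ := exists_isVonNeumann_orthogonal
      (2 * tau T 0 1 - 2 * tauTrace T * gram T 0 1)
      (tau T 0 0 - tau T 1 1 - tauTrace T * (gram T 0 0 - gram T 1 1))
    refine ⟨x, hx, ?_⟩
    rw [concSq, if_pos hδ]
    exact hasConcSq_of_orthogonal hT hx h1 hz
  · refine ⟨!₂[0, 1 / 2, 0], isVonNeumann_y, ?_⟩
    rw [concSq, if_neg hδ]
    exact hasConcSq_y hT isVonNeumann_y (by simp) (by simp)

/-! ### The minimal average entropy -/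

/-- The concurrence of the outcome `M`. -/
def outcomeConc (T : Fin 2 → Fin 2 → Fin 2 → ℝ) (M : Matrix (Fin 2) (Fin 2) ℂ) : ℝ :=
  2 * √(steer T M).det.re / (steer T M).trace.re

theorem trace_mul_outcomeConc (T : Fin 2 → Fin 2 → Fin 2 → ℝ) {M : Matrix (Fin 2) (Fin 2) ℂ}
    (h : M.PosSemidef) :
    (steer T M).trace.re * outcomeConc T M = 2 * √(steer T M).det.re := by
  have hs := steer_posSemidef T h
  by_cases h0 : (steer T M).trace.re = 0
  -- An outcome of probability zero also has zero determinant, so the division by zero in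
  -- `outcomeConc` does no harm.
  · have h4 := four_det_re_le hs.isHermitian
    rw [h0] at h4
    have : (steer T M).det.re = 0 := le_antisymm (by linarith) (det_re_nonneg hs)
    rw [h0, this]
    simp
  · rw [outcomeConc]
    field_simp

theorem outcomeConc_of_four_det {T : Fin 2 → Fin 2 → Fin 2 → ℝ} {M : Matrix (Fin 2) (Fin 2) ℂ}
    {κ : ℝ} (h : M.PosSemidef) (hp : 0 < (steer T M).trace.re)
    (hκ : 4 * (steer T M).det.re = κ * (steer T M).trace.re ^ 2) : outcomeConc T M = √κ := by
  have h0 := det_re_nonneg (steer_posSemidef T h)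
  have hκ' : κ = (2 * √(steer T M).det.re / (steer T M).trace.re) ^ 2 := by
    rw [div_pow, mul_pow, Real.sq_sqrt h0, eq_div_iff (by positivity), ← hκ]
    norm_num
  rw [hκ', Real.sqrt_sq (by positivity), outcomeConc]

/-- At probability zero the normalized state is a junk value, but its weight is zero. -/
theorem trace_mul_entropy (T : Fin 2 → Fin 2 → Fin 2 → ℝ) {M : Matrix (Fin 2) (Fin 2) ℂ}
    (h : M.PosSemidef) :
    (steer T M).trace.re * entropy (((steer T M).trace.re : ℂ)⁻¹ • steer T M) =
      (steer T M).trace.re * concEntropy (outcomeConc T M) := by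
  have hs := steer_posSemidef T h
  rcases (trace_re_nonneg hs).eq_or_lt with h0 | h0
  · rw [← h0, zero_mul, zero_mul]
  · rw [entropy_smul hs h0 rfl, outcomeConc]

/-- Incomplete measurements whose missing operator is never observed satisfy the concurrence
bound. -/
theorem sqrt_concSq_le_sum (T : Fin 2 → Fin 2 → Fin 2 → ℝ) {ι : Type*} [Fintype ι]
    {M : ι → Matrix (Fin 2) (Fin 2) ℂ} (hM : ∀ k, (M k).PosSemidef)
    (hN : (1 - ∑ k, M k).PosSemidef) (h0 : steer T (1 - ∑ k, M k) = 0) :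
    √(concSq T) ≤ ∑ k, (steer T (M k)).trace.re * outcomeConc T (M k) := by
  obtain ⟨n₀, n₁, n₂, hn, hw⟩ := exists_conc_witness T
  -- On the missing operator the functional is at most `2√0 = 0`, so dropping that operator cannot
  -- lower the total below the value at the identity.
  have h1 := hw _ hN
  have h2 := Finset.sum_le_sum fun k (_ : k ∈ Finset.univ) => hw _ (hM k)
  simp only [Finset.sum_add_distrib, ← Finset.mul_sum] at h2
  simp only [trace_mul_outcomeConc T (hM _)]
  have e : ∀ a a', ((1 - ∑ k, M k) a a').re =
      ((1 : Matrix (Fin 2) (Fin 2) ℂ) a a').re - ∑ k, (M k a a').re := by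
    intro a a'
    rw [Matrix.sub_apply, Matrix.sum_apply, Complex.sub_re, Complex.re_sum]
  rw [h0, Matrix.det_zero, e, e, e] at h1
  simp only [Matrix.one_apply_eq, Matrix.one_apply_ne (zero_ne_one : (0 : Fin 2) ≠ 1),
    Complex.one_re, Complex.zero_re, Real.sqrt_zero, mul_zero] at h1
  refine le_trans ?_ (h2.trans_eq (Finset.mul_sum _ _ _))
  linarith

theorem steer_one_trace {T : Fin 2 → Fin 2 → Fin 2 → ℝ} (hT : gram T 0 0 + gram T 1 1 = 1) :
    (steer T 1).trace.re = 1 := by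
  rw [trace_steer T Matrix.isHermitian_one]
  simpa using hT

/-- The common lower bound for both entropy minimizations: complete measurements give the average
entropies on B, and incomplete ones with an unobservable remainder give the ensembles of the
complement state. -/
theorem concEntropy_le_sum_outcome {T : Fin 2 → Fin 2 → Fin 2 → ℝ}
    (hT : gram T 0 0 + gram T 1 1 = 1) {ι : Type*} [Fintype ι]
    {M : ι → Matrix (Fin 2) (Fin 2) ℂ} (hM : ∀ k, (M k).PosSemidef)
    (hN : (1 - ∑ k, M k).PosSemidef) (h0 : steer T (1 - ∑ k, M k) = 0) :
    concEntropy (√(concSq T)) ≤ ∑ k, (steer T (M k)).trace.re *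
      concEntropy (outcomeConc T (M k)) := by
  refine concEntropy_le_sum (fun k => trace_re_nonneg (steer_posSemidef T (hM k))) ?_
    (fun k => conc_mem_Icc (steer_posSemidef T (hM k))) (Real.sqrt_nonneg _)
    (sqrt_concSq_le_sum T hM hN h0)
  -- The missing operator carries no probability, so the remaining outcomes already have total
  -- weight one, as Jensen's inequality requires.
  have h1 := steer_add T (∑ k, M k) (1 - ∑ k, M k)
  rw [add_sub_cancel, h0, add_zero, steer_sum] at h1
  have h2 := steer_one_trace hT
  rw [h1, Matrix.trace_sum, Complex.re_sum] at h2
  exact h2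

theorem avgEntropy_stateAB (T : Fin 2 → Fin 2 → Fin 2 → ℝ) {n : ℕ}
    {M : Fin n → Matrix (Fin 2) (Fin 2) ℂ} (hM : ∀ k, (M k).PosSemidef) :
    avgEntropy (stateAB T) M =
      ∑ k, (steer T (M k)).trace.re * concEntropy (outcomeConc T (M k)) := by
  simp only [avgEntropy, postProb_stateAB, postState_stateAB, trace_mul_entropy T (hM _)]

theorem steer_zero (T : Fin 2 → Fin 2 → Fin 2 → ℝ) : steer T 0 = 0 := by
  ext b b'
  simp [steer_apply]

theorem trace_effect_add {T : Fin 2 → Fin 2 → Fin 2 → ℝ} (hT : gram T 0 0 + gram T 1 1 = 1)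
    (x : E3) : (steer T (effect x)).trace.re + (steer T (effect (-x))).trace.re = 1 := by
  rw [← steer_one_trace hT, ← effect_add_effect_neg x, steer_add, Matrix.trace_add, Complex.add_re]

theorem trace_mul_of_four_det {T : Fin 2 → Fin 2 → Fin 2 → ℝ} {M : Matrix (Fin 2) (Fin 2) ℂ}
    {κ : ℝ} (h : M.PosSemidef) (hκ : 4 * (steer T M).det.re = κ * (steer T M).trace.re ^ 2)
    (f : ℝ → ℝ) :
    (steer T M).trace.re * f (outcomeConc T M) = (steer T M).trace.re * f (√κ) := by
  rcases (trace_re_nonneg (steer_posSemidef T h)).eq_or_lt with h0 | h0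
  · rw [← h0, zero_mul, zero_mul]
  · rw [outcomeConc_of_four_det h h0 hκ]

theorem HasConcSq.avgEntropy_eq {T : Fin 2 → Fin 2 → Fin 2 → ℝ}
    (hT : gram T 0 0 + gram T 1 1 = 1) {x : E3} (hx : IsVonNeumann x) {κ : ℝ}
    (h : HasConcSq T κ x) :
    avgEntropy (stateAB T) ![effect x, effect (-x)] = concEntropy (√κ) := by
  rw [avgEntropy_stateAB T (isPOVM_effect hx).1, Fin.sum_univ_two]
  simp only [Matrix.cons_val_zero, Matrix.cons_val_one]
  rw [trace_mul_of_four_det (effect_posSemidef hx) h.1,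
    trace_mul_of_four_det (effect_posSemidef hx.neg) h.2, ← add_mul, trace_effect_add hT, one_mul]

/-- The bound from the witness and Jensen's inequality is met by the measurement of
`exists_hasConcSq`, where both outcomes have the same entropy. -/
theorem isLeast_avgEntropies {T : Fin 2 → Fin 2 → Fin 2 → ℝ}
    (hT : gram T 0 0 + gram T 1 1 = 1) :
    IsLeast (avgEntropies (stateAB T)) (concEntropy (√(concSq T))) := by
  constructor
  · obtain ⟨x, hx, h⟩ := exists_hasConcSq hT
    exact ⟨2, _, isPOVM_effect hx, (h.avgEntropy_eq hT hx).symm⟩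
  · rintro _ ⟨n, M, hM, rfl⟩
    rw [avgEntropy_stateAB T hM.1]
    refine concEntropy_le_sum_outcome hT hM.1 ?_ ?_
    · rw [hM.2, sub_self]; exact Matrix.PosSemidef.zero
    · rw [hM.2, sub_self, steer_zero]

/-! ### Ensembles of the complement state -/

/-- The matrix with the `A`-slices of the vector as columns. -/
def slices (T : Fin 2 → Fin 2 → Fin 2 → ℝ) : Matrix (Fin 2 × Fin 2) (Fin 2) ℂ :=
  Matrix.of fun x a => (T a x.1 x.2 : ℂ)

theorem complementState_realVec (T : Fin 2 → Fin 2 → Fin 2 → ℝ) :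
    complementState (realVec T) = slices T * (slices T)ᴴ := by
  ext x y
  simp [complementState, ptraceFst, proj, realVec, slices, Matrix.mul_apply,
    Matrix.vecMulVec_apply]

theorem slices_gram (T : Fin 2 → Fin 2 → Fin 2 → ℝ) :
    (slices T)ᴴ * slices T = Matrix.of fun a a' => (gram T a a' : ℂ) := by
  ext a a'
  simp [slices, gram, Matrix.mul_apply, Fintype.sum_prod_type]

/-- A generalized inverse of the Gram matrix of the slices. -/
theorem exists_gram_inverse {T : Fin 2 → Fin 2 → Fin 2 → ℝ} (hT : gram T 0 0 + gram T 1 1 = 1) :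
    ∃ G' : Matrix (Fin 2) (Fin 2) ℂ, G'ᴴ = G' ∧
      slices T * (G' * ((slices T)ᴴ * slices T)) = slices T ∧
      (1 - G' * ((slices T)ᴴ * slices T) * ((slices T)ᴴ * slices T) * G').PosSemidef ∧
      slices T * (1 - G' * ((slices T)ᴴ * slices T) * ((slices T)ᴴ * slices T) * G') = 0 := by
  have hH : ((slices T)ᴴ * slices T)ᴴ = (slices T)ᴴ * slices T := by
    rw [Matrix.conjTranspose_mul, Matrix.conjTranspose_conjTranspose]
  have hG := slices_gram T
  set G := (slices T)ᴴ * slices T with hGdef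
  by_cases hd : IsUnit G.det
  · have e : G⁻¹ * G = 1 := Matrix.nonsing_inv_mul G hd
    have e' : G * G⁻¹ = 1 := Matrix.mul_nonsing_inv G hd
    refine ⟨G⁻¹, by rw [Matrix.conjTranspose_nonsing_inv, hH], by rw [e, Matrix.mul_one], ?_, ?_⟩
    · rw [e, Matrix.one_mul, e', sub_self]; exact Matrix.PosSemidef.zero
    · rw [e, Matrix.one_mul, e', sub_self, Matrix.mul_zero]
  · have hd0 : G.det = 0 := by simpa using hd
    -- By Cayley–Hamilton, trace one and determinant zero make the Gram matrix idempotent, so it is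
    -- its own generalized inverse.
    have hGG : G * G = G := by
      have hsym : gram T 1 0 = gram T 0 1 := by simp only [gram, mul_comm]
      have hd1 : (gram T 0 0 : ℂ) * gram T 1 1 - gram T 0 1 * gram T 0 1 = 0 := by
        rw [hG, Matrix.det_fin_two] at hd0
        simpa [hsym] using hd0
      have hT' : (gram T 0 0 : ℂ) + gram T 1 1 = 1 := by exact_mod_cast hT
      rw [hG]
      ext a a'
      fin_cases a <;> fin_cases a' <;> simp [Matrix.mul_apply, Fin.sum_univ_two, hsym]
      · linear_combination (gram T 0 0 : ℂ) * hT' - hd1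
      · linear_combination (gram T 0 1 : ℂ) * hT'
      · linear_combination (gram T 0 1 : ℂ) * hT'
      · linear_combination (gram T 1 1 : ℂ) * hT' - hd1
    -- The Gram matrix of `S (1 - G)` is `(1 - G) G (1 - G) = 0`.
    have hS : slices T * (1 - G) = 0 := by
      rw [← Matrix.conjTranspose_mul_self_eq_zero, Matrix.conjTranspose_mul, Matrix.mul_assoc,
        ← Matrix.mul_assoc _ (slices T), ← hGdef, Matrix.mul_sub, Matrix.mul_one, hGG, sub_self,
        Matrix.mul_zero]
    refine ⟨G, hH, ?_, ?_, ?_⟩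
    · rw [hGG]
      rw [Matrix.mul_sub, Matrix.mul_one, sub_eq_zero] at hS
      exact hS.symm
    · rw [hGG, hGG, hGG]
      have : 1 - G = (1 - G)ᴴ * (1 - G) := by
        rw [Matrix.conjTranspose_sub, Matrix.conjTranspose_one, hH, Matrix.sub_mul, Matrix.one_mul,
          Matrix.mul_sub, Matrix.mul_one, hGG, sub_self, sub_zero]
      rw [this]
      exact Matrix.posSemidef_conjTranspose_mul_self _
    · rw [hGG, hGG, hGG, hS]

/-- Every ensemble of the complement state is steered by an (incomplete) measurement on `A`. -/
theorem exists_steering_of_ensemble {T : Fin 2 → Fin 2 → Fin 2 → ℝ}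
    (hT : gram T 0 0 + gram T 1 1 = 1) {n : ℕ} {X : Matrix (Fin 2 × Fin 2) (Fin n) ℂ}
    (h : X * Xᴴ = slices T * (slices T)ᴴ) :
    ∃ U : Matrix (Fin 2) (Fin n) ℂ, slices T * U = X ∧ (1 - U * Uᴴ).PosSemidef ∧
      slices T * (1 - U * Uᴴ) = 0 := by
  obtain ⟨G', hG', h1, h2, h3⟩ := exists_gram_inverse hT
  set S := slices T
  have hUU : (G' * Sᴴ * X) * (G' * Sᴴ * X)ᴴ = G' * (Sᴴ * S) * (Sᴴ * S) * G' := by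
    calc (G' * Sᴴ * X) * (G' * Sᴴ * X)ᴴ = G' * Sᴴ * (X * Xᴴ) * S * G' := by
          simp only [Matrix.conjTranspose_mul, Matrix.conjTranspose_conjTranspose, hG',
            Matrix.mul_assoc]
      _ = _ := by rw [h]; simp only [Matrix.mul_assoc]
  refine ⟨G' * Sᴴ * X, ?_, by rwa [hUU], by rwa [hUU]⟩
  -- The operator `1 - S G' Sᴴ` annihilates `S Sᴴ = X Xᴴ`, hence `X` itself; this says that `U = G'
  -- Sᴴ X` solves `S U = X`.
  have h4 : (1 - S * G' * Sᴴ) * (X * Xᴴ) = 0 := by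
    rw [h, Matrix.sub_mul, Matrix.one_mul, sub_eq_zero]
    have h5 := congrArg (· * Sᴴ) h1
    simp only [Matrix.mul_assoc] at h5 ⊢
    exact h5.symm
  rw [Matrix.mul_self_mul_conjTranspose_eq_zero, Matrix.sub_mul, Matrix.one_mul, sub_eq_zero] at h4
  simp only [Matrix.mul_assoc] at h4 ⊢
  exact h4.symm

/-- The link between the two problems: a pure state of BC in the span of the slices has as its
B-marginal the state steered by a rank-one operator on A. -/
theorem ptraceSnd_proj_slices (T : Fin 2 → Fin 2 → Fin 2 → ℝ) (u : Fin 2 → ℂ) :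
    ptraceSnd (proj (slices T *ᵥ u)) = steer T (Matrix.vecMulVec (star u) u) := by
  ext b b'
  rw [steer_apply]
  simp [ptraceSnd, proj, slices, Matrix.vecMulVec_apply, Matrix.mulVec, dotProduct,
    Fin.sum_univ_two]
  ring

theorem vecMulVec_star_posSemidef (u : Fin 2 → ℂ) :
    (Matrix.vecMulVec (star u) u).PosSemidef := by
  simpa using Matrix.posSemidef_vecMulVec_self_star (star u)

theorem ptraceSnd_proj_posSemidef (φ : Fin 2 × Fin 2 → ℂ) : (ptraceSnd (proj φ)).PosSemidef := by
  have : ptraceSnd (proj φ) = (Matrix.of fun b c => φ (b, c)) * (Matrix.of fun b c => φ (b, c))ᴴ := by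
    ext b b'
    simp [ptraceSnd, proj, Matrix.vecMulVec_apply, Matrix.mul_apply]
  rw [this]
  exact Matrix.posSemidef_self_mul_conjTranspose _

theorem trace_ptraceSnd_proj (φ : Fin 2 × Fin 2 → ℂ) :
    (ptraceSnd (proj φ)).trace = star φ ⬝ᵥ φ := by
  simp [ptraceSnd, proj, Matrix.vecMulVec_apply, Matrix.trace, dotProduct, Fintype.sum_prod_type,
    mul_comm]

theorem secondSymm_fin_two (M : Matrix (Fin 2) (Fin 2) ℂ) : secondSymm M = M.det.re := by
  rw [secondSymm]
  congr 1
  simp only [Matrix.trace_fin_two, Matrix.det_fin_two, Matrix.mul_apply, Fin.sum_univ_two]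
  ring

theorem ptraceSnd_smul {ι κ : Type*} [Fintype κ] (z : ℂ) (ρ : Matrix (ι × κ) (ι × κ) ℂ) :
    ptraceSnd (z • ρ) = z • ptraceSnd ρ := by
  ext a a'
  simp [ptraceSnd, Finset.mul_sum]

/-- The entanglement of a steered pure state of `BC`. -/
theorem steered_pure_state {T : Fin 2 → Fin 2 → Fin 2 → ℝ} {φ : Fin 2 × Fin 2 → ℂ} {p : ℝ}
    {u : Fin 2 → ℂ} (hφ : star φ ⬝ᵥ φ = 1) (hp : 0 ≤ p)
    (h : proj (slices T *ᵥ u) = (p : ℂ) • proj φ) :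
    p = (steer T (Matrix.vecMulVec (star u) u)).trace.re ∧
    p * entropy (ptraceSnd (proj φ)) =
      p * concEntropy (outcomeConc T (Matrix.vecMulVec (star u) u)) ∧
    p * (2 * √(secondSymm (ptraceSnd (proj φ)))) =
      p * outcomeConc T (Matrix.vecMulVec (star u) u) := by
  have h1 : steer T (Matrix.vecMulVec (star u) u) = (p : ℂ) • ptraceSnd (proj φ) := by
    rw [← ptraceSnd_proj_slices, h, ptraceSnd_smul]
  have h2 : (steer T (Matrix.vecMulVec (star u) u)).trace.re = p := by
    rw [h1, Matrix.trace_smul, trace_ptraceSnd_proj, hφ]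
    simp
  refine ⟨h2.symm, ?_⟩
  rcases hp.eq_or_lt with h0 | h0
  · simp [← h0]
  have hps := ptraceSnd_proj_posSemidef φ
  have hdet : (steer T (Matrix.vecMulVec (star u) u)).det.re =
      p ^ 2 * (ptraceSnd (proj φ)).det.re := by
    rw [h1, Matrix.det_smul, Fintype.card_fin, ← Complex.ofReal_pow, Complex.re_ofReal_mul]
  have hC : outcomeConc T (Matrix.vecMulVec (star u) u) = 2 * √(ptraceSnd (proj φ)).det.re := by
    rw [outcomeConc, hdet, h2, Real.sqrt_mul (sq_nonneg _), Real.sqrt_sq hp]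
    field_simp
  have hE := entropy_smul hps one_pos (by rw [trace_ptraceSnd_proj, hφ]; simp)
  rw [hC, secondSymm_fin_two]
  simp only [Complex.ofReal_one, inv_one, one_smul, div_one] at hE
  rw [hE]
  exact ⟨rfl, rfl⟩

/-- Finite ensembles of unit vectors for the state `ρ`. -/
def IsEnsemble {ι : Type*} [Fintype ι] (ρ : Matrix ι ι ℂ) {n : ℕ} (p : Fin n → ℝ)
    (φ : Fin n → ι → ℂ) : Prop :=
  (∀ k, 0 ≤ p k) ∧ ∑ k, p k = 1 ∧ (∀ k, star (φ k) ⬝ᵥ φ k = 1) ∧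
    ρ = ∑ k, (p k : ℂ) • proj (φ k)

/-- The weighted vectors `√p φ` form a matrix `X` with `X Xᴴ = ρ^{BC}`, so
`exists_steering_of_ensemble` writes them as images of vectors `u k` under the slices. The defect `1
- U Uᴴ`, transposed, is the missing measurement operator; it is annihilated by the slices and
therefore steers to zero. -/
theorem exists_measurement_of_ensemble {T : Fin 2 → Fin 2 → Fin 2 → ℝ}
    (hT : gram T 0 0 + gram T 1 1 = 1) {n : ℕ} {p : Fin n → ℝ} {φ : Fin n → Fin 2 × Fin 2 → ℂ}
    (h : IsEnsemble (complementState (realVec T)) p φ) :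
    ∃ u : Fin n → Fin 2 → ℂ,
      (∀ k, proj (slices T *ᵥ u k) = (p k : ℂ) • proj (φ k)) ∧
      (1 - ∑ k, Matrix.vecMulVec (star (u k)) (u k)).PosSemidef ∧
      steer T (1 - ∑ k, Matrix.vecMulVec (star (u k)) (u k)) = 0 := by
  obtain ⟨hp, -, -, hρ⟩ := h
  have hs : ∀ k, (√(p k) : ℂ) * √(p k) = p k := fun k => by
    exact_mod_cast Real.mul_self_sqrt (hp k)
  obtain ⟨U, hU, hpos, h0⟩ := exists_steering_of_ensemble hT
    (X := Matrix.of fun x k => (√(p k) : ℂ) * φ k x) (by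
      rw [← complementState_realVec, hρ]
      ext x y
      simp only [Matrix.mul_apply, Matrix.of_apply, Matrix.conjTranspose_apply, Matrix.sum_apply,
        Matrix.smul_apply, proj, Matrix.vecMulVec_apply, Pi.star_apply, smul_eq_mul, ← hs]
      refine Finset.sum_congr rfl fun k _ => ?_
      simp only [star_mul', Complex.star_def, Complex.conj_ofReal]
      ring)
  have hsum : 1 - ∑ k, Matrix.vecMulVec (star fun a => U a k) (fun a => U a k) =
      (1 - U * Uᴴ)ᵀ := by
    ext a a'
    simp only [Matrix.sub_apply, Matrix.sum_apply, Matrix.vecMulVec_apply, Pi.star_apply,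
      Matrix.transpose_apply, Matrix.mul_apply, Matrix.conjTranspose_apply,
      Matrix.one_apply, eq_comm, mul_comm]
  refine ⟨fun k a => U a k, ?_, ?_, ?_⟩
  · intro k
    have : slices T *ᵥ (fun a => U a k) = fun x => (√(p k) : ℂ) * φ k x := by
      funext x
      exact congrFun (congrFun hU x) k
    rw [this]
    ext x y
    simp only [proj, Matrix.vecMulVec_apply, Pi.star_apply, Matrix.smul_apply, smul_eq_mul, ← hs,
      star_mul', Complex.star_def, Complex.conj_ofReal]
    ring
  · rw [hsum]; exact hpos.transpose
  · rw [hsum]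
    ext b b'
    rw [steer_apply]
    have : ∀ a c, ∑ a', (1 - U * Uᴴ : Matrix (Fin 2) (Fin 2) ℂ) a' a * (T a' b c : ℂ) = 0 := fun a c => by
      have := congrFun (congrFun h0 (b, c)) a
      simpa only [Matrix.mul_apply, slices, Matrix.of_apply, mul_comm, Matrix.zero_apply] using this
    simp only [Matrix.transpose_apply, Matrix.zero_apply]
    refine Finset.sum_eq_zero fun a _ => ?_
    rw [Finset.sum_comm]
    refine Finset.sum_eq_zero fun c _ => ?_
    simp only [← mul_assoc, ← Finset.sum_mul, this, zero_mul]

/-- A zero vector receives weight zero and an arbitrary unit vector, so unobserved outcomes still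
fit the definition of an ensemble. -/
theorem exists_unit_proj (χ : Fin 2 × Fin 2 → ℂ) : ∃ (p : ℝ) (φ : Fin 2 × Fin 2 → ℂ), 0 ≤ p ∧
    star φ ⬝ᵥ φ = 1 ∧ proj χ = (p : ℂ) • proj φ := by
  by_cases h : χ = 0
  · refine ⟨0, Pi.single 0 1, le_rfl, by simp, ?_⟩
    ext x y
    simp [h, proj, Matrix.vecMulVec_apply]
  · have h0 : star χ ⬝ᵥ χ ≠ 0 := by rwa [Ne, dotProduct_star_self_eq_zero]
    have hnn : 0 ≤ star χ ⬝ᵥ χ := dotProduct_star_self_nonneg χ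
    have hre : star χ ⬝ᵥ χ = ((star χ ⬝ᵥ χ).re : ℂ) := by
      apply Complex.ext
      · simp
      · simpa using (Complex.le_def.1 hnn).2.symm
    have hpos : 0 ≤ (star χ ⬝ᵥ χ).re := (Complex.le_def.1 hnn).1
    set p := (star χ ⬝ᵥ χ).re
    have hs : (√p : ℂ) * √p = p := by exact_mod_cast Real.mul_self_sqrt hpos
    have hp0 : (p : ℂ) ≠ 0 := by rwa [← hre]
    refine ⟨p, ((√p : ℂ))⁻¹ • χ, hpos, ?_, ?_⟩
    · rw [star_smul, smul_dotProduct, dotProduct_smul, hre, smul_eq_mul, smul_eq_mul,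
        ← mul_assoc, star_inv₀, Complex.star_def, Complex.conj_ofReal, ← mul_inv, hs,
        inv_mul_cancel₀ hp0]
    · ext x y
      simp only [proj, Matrix.vecMulVec_apply, Matrix.smul_apply, Pi.smul_apply, Pi.star_apply,
        smul_eq_mul, star_mul', star_inv₀, Complex.star_def, Complex.conj_ofReal]
      have : (p : ℂ) * ((√p : ℂ)⁻¹ * (√p : ℂ)⁻¹) = 1 := by
        rw [← mul_inv, hs, mul_inv_cancel₀ hp0]
      linear_combination -(χ x * (starRingEnd ℂ) (χ y)) * this

/-- An ensemble of the complement state all of whose members have the same concurrence. -/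
theorem exists_ensemble_concSq {T : Fin 2 → Fin 2 → Fin 2 → ℝ}
    (hT : gram T 0 0 + gram T 1 1 = 1) :
    ∃ (p : Fin 2 → ℝ) (φ : Fin 2 → Fin 2 × Fin 2 → ℂ),
      IsEnsemble (complementState (realVec T)) p φ ∧ ∀ k,
      p k * entropy (ptraceSnd (proj (φ k))) = p k * concEntropy (√(concSq T)) ∧
      p k * (2 * √(secondSymm (ptraceSnd (proj (φ k))))) = p k * √(concSq T) := by
  obtain ⟨x, hx, h⟩ := exists_hasConcSq hT
  have hM : ∀ k, (![effect x, effect (-x)] k).PosSemidef := (isPOVM_effect hx).1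
  have hsum := (isPOVM_effect hx).2
  have hc : ∀ k, 4 * (steer T (![effect x, effect (-x)] k)).det.re =
      concSq T * (steer T (![effect x, effect (-x)] k)).trace.re ^ 2 := by
    intro k; fin_cases k
    · exact h.1
    · exact h.2
  have htr : ∑ k, (steer T (![effect x, effect (-x)] k)).trace.re = 1 := by
    rw [Fin.sum_univ_two]; exact trace_effect_add hT x
  have hd : ∀ k, (![effect x, effect (-x)] k).det.re = 0 := by
    intro k; fin_cases k
    · exact det_effect hx
    · exact det_effect hx.neg
  generalize (![effect x, effect (-x)]) = M at hM hsum hc htr hd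
  -- Both effects have rank one, so each of them steers BC to a pure state.
  choose u hu using fun k => exists_vecMulVec_of_det_eq_zero (hM k) (hd k)
  choose p φ hp hφ hproj using fun k => exists_unit_proj (slices T *ᵥ u k)
  have hpure := fun k => steered_pure_state (hφ k) (hp k) (hproj k)
  simp only [← hu] at hpure
  refine ⟨p, φ, ⟨hp, ?_, hφ, ?_⟩, ?_⟩
  · rw [← htr]; exact Finset.sum_congr rfl fun k _ => (hpure k).1
  · simp only [← hproj, complementState_realVec]
    -- Completeness of the measurement reads `∑ u uᴴ = 1`; inserting it between `S` and `Sᴴ`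
    -- recovers `ρ^{BC}`.
    have hone : ∀ a a', ∑ k, u k a * star (u k a') = (1 : Matrix (Fin 2) (Fin 2) ℂ) a a' := by
      intro a a'
      rw [Matrix.one_apply, ← ite_congr (eq_iff_iff.2 eq_comm) (fun _ => rfl) (fun _ => rfl),
        ← Matrix.one_apply, ← hsum, Matrix.sum_apply]
      refine Finset.sum_congr rfl fun k _ => ?_
      rw [hu k, Matrix.vecMulVec_apply, Pi.star_apply, mul_comm]
    have h00 := hone 0 0
    have h01 := hone 0 1
    have h10 := hone 1 0
    have h11 := hone 1 1
    rw [Fin.sum_univ_two] at h00 h01 h10 h11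
    ext y z
    simp only [Matrix.mul_apply, Matrix.conjTranspose_apply, proj, Matrix.sum_apply,
      Matrix.vecMulVec_apply, Matrix.mulVec, dotProduct, Fin.sum_univ_two, Pi.star_apply, star_add,
      star_mul']
    simp only [Matrix.one_apply_eq, Matrix.one_apply_ne (zero_ne_one : (0 : Fin 2) ≠ 1),
      Matrix.one_apply_ne (one_ne_zero : (1 : Fin 2) ≠ 0)] at h00 h01 h10 h11
    linear_combination -(slices T y 0 * star (slices T z 0)) * h00 -
      (slices T y 0 * star (slices T z 1)) * h01 - (slices T y 1 * star (slices T z 0)) * h10 -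
      (slices T y 1 * star (slices T z 1)) * h11
  · intro k
    rw [(hpure k).2.1, (hpure k).2.2, (hpure k).1]
    exact ⟨trace_mul_of_four_det (hM k) (hc k) concEntropy,
      trace_mul_of_four_det (hM k) (hc k) id⟩

/-- The infimum is attained by the ensemble steered by the optimal measurement; any other ensemble
is a steered one and obeys the witness bound. -/
theorem concurrence_eq {T : Fin 2 → Fin 2 → Fin 2 → ℝ} (hT : gram T 0 0 + gram T 1 1 = 1) :
    concurrence (complementState (realVec T)) = √(concSq T) := by
  refine IsLeast.csInf_eq ⟨?_, ?_⟩
  · obtain ⟨p, φ, h, hk⟩ := exists_ensemble_concSq hT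
    refine ⟨2, p, φ, h.1, h.2.1, h.2.2.1, h.2.2.2, ?_⟩
    simp only [(hk _).2]
    rw [← Finset.sum_mul, h.2.1, one_mul]
  · rintro _ ⟨n, p, φ, hp, hp1, hφ, hρ, rfl⟩
    obtain ⟨u, hu, hN, h0⟩ := exists_measurement_of_ensemble hT ⟨hp, hp1, hφ, hρ⟩
    refine (sqrt_concSq_le_sum T (fun k => vecMulVec_star_posSemidef (u k)) hN h0).trans_eq ?_
    refine Finset.sum_congr rfl fun k _ => ?_
    obtain ⟨h1, -, h3⟩ := steered_pure_state (hφ k) (hp k) (hu k)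
    rw [h3, ← h1]

/-- As for the concurrence, with Jensen's inequality applied to the witness bound. Its value is also
that of `isLeast_avgEntropies`, which identifies the entanglement of formation with the minimal
average entropy. -/
theorem eof_eq {T : Fin 2 → Fin 2 → Fin 2 → ℝ} (hT : gram T 0 0 + gram T 1 1 = 1) :
    eof (complementState (realVec T)) = concEntropy (√(concSq T)) := by
  refine IsLeast.csInf_eq ⟨?_, ?_⟩
  · obtain ⟨p, φ, h, hk⟩ := exists_ensemble_concSq hT
    refine ⟨2, p, φ, h.1, h.2.1, h.2.2.1, h.2.2.2, ?_⟩
    simp only [(hk _).1]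
    rw [← Finset.sum_mul, h.2.1, one_mul]
  · rintro _ ⟨n, p, φ, hp, hp1, hφ, hρ, rfl⟩
    obtain ⟨u, hu, hN, h0⟩ := exists_measurement_of_ensemble hT ⟨hp, hp1, hφ, hρ⟩
    refine (concEntropy_le_sum_outcome hT (fun k => vecMulVec_star_posSemidef (u k)) hN
      h0).trans_eq ?_
    refine Finset.sum_congr rfl fun k _ => ?_
    obtain ⟨h1, h2, -⟩ := steered_pure_state (hφ k) (hp k) (hu k)
    rw [h2, ← h1]

/-! ### The matrix `R` and separability -/

theorem steer_smul (T : Fin 2 → Fin 2 → Fin 2 → ℝ) (z : ℂ) (M : Matrix (Fin 2) (Fin 2) ℂ) :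
    steer T (z • M) = z • steer T M := by
  ext b b'
  simp [steer_apply]
  ring

theorem rMatrix_stateAB (T : Fin 2 → Fin 2 → Fin 2 → ℝ) (μ ν : Fin 4) :
    rMatrix (stateAB T) μ ν = (steer T (pauli μ) * pauli ν).trace.re := by
  simp only [rMatrix, Matrix.of_apply, steer, ptraceFst, Matrix.trace, Matrix.diag,
    Matrix.mul_apply, Matrix.kroneckerMap_apply, Fintype.sum_prod_type, Matrix.one_apply]
  congr 1
  simp only [Fin.sum_univ_two]
  simp
  ring

theorem trace_steer_effect_mul (T : Fin 2 → Fin 2 → Fin 2 → ℝ) (x : E3) (ν : Fin 4) :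
    (steer T (effect x) * pauli ν).trace.re = 1 / 2 * rMatrix (stateAB T) 0 ν +
      x 0 * rMatrix (stateAB T) 1 ν + x 1 * rMatrix (stateAB T) 2 ν +
      x 2 * rMatrix (stateAB T) 3 ν := by
  have h : (1 / 2 : ℂ) = ((1 / 2 : ℝ) : ℂ) := by norm_num
  simp only [effect, Fin.sum_univ_three, steer_add, steer_smul, Matrix.add_mul, Matrix.trace_add,
    Matrix.smul_mul, Matrix.trace_smul, Complex.add_re, smul_eq_mul, h, Complex.re_ofReal_mul,
    rMatrix_stateAB, Fin.succ_zero_eq_one, Fin.succ_one_eq_two,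
    show (2 : Fin 3).succ = 3 from rfl]
  ring

/-- Entries of the state on `AB`. -/
def entryAB (T : Fin 2 → Fin 2 → Fin 2 → ℝ) (a b a' b' : Fin 2) : ℝ :=
  T a b 0 * T a' b' 0 + T a b 1 * T a' b' 1

/-- Real coefficients make expectations with exactly one `σ₂` vanish, so `R` splits into the entry
`(2, 2)` and a 3×3 block. -/
theorem rMatrix_entries (T : Fin 2 → Fin 2 → Fin 2 → ℝ) :
    rMatrix (stateAB T) = !![
      entryAB T 0 0 0 0 + entryAB T 0 1 0 1 + entryAB T 1 0 1 0 + entryAB T 1 1 1 1,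
      2 * (entryAB T 0 0 0 1 + entryAB T 1 0 1 1), 0,
      entryAB T 0 0 0 0 - entryAB T 0 1 0 1 + entryAB T 1 0 1 0 - entryAB T 1 1 1 1;
      2 * (entryAB T 0 0 1 0 + entryAB T 0 1 1 1),
      2 * (entryAB T 0 0 1 1 + entryAB T 0 1 1 0), 0,
      2 * (entryAB T 0 0 1 0 - entryAB T 0 1 1 1);
      0, 0, 2 * (entryAB T 0 1 1 0 - entryAB T 0 0 1 1), 0;
      entryAB T 0 0 0 0 + entryAB T 0 1 0 1 - entryAB T 1 0 1 0 - entryAB T 1 1 1 1,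
      2 * (entryAB T 0 0 0 1 - entryAB T 1 0 1 1), 0,
      entryAB T 0 0 0 0 - entryAB T 0 1 0 1 - entryAB T 1 0 1 0 + entryAB T 1 1 1 1] := by
  ext μ ν
  rw [rMatrix_stateAB]
  fin_cases μ <;> fin_cases ν <;>
    (simp [pauli, Matrix.trace_fin_two, Matrix.mul_apply, Fin.sum_univ_two, steer_apply, entryAB]
     try ring)

/-- Polar form of the determinant of the `C`-slices. -/
def tauC (T : Fin 2 → Fin 2 → Fin 2 → ℝ) (c c' : Fin 2) : ℝ :=
  T 0 0 c * T 1 1 c' + T 0 0 c' * T 1 1 c - T 0 1 c * T 1 0 c' - T 0 1 c' * T 1 0 c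

/-- The entry `(2, 2)` contributes `-tr τ_C` and the 3×3 block contributes `tr τ_C` times the
discriminant of `τ_C`, the form attached to the C-slices. The factorization isolates two ways for
`R` to be singular. -/
theorem det_rMatrix (T : Fin 2 → Fin 2 → Fin 2 → ℝ) :
    (rMatrix (stateAB T)).det = -(tauC T 0 0 + tauC T 1 1) ^ 2 *
      ((tauC T 0 0 - tauC T 1 1) ^ 2 + 4 * tauC T 0 1 ^ 2) := by
  have h : ∀ a b d e f g k l m n : ℝ, (!![a, b, 0, d; e, f, 0, g; 0, 0, k, 0; l, m, 0, n] :
      Matrix (Fin 4) (Fin 4) ℝ).det =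
      k * (a * (f * n - g * m) - b * (e * n - g * l) + d * (e * m - f * l)) := by
    intros
    simp [Matrix.det_succ_row_zero, Fin.sum_univ_succ, Fin.succAbove, Matrix.submatrix]
    ring
  rw [rMatrix_entries, h]
  simp only [entryAB, tauC]
  ring

/-- The state of `AB` conditioned on the functional `w` of `C`. -/
def sliceC (T : Fin 2 → Fin 2 → Fin 2 → ℝ) (w : Fin 2 → ℂ) : Fin 2 × Fin 2 → ℂ :=
  fun x => w 0 * T x.1 x.2 0 + w 1 * T x.1 x.2 1

/-- The hypotheses say that `w` and `w'` are the rows of a unitary matrix: this is the unitary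
freedom in decomposing a state. -/
theorem stateAB_eq_add (T : Fin 2 → Fin 2 → Fin 2 → ℝ) {w w' : Fin 2 → ℂ}
    (h0 : w 0 * star (w 0) + w' 0 * star (w' 0) = 1)
    (h1 : w 1 * star (w 1) + w' 1 * star (w' 1) = 1)
    (h2 : w 0 * star (w 1) + w' 0 * star (w' 1) = 0)
    (h3 : w 1 * star (w 0) + w' 1 * star (w' 0) = 0) :
    stateAB T = proj (sliceC T w) + proj (sliceC T w') := by
  ext x y
  simp only [stateAB, ptraceC, proj, realVec, sliceC, Matrix.of_apply, Matrix.add_apply,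
    Matrix.vecMulVec_apply, Pi.star_apply, star_add, star_mul', Fin.sum_univ_two,
    Complex.star_def, Complex.conj_ofReal]
  simp only [Complex.star_def] at h0 h1 h2 h3
  linear_combination -(T x.1 x.2 0 * T y.1 y.2 0 : ℂ) * h0 - (T x.1 x.2 1 * T y.1 y.2 1 : ℂ) * h1 -
    (T x.1 x.2 0 * T y.1 y.2 1 : ℂ) * h2 - (T x.1 x.2 1 * T y.1 y.2 0 : ℂ) * h3

/-! ### Product vectors and separability -/

theorem trace_proj {ι : Type*} [Fintype ι] (u : ι → ℂ) : (proj u).trace = star u ⬝ᵥ u := by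
  simp [proj, Matrix.trace_vecMulVec, dotProduct_comm]

theorem proj_posSemidef {ι : Type*} [Fintype ι] (u : ι → ℂ) : (proj u).PosSemidef :=
  Matrix.posSemidef_vecMulVec_self_star u

theorem isDensity_proj_ket : IsDensity (proj (ket 0)) :=
  ⟨proj_posSemidef _, by simp [trace_proj, ket]⟩

theorem exists_density_proj (u : Fin 2 → ℂ) :
    ∃ (p : ℝ) (σ : Matrix (Fin 2) (Fin 2) ℂ), 0 ≤ p ∧ IsDensity σ ∧ proj u = (p : ℂ) • σ := by
  by_cases h : u = 0
  · refine ⟨0, proj (ket 0), le_rfl, isDensity_proj_ket, ?_⟩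
    ext x y
    simp [h, proj, Matrix.vecMulVec_apply]
  · have h0 : (proj u).trace ≠ 0 := by rwa [trace_proj, Ne, dotProduct_star_self_eq_zero]
    have hp := trace_re_nonneg (proj_posSemidef u)
    have hr := trace_eq_ofReal (proj_posSemidef u).isHermitian
    set p := (proj u).trace.re
    have hp0 : (p : ℂ) ≠ 0 := by rwa [← hr]
    refine ⟨p, (p : ℂ)⁻¹ • proj u, hp, ⟨?_, ?_⟩, ?_⟩
    · refine (proj_posSemidef u).smul ?_
      rw [← Complex.ofReal_inv]
      exact Complex.zero_le_real.2 (inv_nonneg.2 hp)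
    · rw [Matrix.trace_smul, hr, smul_eq_mul, inv_mul_cancel₀ hp0]
    · rw [smul_smul, mul_inv_cancel₀ hp0, one_smul]

/-- A vector of `AB` with vanishing determinant is a product vector. -/
theorem exists_product_proj {χ : Fin 2 × Fin 2 → ℂ} (h : χ (0, 0) * χ (1, 1) = χ (0, 1) * χ (1, 0)) :
    ∃ (p : ℝ) (σ τ : Matrix (Fin 2) (Fin 2) ℂ), 0 ≤ p ∧ IsDensity σ ∧ IsDensity τ ∧
      proj χ = (p : ℂ) • (σ ⊗ₖ τ) := by
  obtain ⟨u, v, huv⟩ : ∃ u v : Fin 2 → ℂ, χ = tensor u v := by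
    by_cases h0 : χ = 0
    · exact ⟨0, 0, by rw [h0]; funext x; simp [tensor]⟩
    · obtain ⟨⟨i, j⟩, hij⟩ := Function.ne_iff.1 h0
      -- A nonzero entry `(i, j)` serves as pivot: a 2×2 matrix of determinant zero is its pivot
      -- column times its pivot row, divided by the pivot.
      refine ⟨fun a => χ (a, j), fun b => χ (i, b) / χ (i, j), ?_⟩
      have hij' : χ (i, j) ≠ 0 := hij
      funext x
      obtain ⟨a, b⟩ := x
      simp only [tensor]
      rw [mul_div_assoc', eq_div_iff hij']
      fin_cases i <;> fin_cases j <;> fin_cases a <;> fin_cases b <;>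
        simp only [Fin.zero_eta, Fin.mk_one] <;>
        first | linear_combination h | linear_combination -h | ring1
  obtain ⟨p, σ, hp, hσ, hu⟩ := exists_density_proj u
  obtain ⟨q, τ, hq, hτ, hv⟩ := exists_density_proj v
  refine ⟨p * q, σ, τ, mul_nonneg hp hq, hσ, hτ, ?_⟩
  have : proj χ = proj u ⊗ₖ proj v := by
    rw [huv]
    ext x y
    simp only [proj, tensor, Matrix.vecMulVec_apply, Pi.star_apply, Matrix.kroneckerMap_apply,
      star_mul']
    ring
  rw [this, hu, hv, Matrix.smul_kronecker, Matrix.kronecker_smul, smul_smul]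
  push_cast
  rfl

theorem trace_stateAB {T : Fin 2 → Fin 2 → Fin 2 → ℝ} (hT : gram T 0 0 + gram T 1 1 = 1) :
    (stateAB T).trace = 1 := by
  have : (stateAB T).trace = ((gram T 0 0 + gram T 1 1 : ℝ) : ℂ) := by
    simp [stateAB, ptraceC, proj, realVec, Matrix.trace, Matrix.vecMulVec_apply,
      Fintype.sum_prod_type, gram, Fin.sum_univ_two]
  rw [this, hT, Complex.ofReal_one]

/-- The value of the form `τ_C` at `w` is twice the determinant of the slice, so isotropic vectors
give product slices. -/
theorem isSeparable_of_sliceC {T : Fin 2 → Fin 2 → Fin 2 → ℝ} (hT : gram T 0 0 + gram T 1 1 = 1)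
    {w w' : Fin 2 → ℂ} (hρ : stateAB T = proj (sliceC T w) + proj (sliceC T w'))
    (h : w 0 ^ 2 * tauC T 0 0 + 2 * (w 0 * w 1 * tauC T 0 1) + w 1 ^ 2 * tauC T 1 1 = 0)
    (h' : w' 0 ^ 2 * tauC T 0 0 + 2 * (w' 0 * w' 1 * tauC T 0 1) + w' 1 ^ 2 * tauC T 1 1 = 0) :
    IsSeparable (stateAB T) := by
  have key : ∀ {v : Fin 2 → ℂ},
      v 0 ^ 2 * tauC T 0 0 + 2 * (v 0 * v 1 * tauC T 0 1) + v 1 ^ 2 * tauC T 1 1 = 0 →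
      sliceC T v (0, 0) * sliceC T v (1, 1) = sliceC T v (0, 1) * sliceC T v (1, 0) := by
    intro v hv
    simp only [tauC] at hv
    push_cast at hv
    simp only [sliceC]
    linear_combination hv / 2
  obtain ⟨p, σ, τ, hp, hσ, hτ, e⟩ := exists_product_proj (key h)
  obtain ⟨q, σ', τ', hq, hσ', hτ', e'⟩ := exists_product_proj (key h')
  rw [e, e'] at hρ
  refine ⟨2, ![p, q], ![σ, σ'], ![τ, τ'], ?_, ?_, ?_, ?_, ?_⟩
  · intro k; fin_cases k
    · exact hp
    · exact hq
  · have ht := trace_stateAB hT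
    rw [hρ, Matrix.trace_add, Matrix.trace_smul, Matrix.trace_smul, Matrix.trace_kronecker,
      Matrix.trace_kronecker, hσ.2, hτ.2, hσ'.2, hτ'.2] at ht
    simp only [mul_one, smul_eq_mul] at ht
    rw [Fin.sum_univ_two]
    exact_mod_cast ht
  · intro k; fin_cases k
    · exact hσ
    · exact hσ'
  · intro k; fin_cases k
    · exact hτ
    · exact hτ'
  · rw [hρ, Fin.sum_univ_two]
    rfl

/-- Either factor of `det R` supplies an orthonormal basis of C that is isotropic for `τ_C`: a real
one when `τ_C` is traceless, and `(1, ±i)/√2` when `τ_C` is a multiple of the identity. -/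
theorem isSeparable_of_det_rMatrix_eq_zero {T : Fin 2 → Fin 2 → Fin 2 → ℝ}
    (hT : gram T 0 0 + gram T 1 1 = 1) (h : (rMatrix (stateAB T)).det = 0) :
    IsSeparable (stateAB T) := by
  rw [det_rMatrix] at h
  rcases mul_eq_zero.1 h with h | h
  · have ht : tauC T 0 0 + tauC T 1 1 = 0 := by simpa using h
    -- For a traceless form the value at `(cos(θ/2), sin(θ/2))` is `τ₀₀ cos θ + τ₀₁ sin θ`. Choose
    -- `θ` to make this vanish; the orthogonal vector then gives its negative.
    obtain ⟨n₁, n₃, hn, hz⟩ := exists_unit_orthogonal (tauC T 0 1) (tauC T 0 0)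
    obtain ⟨θ, hθ⟩ := (Complex.norm_eq_one_iff ⟨n₃, n₁⟩).1 (by
      rw [Complex.norm_eq_sqrt_sq_add_sq, add_comm, hn, Real.sqrt_one])
    have hc : Real.cos θ = n₃ := by simpa using congrArg Complex.re hθ
    have hs : Real.sin θ = n₁ := by simpa using congrArg Complex.im hθ
    have hcs := Real.sin_sq_add_cos_sq (θ / 2)
    have hc2 : n₃ = Real.cos (θ / 2) ^ 2 - Real.sin (θ / 2) ^ 2 := by
      rw [← hc, ← Real.cos_two_mul', mul_div_cancel₀ _ two_ne_zero]
    have hs2 : n₁ = 2 * Real.sin (θ / 2) * Real.cos (θ / 2) := by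
      rw [← hs, ← Real.sin_two_mul, mul_div_cancel₀ _ two_ne_zero]
    set C := Real.cos (θ / 2)
    set S := Real.sin (θ / 2)
    have hcs' : (S : ℂ) ^ 2 + (C : ℂ) ^ 2 = 1 := by exact_mod_cast hcs
    have hq : C ^ 2 * tauC T 0 0 + 2 * (C * S * tauC T 0 1) + S ^ 2 * tauC T 1 1 = 0 := by
      rw [hc2, hs2] at hz
      linear_combination hz + S ^ 2 * ht
    have hq' : S ^ 2 * tauC T 0 0 + 2 * (-S * C * tauC T 0 1) + C ^ 2 * tauC T 1 1 = 0 := by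
      rw [hc2, hs2] at hz
      linear_combination -hz + C ^ 2 * ht
    refine isSeparable_of_sliceC hT (w := ![(C : ℂ), S]) (w' := ![-(S : ℂ), C])
      (stateAB_eq_add T ?_ ?_ ?_ ?_) ?_ ?_
    · simp [Complex.conj_ofReal]; linear_combination hcs'
    · simp [Complex.conj_ofReal]; linear_combination hcs'
    · simp [Complex.conj_ofReal]; ring
    · simp [Complex.conj_ofReal]; ring
    · simp; exact_mod_cast hq
    · simp
      have := congrArg (fun r : ℝ => (r : ℂ)) hq'
      push_cast at this
      linear_combination this
  · have h1 : tauC T 0 0 = tauC T 1 1 := by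
      nlinarith [sq_nonneg (tauC T 0 0 - tauC T 1 1), sq_nonneg (tauC T 0 1)]
    have h2 : tauC T 0 1 = 0 := by
      nlinarith [sq_nonneg (tauC T 0 0 - tauC T 1 1), sq_nonneg (tauC T 0 1)]
    have hs : (√(1 / 2) : ℂ) * √(1 / 2) = 1 / 2 := by
      rw [← Complex.ofReal_mul, Real.mul_self_sqrt (by norm_num)]
      norm_num
    generalize √(1 / 2) = r at hs
    have hI := Complex.I_sq
    refine isSeparable_of_sliceC hT (w := ![(r : ℂ), r * Complex.I])
      (w' := ![(r : ℂ), -(r * Complex.I)]) (stateAB_eq_add T ?_ ?_ ?_ ?_) ?_ ?_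
    · simp [Complex.conj_ofReal]; linear_combination 2 * hs
    · simp [Complex.conj_ofReal]; linear_combination 2 * hs - 2 * r ^ 2 * hI
    · simp [Complex.conj_ofReal]
    · simp [Complex.conj_ofReal]
    · simp [h1, h2]; linear_combination (r : ℂ) ^ 2 * tauC T 1 1 * hI
    · simp [h1, h2]; linear_combination (r : ℂ) ^ 2 * tauC T 1 1 * hI

/-! ### The steering ellipsoid and its chords -/

theorem bloch_add (M N : Matrix (Fin 2) (Fin 2) ℂ) : bloch (M + N) = bloch M + bloch N := by
  ext i
  simp [bloch, Matrix.add_mul, Matrix.trace_add]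

theorem bloch_smul (r : ℝ) (M : Matrix (Fin 2) (Fin 2) ℂ) :
    bloch ((r : ℂ) • M) = r • bloch M := by
  ext i
  simp [bloch]

theorem bloch_apply (M : Matrix (Fin 2) (Fin 2) ℂ) (i : Fin 3) :
    bloch M i = (M * pauli i.succ).trace.re := rfl

theorem smul_bloch_postState {T : Fin 2 → Fin 2 → Fin 2 → ℝ} {M : Matrix (Fin 2) (Fin 2) ℂ}
    (hp : (steer T M).trace.re ≠ 0) :
    (steer T M).trace.re • bloch (postState (stateAB T) M) = bloch (steer T M) := by
  rw [postState_stateAB, ← Complex.ofReal_inv, bloch_smul, smul_smul, mul_inv_cancel₀ hp, one_smul]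

theorem bloch_steer_effect (T : Fin 2 → Fin 2 → Fin 2 → ℝ) (x : E3) (i : Fin 3) :
    bloch (steer T (effect x)) i = 1 / 2 * rMatrix (stateAB T) 0 i.succ +
      x 0 * rMatrix (stateAB T) 1 i.succ + x 1 * rMatrix (stateAB T) 2 i.succ +
      x 2 * rMatrix (stateAB T) 3 i.succ := by
  rw [bloch_apply, trace_steer_effect_mul]

theorem trace_steer_effect_rMatrix (T : Fin 2 → Fin 2 → Fin 2 → ℝ) (x : E3) :
    (steer T (effect x)).trace.re = 1 / 2 * rMatrix (stateAB T) 0 0 +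
      x 0 * rMatrix (stateAB T) 1 0 + x 1 * rMatrix (stateAB T) 2 0 +
      x 2 * rMatrix (stateAB T) 3 0 := by
  rw [← trace_steer_effect_mul]
  simp [pauli]

theorem ptraceFst_stateAB (T : Fin 2 → Fin 2 → Fin 2 → ℝ) : ptraceFst (stateAB T) = steer T 1 := by
  rw [steer, Matrix.one_kronecker_one, Matrix.one_mul]

theorem bloch_reduced (T : Fin 2 → Fin 2 → Fin 2 → ℝ) (i : Fin 3) :
    bloch (ptraceFst (stateAB T)) i = rMatrix (stateAB T) 0 i.succ := by
  rw [ptraceFst_stateAB, rMatrix_stateAB, bloch_apply]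
  rfl

theorem rMatrix_zero_zero {T : Fin 2 → Fin 2 → Fin 2 → ℝ} (hT : gram T 0 0 + gram T 1 1 = 1) :
    rMatrix (stateAB T) 0 0 = 1 := by
  rw [rMatrix_stateAB]
  simpa [pauli] using steer_one_trace hT

/-- Steering is linear on Bloch four-vectors: measurement parameters go to probability times state
parameters. -/
theorem rMatrix_transpose_mulVec_effect {T : Fin 2 → Fin 2 → Fin 2 → ℝ} {x : E3}
    (hp : (steer T (effect x)).trace.re ≠ 0) :
    (rMatrix (stateAB T))ᵀ *ᵥ ![1 / 2, x 0, x 1, x 2] = (steer T (effect x)).trace.re •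
      ![1, bloch (postState (stateAB T) (effect x)) 0,
        bloch (postState (stateAB T) (effect x)) 1,
        bloch (postState (stateAB T) (effect x)) 2] := by
  have h := smul_bloch_postState hp
  have hi : ∀ i, (steer T (effect x)).trace.re * bloch (postState (stateAB T) (effect x)) i =
      bloch (steer T (effect x)) i := fun i => congrArg (fun v : E3 => v i) h
  have h0 := hi 0
  have h1 := hi 1
  have h2 := hi 2
  rw [bloch_steer_effect] at h0 h1 h2
  have ht := trace_steer_effect_rMatrix T x
  simp only [Fin.succ_zero_eq_one, Fin.succ_one_eq_two, show (2 : Fin 3).succ = 3 from rfl]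
    at h0 h1 h2
  ext ν
  fin_cases ν <;> simp [Matrix.mulVec, dotProduct, Fin.sum_univ_four]
  · rw [ht]; ring
  · rw [h0]; ring
  · rw [h1]; ring
  · rw [h2]; ring

theorem rMatrix_transpose_mulVec_one {T : Fin 2 → Fin 2 → Fin 2 → ℝ}
    (hT : gram T 0 0 + gram T 1 1 = 1) :
    (rMatrix (stateAB T))ᵀ *ᵥ ![1, 0, 0, 0] = ![1, bloch (ptraceFst (stateAB T)) 0,
      bloch (ptraceFst (stateAB T)) 1, bloch (ptraceFst (stateAB T)) 2] := by
  ext ν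
  fin_cases ν <;> simp [Matrix.mulVec, dotProduct, Fin.sum_univ_four, bloch_reduced,
    rMatrix_zero_zero hT]

/-- A positive operator of trace zero is zero, so an impossible outcome would put the nonzero vector
`(1/2, x)` in the kernel of `Rᵀ`. -/
theorem trace_steer_effect_pos {T : Fin 2 → Fin 2 → Fin 2 → ℝ}
    (hR : IsUnit (rMatrix (stateAB T)).det) {x : E3} (hx : IsVonNeumann x) :
    0 < (steer T (effect x)).trace.re := by
  have hs := steer_posSemidef T (effect_posSemidef hx)
  refine lt_of_le_of_ne (trace_re_nonneg hs) fun h0 => ?_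
  have hz : steer T (effect x) = 0 := by
    rw [← hs.trace_eq_zero_iff, trace_eq_ofReal hs.isHermitian, ← h0, Complex.ofReal_zero]
  have hν : (rMatrix (stateAB T))ᵀ *ᵥ ![1 / 2, x 0, x 1, x 2] = 0 := by
    ext ν
    have := trace_steer_effect_mul T x ν
    rw [hz, Matrix.zero_mul, Matrix.trace_zero, Complex.zero_re] at this
    simp [Matrix.mulVec, dotProduct, Fin.sum_univ_four]
    linarith
  have := Matrix.eq_zero_of_mulVec_eq_zero
    (by rw [Matrix.det_transpose]; exact hR.ne_zero) hν
  have := congrFun this 0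
  norm_num at this

/-- The ellipsoid is the light cone seen through `Rᵀ`, so membership can be tested on a preimage. -/
theorem mem_steeringEllipsoid_iff {ρ : Matrix (Fin 2 × Fin 2) (Fin 2 × Fin 2) ℂ}
    (hR : IsUnit (rMatrix ρ).det) {y : E3} {m : Fin 4 → ℝ}
    (h : (rMatrix ρ)ᵀ *ᵥ m = ![1, y 0, y 1, y 2]) :
    y ∈ steeringEllipsoid ρ ↔ m 0 ^ 2 = m 1 ^ 2 + m 2 ^ 2 + m 3 ^ 2 := by
  have hm : ((rMatrix ρ)⁻¹)ᵀ *ᵥ ![1, y 0, y 1, y 2] = m := by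
    rw [← h, Matrix.mulVec_mulVec, ← Matrix.transpose_mul, Matrix.mul_nonsing_inv _ hR,
      Matrix.transpose_one, Matrix.one_mulVec]
  rw [steeringEllipsoid, Set.mem_ofPred_eq, Matrix.mul_assoc, ← Matrix.mulVec_mulVec,
    Matrix.dotProduct_mulVec, ← Matrix.mulVec_transpose, ← Matrix.mulVec_mulVec, hm]
  simp only [minkowski, dotProduct, Matrix.mulVec_diagonal, Fin.sum_univ_four]
  simp
  constructor <;> intro h <;> linarith

theorem rot_add (η : ℝ) (y z : E3) : rot η (y + z) = rot η y + rot η z := by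
  ext i
  fin_cases i <;> simp [rot] <;> ring

theorem rot_smul (η t : ℝ) (y : E3) : rot η (t • y) = t • rot η y := by
  ext i
  fin_cases i <;> simp [rot] <;> ring

theorem rot_injective (η : ℝ) : Function.Injective (rot η) := by
  have h : Function.LeftInverse (rot (-η)) (rot η) := by
    intro y
    have := Real.sin_sq_add_cos_sq η
    ext i
    fin_cases i <;> simp [rot]
    · linear_combination y 0 * this
    · linear_combination y 2 * this
  exact h.injective

theorem norm_rot (η : ℝ) (y : E3) : ‖rot η y‖ = ‖y‖ := by
  have := Real.sin_sq_add_cos_sq η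
  rw [EuclideanSpace.norm_eq, EuclideanSpace.norm_eq]
  congr 1
  simp [Fin.sum_univ_three, rot]
  linear_combination (y 0 ^ 2 + y 2 ^ 2) * this

theorem bloch_decomposition {T : Fin 2 → Fin 2 → Fin 2 → ℝ} {x : E3}
    (hp : (steer T (effect x)).trace.re ≠ 0) (hm : (steer T (effect (-x))).trace.re ≠ 0) :
    bloch (ptraceFst (stateAB T)) =
      (steer T (effect x)).trace.re • bloch (postState (stateAB T) (effect x)) +
      (steer T (effect (-x))).trace.re • bloch (postState (stateAB T) (effect (-x))) := by
  rw [smul_bloch_postState hp, smul_bloch_postState hm, ← bloch_add, ← steer_add,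
    effect_add_effect_neg, ptraceFst_stateAB]

/-- The ensemble produced by a von Neumann measurement is a chord of the steering ellipsoid. -/
theorem isChordDecomposition_of_measurement {T : Fin 2 → Fin 2 → Fin 2 → ℝ}
    (hT : gram T 0 0 + gram T 1 1 = 1) (hR : IsUnit (rMatrix (stateAB T)).det) {x : E3}
    (hx : IsVonNeumann x) {e : E3} {t₀ : ℝ}
    (he : bloch (postState (stateAB T) (effect x)) =
      bloch (ptraceFst (stateAB T)) + t₀ • e) (η : ℝ) :
    IsChordDecomposition (rot η '' steeringEllipsoid (stateAB T))
      (rot η (bloch (ptraceFst (stateAB T)))) (rot η e)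
      (steer T (effect x)).trace.re (steer T (effect (-x))).trace.re
      (rot η (bloch (postState (stateAB T) (effect x))))
      (rot η (bloch (postState (stateAB T) (effect (-x))))) := by
  have hp := trace_steer_effect_pos hR hx
  have hm := trace_steer_effect_pos hR hx.neg
  have hpm := trace_effect_add hT x
  have hdec := bloch_decomposition hp.ne' hm.ne'
  have hRp := rMatrix_transpose_mulVec_effect hp.ne'
  have hR1 := rMatrix_transpose_mulVec_one hT
  set p := (steer T (effect x)).trace.re
  set q := (steer T (effect (-x))).trace.re
  set y := bloch (postState (stateAB T) (effect x))
  set z := bloch (postState (stateAB T) (effect (-x)))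
  set B := bloch (ptraceFst (stateAB T))
  have hinj : Function.Injective ((rMatrix (stateAB T))ᵀ *ᵥ · : (Fin 4 → ℝ) → Fin 4 → ℝ) :=
    Matrix.mulVec_injective_of_isUnit
      ((Matrix.isUnit_iff_isUnit_det _).2 (by rwa [Matrix.det_transpose]))
  -- Equality would make `(1/2, x)` a multiple of `(1, 0, 0, 0)`, whereas `x` has length `1/2`.
  have hyB : y ≠ B := by
    intro h
    have h1 : (rMatrix (stateAB T))ᵀ *ᵥ ![1 / 2, x 0, x 1, x 2] =
        (rMatrix (stateAB T))ᵀ *ᵥ (p • ![1, 0, 0, 0]) := by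
      rw [hRp, Matrix.mulVec_smul, hR1, h]
    have h2 := hinj h1
    have a0 := congrFun h2 1
    have a1 := congrFun h2 2
    have a2 := congrFun h2 3
    simp at a0 a1 a2
    unfold IsVonNeumann at hx
    rw [a0, a1, a2] at hx
    norm_num at hx
  have ht₀ : t₀ ≠ 0 := by
    rintro rfl
    exact hyB (by rw [he]; simp)
  have hz : z = B + (-(p / q) * t₀) • e := by
    have h1 : q • z = q • (B + (-(p / q) * t₀) • e) := by
      have h2 : q • z = B - p • y := by rw [hdec]; abel
      rw [h2, he, smul_add, smul_add, smul_smul, smul_smul,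
        show q * (-(p / q) * t₀) = -(p * t₀) by field_simp, show q = 1 - p by linarith, sub_smul,
        one_smul, neg_smul]
      abel
    exact smul_right_injective E3 hm.ne' h1
  have hline : {w : E3 | w ∈ steeringEllipsoid (stateAB T) ∧ ∃ t : ℝ, w = B + t • e} = {y, z} := by
    have hmem : ∀ t : ℝ, B + t • e ∈ steeringEllipsoid (stateAB T) ↔
        t = t₀ ∨ t = -(p / q) * t₀ := by
      intro t
      -- The point of the line at parameter `t` lifts to an affine combination of the preimages of
      -- `B` and `y`, with ratio `t / t₀`.
      have h1 : (rMatrix (stateAB T))ᵀ *ᵥ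
          ((1 - t / t₀) • ![1, 0, 0, 0] + (t / t₀ / p) • ![1 / 2, x 0, x 1, x 2]) =
          ![1, (B + t • e) 0, (B + t • e) 1, (B + t • e) 2] := by
        rw [Matrix.mulVec_add, Matrix.mulVec_smul, Matrix.mulVec_smul, hRp, hR1, smul_smul,
          div_mul_cancel₀ _ hp.ne', he]
        ext i
        fin_cases i <;> simp <;> field_simp <;> ring
      rw [mem_steeringEllipsoid_iff hR h1]
      simp
      have hx' : x 0 ^ 2 + x 1 ^ 2 + x 2 ^ 2 = 1 / 4 := hx
      have h2 : (1 - t / t₀ + t / t₀ / p * 2⁻¹) ^ 2 = (t / t₀ / p * x 0) ^ 2 +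
          (t / t₀ / p * x 1) ^ 2 + (t / t₀ / p * x 2) ^ 2 ↔
          (t - t₀) * (t - -(p / q) * t₀) = 0 := by
        -- With `s = t / t₀`, the light-cone form on the line is `(1 - s)(1 + s q / p)`, so its only
        -- zeros are the two measurement outcomes.
        have h3 : (1 - t / t₀ + t / t₀ / p * 2⁻¹) ^ 2 - ((t / t₀ / p * x 0) ^ 2 +
          (t / t₀ / p * x 1) ^ 2 + (t / t₀ / p * x 2) ^ 2) =
          -(q / (p * t₀ ^ 2)) * ((t - t₀) * (t - -(p / q) * t₀)) := by
          have h4 : (t / t₀ / p * x 0) ^ 2 + (t / t₀ / p * x 1) ^ 2 + (t / t₀ / p * x 2) ^ 2 =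
              (t / t₀ / p) ^ 2 * (1 / 4) := by rw [← hx']; ring
          rw [h4]
          have hq : q = 1 - p := by linarith
          have hq0 : 1 - p ≠ 0 := by rw [← hq]; exact hm.ne'
          rw [hq]
          field_simp
          ring
        rw [← sub_eq_zero, h3, mul_eq_zero, or_iff_right]
        exact neg_ne_zero.2 (div_ne_zero hm.ne' (mul_ne_zero hp.ne' (pow_ne_zero 2 ht₀)))
      rw [h2, mul_eq_zero, sub_eq_zero, sub_eq_zero, neg_mul]
    ext w
    simp only [Set.mem_ofPred_eq, Set.mem_insert_iff, Set.mem_singleton_iff]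
    constructor
    · rintro ⟨hw, t, rfl⟩
      rcases (hmem t).1 hw with rfl | rfl
      · exact Or.inl he.symm
      · exact Or.inr hz.symm
    · rintro (rfl | rfl)
      · exact ⟨by rw [he]; exact (hmem _).2 (Or.inl rfl), t₀, he⟩
      · exact ⟨by rw [hz]; exact (hmem _).2 (Or.inr rfl), _, hz⟩
  refine ⟨?_, ?_, hp, hm, hpm, ?_⟩
  · refine (rot_injective η).ne fun h => hyB ?_
    rw [hdec, ← h, ← add_smul, hpm, one_smul]
  · rw [← Set.image_pair, ← hline]
    ext w
    constructor
    · rintro ⟨⟨v, hv, rfl⟩, t, ht⟩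
      refine ⟨v, ⟨hv, t, rot_injective η ?_⟩, rfl⟩
      rw [ht, rot_add, rot_smul]
    · rintro ⟨v, ⟨hv, t, rfl⟩, rfl⟩
      exact ⟨⟨_, hv, rfl⟩, t, by rw [rot_add, rot_smul]⟩
  · rw [← rot_smul, ← rot_smul, ← rot_add, ← hdec]

/-- Length of the Bloch vector of an outcome. -/
theorem norm_bloch_postState_sq {T : Fin 2 → Fin 2 → Fin 2 → ℝ} {M : Matrix (Fin 2) (Fin 2) ℂ}
    (hM : M.PosSemidef) (hp : 0 < (steer T M).trace.re) :
    ‖bloch (postState (stateAB T) M)‖ ^ 2 = 1 - outcomeConc T M ^ 2 := by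
  have hs := steer_posSemidef T hM
  have h := norm_bloch_sq hs.isHermitian
  rw [← smul_bloch_postState hp.ne', norm_smul, mul_pow, Real.norm_eq_abs, sq_abs] at h
  rw [outcomeConc, div_pow, mul_pow, Real.sq_sqrt (det_re_nonneg hs)]
  field_simp
  linarith

theorem HasConcSq.norm_sq {T : Fin 2 → Fin 2 → Fin 2 → ℝ} {x : E3} {κ : ℝ} (hκ : 0 ≤ κ)
    (hx : IsVonNeumann x) (h : HasConcSq T κ x) (hp : 0 < (steer T (effect x)).trace.re)
    (hm : 0 < (steer T (effect (-x))).trace.re) :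
    ‖bloch (postState (stateAB T) (effect x))‖ ^ 2 = 1 - κ ∧
      ‖bloch (postState (stateAB T) (effect (-x)))‖ ^ 2 = 1 - κ := by
  rw [norm_bloch_postState_sq (effect_posSemidef hx) hp,
    norm_bloch_postState_sq (effect_posSemidef hx.neg) hm,
    outcomeConc_of_four_det (effect_posSemidef hx) hp h.1,
    outcomeConc_of_four_det (effect_posSemidef hx.neg) hm h.2, Real.sq_sqrt hκ]
  exact ⟨rfl, rfl⟩

/-! ### Rank-two states with real parameters -/

namespace RealParams

variable {P : RealParams}

/-- The coefficients of the purification. -/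
def tensor (P : RealParams) (a b c : Fin 2) : ℝ :=
  ![![![√P.l0 * P.a0, 0], ![√P.l0 * P.b0 * P.c, -(√P.l1 * P.b1 * P.d)]],
    ![![0, √P.l1 * P.a1], ![√P.l0 * P.b0 * P.d, √P.l1 * P.b1 * P.c]]] a b c

theorem purification_eq (P : RealParams) : P.purification = realVec P.tensor := by
  funext ⟨a, b, c⟩
  fin_cases a <;> fin_cases b <;> fin_cases c <;>
    simp [purification, realVec, RealParams.tensor, tensorAB, psi0, psi1, eta, etaPerp,
      QState.tensor, ket] <;> ring

theorem Valid.sq_sqrt (h : P.Valid) : √P.l0 ^ 2 = P.l0 ∧ √P.l1 ^ 2 = P.l1 :=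
  ⟨Real.sq_sqrt h.1.le, Real.sq_sqrt h.2.1.le⟩

theorem stateAB_tensor (h : P.Valid) : stateAB P.tensor = P.rhoAB := by
  have h0 : (√P.l0 : ℂ) ^ 2 = P.l0 := by exact_mod_cast h.sq_sqrt.1
  have h1 : (√P.l1 : ℂ) ^ 2 = P.l1 := by exact_mod_cast h.sq_sqrt.2
  ext ⟨a, b⟩ ⟨a', b'⟩
  fin_cases a <;> fin_cases b <;> fin_cases a' <;> fin_cases b' <;>
    simp [stateAB, ptraceC, proj, realVec, RealParams.tensor, rhoAB, psi0, psi1, eta, etaPerp,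
      QState.tensor, ket, Matrix.vecMulVec_apply, Complex.conj_ofReal, ← h0, ← h1] <;> ring

theorem gram_tensor (h : P.Valid) : gram P.tensor 0 0 + gram P.tensor 1 1 = 1 := by
  obtain ⟨h0, h1⟩ := h.sq_sqrt
  obtain ⟨-, -, hl, ha, hb, hc⟩ := h
  simp [gram, Fin.sum_univ_two, RealParams.tensor]
  linear_combination (P.a0 ^ 2 + P.b0 ^ 2 * (P.c ^ 2 + P.d ^ 2)) * h0 +
    (P.a1 ^ 2 + P.b1 ^ 2 * (P.c ^ 2 + P.d ^ 2)) * h1 + (P.l0 * P.b0 ^ 2 + P.l1 * P.b1 ^ 2) * hc +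
    P.l0 * ha + P.l1 * hb + hl

theorem tau_tensor (P : RealParams) :
    tau P.tensor 0 0 = -(2 * √P.l0 * √P.l1 * P.a0 * P.b1 * P.d) ∧
    tau P.tensor 1 1 = -(2 * √P.l0 * √P.l1 * P.a1 * P.b0 * P.d) ∧
    tau P.tensor 0 1 = √P.l0 * √P.l1 * P.c * (P.a0 * P.b1 - P.a1 * P.b0) := by
  refine ⟨?_, ?_, ?_⟩ <;> simp [tau, RealParams.tensor] <;> ring

theorem tauTrace_tensor_sq (h : P.Valid) : tauTrace P.tensor ^ 2 =
    4 * P.l0 * P.l1 * P.d ^ 2 * (P.a0 * P.b1 + P.a1 * P.b0) ^ 2 := by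
  obtain ⟨h0, h1⟩ := h.sq_sqrt
  obtain ⟨e0, e1, -⟩ := tau_tensor P
  rw [tauTrace, e0, e1, ← h0, ← h1, h0, h1]
  linear_combination 4 * P.d ^ 2 * (P.a0 * P.b1 + P.a1 * P.b0) ^ 2 *
    (√P.l1 ^ 2 * h0 + P.l0 * h1)

/-- As `λ₀λ₁ > 0`, the sign of `det τ` is exactly what separates cases (i) and (ii). -/
theorem tauDet_tensor (h : P.Valid) : tauDet P.tensor = P.l0 * P.l1 *
    (4 * P.a0 * P.a1 * P.b0 * P.b1 * P.d ^ 2 - P.c ^ 2 * (P.a0 * P.b1 - P.a1 * P.b0) ^ 2) := by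
  obtain ⟨h0, h1⟩ := h.sq_sqrt
  obtain ⟨e0, e1, e2⟩ := tau_tensor P
  rw [tauDet, e0, e1, e2]
  linear_combination (4 * P.a0 * P.a1 * P.b0 * P.b1 * P.d ^ 2 -
    P.c ^ 2 * (P.a0 * P.b1 - P.a1 * P.b0) ^ 2) * (√P.l1 ^ 2 * h0 + P.l0 * h1)

/-- Subtracting the product term turns `(a₀b₁ + a₁b₀)²` into `(a₀b₁ - a₁b₀)²`, and then `c² + d² =
1` removes `c` and `d`. -/
theorem disc_tensor (h : P.Valid) : tauTrace P.tensor ^ 2 - 4 * tauDet P.tensor =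
    4 * P.l0 * P.l1 * (P.a0 * P.b1 - P.a1 * P.b0) ^ 2 := by
  rw [tauTrace_tensor_sq h, tauDet_tensor h]
  have := h.2.2.2.2.2
  linear_combination 4 * P.l0 * P.l1 * (P.a0 * P.b1 - P.a1 * P.b0) ^ 2 * this

theorem concSq_tensor_of_le (h : P.Valid) (hi : P.c ^ 2 * (P.a0 * P.b1 - P.a1 * P.b0) ^ 2 ≥
    4 * P.a0 * P.a1 * P.b0 * P.b1 * P.d ^ 2) : concSq P.tensor =
      4 * P.l0 * P.l1 * P.d ^ 2 * (P.a0 * P.b1 + P.a1 * P.b0) ^ 2 := by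
  rw [concSq, if_pos, tauTrace_tensor_sq h]
  rw [tauDet_tensor h]
  exact mul_nonpos_of_nonneg_of_nonpos (mul_pos h.1 h.2.1).le (by linarith)

theorem concSq_tensor_of_lt (h : P.Valid) (hi : P.c ^ 2 * (P.a0 * P.b1 - P.a1 * P.b0) ^ 2 <
    4 * P.a0 * P.a1 * P.b0 * P.b1 * P.d ^ 2) : concSq P.tensor =
      4 * P.l0 * P.l1 * (P.a0 * P.b1 - P.a1 * P.b0) ^ 2 := by
  rw [concSq, if_neg, disc_tensor h]
  rw [tauDet_tensor h, not_le]
  exact mul_pos (mul_pos h.1 h.2.1) (by linarith)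

theorem rank_two_concurrence (h : P.Valid) :
    ptraceC (proj P.purification) = P.rhoAB ∧
      (P.c ^ 2 * (P.a0 * P.b1 - P.a1 * P.b0) ^ 2 ≥ 4 * P.a0 * P.a1 * P.b0 * P.b1 * P.d ^ 2 →
        concurrence (complementState P.purification) ^ 2 =
          4 * P.l0 * P.l1 * P.d ^ 2 * (P.a0 * P.b1 + P.a1 * P.b0) ^ 2) ∧
      (P.c ^ 2 * (P.a0 * P.b1 - P.a1 * P.b0) ^ 2 < 4 * P.a0 * P.a1 * P.b0 * P.b1 * P.d ^ 2 →
        concurrence (complementState P.purification) ^ 2 =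
          4 * P.l0 * P.l1 * (P.a0 * P.b1 - P.a1 * P.b0) ^ 2) ∧
      eof (complementState P.purification) =
        H ((1 + √(1 - concurrence (complementState P.purification) ^ 2)) / 2) := by
  have hT := gram_tensor h
  rw [purification_eq, concurrence_eq hT, eof_eq hT, Real.sq_sqrt (concSq_nonneg _)]
  refine ⟨stateAB_tensor h, concSq_tensor_of_le h, concSq_tensor_of_lt h, ?_⟩
  rw [concEntropy, Real.sq_sqrt (concSq_nonneg _)]

/-- The rotation of the steering ellipsoid turns the direction of equal concurrences into a
coordinate axis. -/
theorem chord_direction (h : P.Valid) :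
    (-(rMatrix (stateAB P.tensor) 2 2) *
        (2 * tau P.tensor 0 1 - 2 * tauTrace P.tensor * gram P.tensor 0 1) =
      2 * ((rMatrix (stateAB P.tensor) 1 1 - rMatrix (stateAB P.tensor) 1 0 *
          rMatrix (stateAB P.tensor) 0 1) * (P.c * P.f3) +
        (rMatrix (stateAB P.tensor) 1 3 - rMatrix (stateAB P.tensor) 1 0 *
          rMatrix (stateAB P.tensor) 0 3) * P.f6)) ∧
    (-(rMatrix (stateAB P.tensor) 2 2) *
        (tau P.tensor 0 0 - tau P.tensor 1 1 -
          tauTrace P.tensor * (gram P.tensor 0 0 - gram P.tensor 1 1)) =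
      2 * ((rMatrix (stateAB P.tensor) 3 1 - rMatrix (stateAB P.tensor) 3 0 *
          rMatrix (stateAB P.tensor) 0 1) * (P.c * P.f3) +
        (rMatrix (stateAB P.tensor) 3 3 - rMatrix (stateAB P.tensor) 3 0 *
          rMatrix (stateAB P.tensor) 0 3) * P.f6)) := by
  obtain ⟨e0, e1, e2⟩ := tau_tensor P
  obtain ⟨h0, h1⟩ := h.sq_sqrt
  obtain ⟨hl0, hl1, hl, ha, hb, hc⟩ := h
  rw [tauTrace, e0, e1, e2, rMatrix_entries, f3, f6, Real.sqrt_mul hl0.le]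
  rw [← h0, ← h1] at hl
  simp [entryAB, gram, RealParams.tensor, Fin.sum_univ_two]
  generalize √P.l0 = u at *
  generalize √P.l1 = v at *
  -- Both identities hold modulo the four normalizations; the polynomial coefficients below exhibit
  -- each difference in the ideal they generate, with `u` and `v` the square roots of the weights.
  constructor
  · linear_combination u * v * (4 * P.a0 * P.b0 ^ 4 * P.a1 * P.c * P.d * u ^ 4 + 8 * P.a0 ^ 2
      * P.b0 ^ 3 * P.b1 * P.c * P.d * u ^ 4 + 8 * P.b0 ^ 3 * P.a1 ^ 2 * P.b1 * P.c * P.d * u ^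
      2 * v ^ 2 - 8 * P.a0 ^ 2 * P.b0 * P.b1 ^ 3 * P.c * P.d * u ^ 2 * v ^ 2 - 8 * P.b0 * P.a1
      ^ 2 * P.b1 ^ 3 * P.c * P.d * v ^ 4 - 4 * P.a0 * P.a1 * P.b1 ^ 4 * P.c * P.d * v ^ 4 + 4
      * P.b0 ^ 5 * P.b1 * P.c * P.d * u ^ 4 - 4 * P.b0 * P.b1 ^ 5 * P.c * P.d * v ^ 4) * hc +
      u * v * (4 * P.a0 * P.b0 ^ 2 * P.a1 * P.c * P.d * u ^ 4 - 4 * P.a0 * P.a1 * P.b1 ^ 2 *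
      P.c * P.d * u ^ 2 * v ^ 2 + 4 * P.b0 ^ 3 * P.b1 * P.c * P.d * u ^ 4 - 4 * P.b0 * P.b1 ^
      3 * P.c * P.d * u ^ 2 * v ^ 2) * ha + u * v * (4 * P.a0 * P.b0 ^ 2 * P.a1 * P.c * P.d *
      u ^ 2 * v ^ 2 - 4 * P.a0 * P.a1 * P.b1 ^ 2 * P.c * P.d * v ^ 4 + 4 * P.b0 ^ 3 * P.b1 *
      P.c * P.d * u ^ 2 * v ^ 2 - 4 * P.b0 * P.b1 ^ 3 * P.c * P.d * v ^ 4) * hb + u * v * (4 *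
      P.a0 * P.b0 ^ 2 * P.a1 * P.c * P.d * u ^ 2 + 4 * P.b0 ^ 3 * P.b1 * P.c * P.d * u ^ 2 - 4
      * P.a0 * P.a1 * P.b1 ^ 2 * P.c * P.d * v ^ 2 - 4 * P.b0 * P.b1 ^ 3 * P.c * P.d * v ^ 2)
      * hl
  · linear_combination u * v * (2 * P.a0 * P.b0 ^ 4 * P.a1 * P.c ^ 2 * u ^ 4 + 4 * P.a0 ^ 2 *
      P.b0 ^ 3 * P.b1 * P.c ^ 2 * u ^ 4 + 4 * P.b0 ^ 3 * P.a1 ^ 2 * P.b1 * P.c ^ 2 * u ^ 2 * v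
      ^ 2 - 4 * P.a0 ^ 2 * P.b0 * P.b1 ^ 3 * P.c ^ 2 * u ^ 2 * v ^ 2 - 4 * P.b0 * P.a1 ^ 2 *
      P.b1 ^ 3 * P.c ^ 2 * v ^ 4 - 2 * P.a0 * P.a1 * P.b1 ^ 4 * P.c ^ 2 * v ^ 4 + 2 * P.b0 ^ 5
      * P.b1 * P.c ^ 2 * u ^ 4 - 2 * P.b0 * P.b1 ^ 5 * P.c ^ 2 * v ^ 4 - 2 * P.a0 * P.b0 ^ 2 *
      P.a1 * u ^ 2 - 4 * P.a0 ^ 2 * P.b0 * P.b1 * u ^ 2 + 4 * P.b0 * P.a1 ^ 2 * P.b1 * v ^ 2 +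
      2 * P.a0 * P.a1 * P.b1 ^ 2 * v ^ 2 + 4 * P.a0 ^ 3 * P.b0 ^ 2 * P.a1 * u ^ 4 + 4 * P.a0 ^
      4 * P.b0 * P.b1 * u ^ 4 - 4 * P.b0 * P.a1 ^ 4 * P.b1 * v ^ 4 - 4 * P.a0 * P.a1 ^ 3 *
      P.b1 ^ 2 * v ^ 4 - 2 * P.b0 ^ 3 * P.b1 * u ^ 2 + 2 * P.b0 * P.b1 ^ 3 * v ^ 2 + 2 * P.a0
      * P.b0 ^ 4 * P.a1 * u ^ 4 - 2 * P.a0 * P.b0 ^ 4 * P.a1 * P.d ^ 2 * u ^ 4 + 4 * P.a0 ^ 2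
      * P.b0 ^ 3 * P.b1 * u ^ 4 - 4 * P.a0 ^ 2 * P.b0 ^ 3 * P.b1 * P.d ^ 2 * u ^ 4 - 4 * P.b0
      ^ 3 * P.a1 ^ 2 * P.b1 * P.d ^ 2 * u ^ 2 * v ^ 2 + 4 * P.a0 ^ 2 * P.b0 * P.b1 ^ 3 * P.d ^
      2 * u ^ 2 * v ^ 2 - 4 * P.b0 * P.a1 ^ 2 * P.b1 ^ 3 * v ^ 4 + 4 * P.b0 * P.a1 ^ 2 * P.b1
      ^ 3 * P.d ^ 2 * v ^ 4 - 2 * P.a0 * P.a1 * P.b1 ^ 4 * v ^ 4 + 2 * P.a0 * P.a1 * P.b1 ^ 4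
      * P.d ^ 2 * v ^ 4 + 2 * P.b0 ^ 5 * P.b1 * u ^ 4 - 2 * P.b0 ^ 5 * P.b1 * P.d ^ 2 * u ^ 4
      - 2 * P.b0 * P.b1 ^ 5 * v ^ 4 + 2 * P.b0 * P.b1 ^ 5 * P.d ^ 2 * v ^ 4) * hc + u * v * (2
      * P.a0 ^ 3 * P.a1 * u ^ 4 + 2 * P.a0 ^ 2 * P.b0 * P.b1 * u ^ 4 + 4 * P.a0 * P.a1 * P.b1
      ^ 2 * P.d ^ 2 * u ^ 2 * v ^ 2 - 2 * P.a0 * P.a1 * u ^ 2 + 2 * P.a0 * P.b0 ^ 2 * P.a1 * u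
      ^ 4 - 4 * P.a0 * P.b0 ^ 2 * P.a1 * P.d ^ 2 * u ^ 4 + 2 * P.a0 * P.a1 * u ^ 4 - 2 * P.b0
      * P.b1 * u ^ 2 - 4 * P.b0 ^ 3 * P.b1 * P.d ^ 2 * u ^ 4 + 2 * P.b0 ^ 3 * P.b1 * u ^ 4 + 4
      * P.b0 * P.b1 ^ 3 * P.d ^ 2 * u ^ 2 * v ^ 2 + 2 * P.b0 * P.b1 * u ^ 4) * ha + u * v *
      (-2 * P.a0 * P.a1 ^ 3 * v ^ 4 - 2 * P.b0 * P.a1 ^ 2 * P.b1 * v ^ 4 - 4 * P.a0 * P.b0 ^ 2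
      * P.a1 * P.d ^ 2 * u ^ 2 * v ^ 2 + 2 * P.a0 * P.a1 * v ^ 2 - 2 * P.a0 * P.a1 * P.b1 ^ 2
      * v ^ 4 + 4 * P.a0 * P.a1 * P.b1 ^ 2 * P.d ^ 2 * v ^ 4 - 2 * P.a0 * P.a1 * v ^ 4 + 2 *
      P.b0 * P.b1 * v ^ 2 + 4 * P.b0 * P.b1 ^ 3 * P.d ^ 2 * v ^ 4 - 4 * P.b0 ^ 3 * P.b1 * P.d
      ^ 2 * u ^ 2 * v ^ 2 - 2 * P.b0 * P.b1 ^ 3 * v ^ 4 - 2 * P.b0 * P.b1 * v ^ 4) * hb + u *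
      v * (-4 * P.a0 * P.b0 ^ 2 * P.a1 * P.d ^ 2 * u ^ 2 + 2 * P.a0 * P.a1 * u ^ 2 - 4 * P.b0
      ^ 3 * P.b1 * P.d ^ 2 * u ^ 2 + 2 * P.b0 * P.b1 * u ^ 2 + 4 * P.a0 * P.a1 * P.b1 ^ 2 *
      P.d ^ 2 * v ^ 2 + 4 * P.b0 * P.b1 ^ 3 * P.d ^ 2 * v ^ 2 - 2 * P.a0 * P.a1 * v ^ 2 - 2 *
      P.b0 * P.b1 * v ^ 2) * hl

end RealParams

/-! ### The two chords through the reduced state -/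

theorem chordEntropy_eq {p p' t : ℝ} {M N : E3} (hp : p + p' = 1) (hM : ‖M‖ ^ 2 = 1 - t)
    (hN : ‖N‖ ^ 2 = 1 - t) : chordEntropy p p' M N = H ((1 + √(1 - t)) / 2) := by
  rw [chordEntropy, ← Real.sqrt_sq (norm_nonneg M), ← Real.sqrt_sq (norm_nonneg N), hM, hN,
    ← add_mul, hp, one_mul]

theorem isRealized_of_measurement {T : Fin 2 → Fin 2 → Fin 2 → ℝ} {x : E3} (hx : IsVonNeumann x)
    (η : ℝ) : IsRealized (stateAB T) η (steer T (effect x)).trace.re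
      (steer T (effect (-x))).trace.re (rot η (bloch (postState (stateAB T) (effect x))))
      (rot η (bloch (postState (stateAB T) (effect (-x))))) :=
  ⟨x, hx, postProb_stateAB T _, postProb_stateAB T _, rfl, rfl⟩

theorem concEntropy_sqrt {t : ℝ} (ht : 0 ≤ t) : concEntropy (√t) = H ((1 + √(1 - t)) / 2) := by
  rw [concEntropy, Real.sq_sqrt ht]

theorem rot_single_one (η : ℝ) :
    rot η (EuclideanSpace.single 1 1) = EuclideanSpace.single 1 1 := by
  ext i
  fin_cases i <;> simp [rot]

theorem rot_direction (η : ℝ) :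
    rot η !₂[Real.cos η, 0, Real.sin η] = EuclideanSpace.single 0 1 := by
  have := Real.sin_sq_add_cos_sq η
  ext i
  fin_cases i <;> simp [rot]
  · linear_combination this
  · ring

/-- The constant term cancels, so the displacement from `B`, scaled by the probability, is linear in
`x`, with the covariances `R_{ij} - R_{i0} R_{0j}` as coefficients. -/
theorem bloch_sub_reduced {T : Fin 2 → Fin 2 → Fin 2 → ℝ} (hT : gram T 0 0 + gram T 1 1 = 1)
    {x : E3} (hp : (steer T (effect x)).trace.re ≠ 0) (i : Fin 3) :
    (steer T (effect x)).trace.re * (bloch (postState (stateAB T) (effect x)) i -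
      bloch (ptraceFst (stateAB T)) i) =
    x 0 * (rMatrix (stateAB T) 1 i.succ -
      rMatrix (stateAB T) 1 0 * rMatrix (stateAB T) 0 i.succ) +
    x 1 * (rMatrix (stateAB T) 2 i.succ -
      rMatrix (stateAB T) 2 0 * rMatrix (stateAB T) 0 i.succ) +
    x 2 * (rMatrix (stateAB T) 3 i.succ -
      rMatrix (stateAB T) 3 0 * rMatrix (stateAB T) 0 i.succ) := by
  have h1 := congrArg (fun v : E3 => v i) (smul_bloch_postState hp)
  simp only [PiLp.smul_apply, smul_eq_mul, bloch_steer_effect] at h1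
  have h2 := trace_steer_effect_rMatrix T x
  rw [rMatrix_zero_zero hT] at h2
  rw [mul_sub, h1, bloch_reduced, h2]
  ring

/-- The chord in the `y₂` direction. -/
theorem bloch_y_chord {T : Fin 2 → Fin 2 → Fin 2 → ℝ} (hT : gram T 0 0 + gram T 1 1 = 1) :
    bloch (postState (stateAB T) (effect !₂[0, 1 / 2, 0])) = bloch (ptraceFst (stateAB T)) +
      rMatrix (stateAB T) 2 2 • (EuclideanSpace.single 1 1 : E3) := by
  have hp : (steer T (effect !₂[0, 1 / 2, 0])).trace.re = 1 / 2 :=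
    trace_steer_effect_y hT (by simp) (by simp)
  have h := bloch_sub_reduced hT (x := !₂[0, 1 / 2, 0]) (by rw [hp]; norm_num)
  rw [hp] at h
  have h0 := h 0
  have h1 := h 1
  have h2 := h 2
  simp only [rMatrix_entries] at h0 h1 h2 ⊢
  simp at h0 h1 h2
  ext i
  fin_cases i <;> simp
  · linarith
  · linarith
  · linarith

/-- The chord in a direction of the plane `y₂ = 0`. -/
theorem bloch_plane_chord {T : Fin 2 → Fin 2 → Fin 2 → ℝ} (hT : gram T 0 0 + gram T 1 1 = 1)
    {x : E3} (hx : x 1 = 0) (hp : (steer T (effect x)).trace.re ≠ 0) {η : ℝ}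
    (h : x 0 * (-(rMatrix (stateAB T) 1 1 - rMatrix (stateAB T) 1 0 * rMatrix (stateAB T) 0 1) *
        Real.sin η + (rMatrix (stateAB T) 1 3 -
        rMatrix (stateAB T) 1 0 * rMatrix (stateAB T) 0 3) * Real.cos η) +
      x 2 * (-(rMatrix (stateAB T) 3 1 - rMatrix (stateAB T) 3 0 * rMatrix (stateAB T) 0 1) *
        Real.sin η + (rMatrix (stateAB T) 3 3 -
        rMatrix (stateAB T) 3 0 * rMatrix (stateAB T) 0 3) * Real.cos η) = 0) :
    ∃ t₀ : ℝ, bloch (postState (stateAB T) (effect x)) = bloch (ptraceFst (stateAB T)) +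
      t₀ • !₂[Real.cos η, 0, Real.sin η] := by
  have h0 := bloch_sub_reduced hT hp 0
  have h1 := bloch_sub_reduced hT hp 1
  have h2 := bloch_sub_reduced hT hp 2
  simp only [Fin.succ_zero_eq_one, Fin.succ_one_eq_two, show (2 : Fin 3).succ = 3 from rfl, hx]
    at h0 h1 h2
  have e12 : rMatrix (stateAB T) 1 2 = 0 := by rw [rMatrix_entries]; rfl
  have e32 : rMatrix (stateAB T) 3 2 = 0 := by rw [rMatrix_entries]; rfl
  have e02 : rMatrix (stateAB T) 0 2 = 0 := by rw [rMatrix_entries]; rfl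
  rw [e12, e32, e02] at h1
  set y := bloch (postState (stateAB T) (effect x))
  set B := bloch (ptraceFst (stateAB T))
  set p := (steer T (effect x)).trace.re
  have hy1 : y 1 - B 1 = 0 := by
    have : p * (y 1 - B 1) = 0 := by rw [h1]; ring
    exact (mul_eq_zero.1 this).resolve_left hp
  -- The hypothesis says that the third rotated coordinate of the displacement vanishes.
  have hperp : -Real.sin η * (y 0 - B 0) + Real.cos η * (y 2 - B 2) = 0 := by
    have : p * (-Real.sin η * (y 0 - B 0) + Real.cos η * (y 2 - B 2)) = 0 := by
      linear_combination -Real.sin η * h0 + Real.cos η * h2 + h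
    exact (mul_eq_zero.1 this).resolve_left hp
  have hcs := Real.sin_sq_add_cos_sq η
  refine ⟨Real.cos η * (y 0 - B 0) + Real.sin η * (y 2 - B 2), ?_⟩
  ext i
  fin_cases i <;> simp
  · linear_combination -Real.sin η * hperp - (y 0 - B 0) * hcs
  · linarith
  · linear_combination Real.cos η * hperp - (y 2 - B 2) * hcs

/-- The `y₁` chord comes from a real measurement and the `y₂` chord from the measurement along `σ₂`;
these are the two equal-concurrence measurements, so the lengths follow from `tr τ` and the
discriminant of `τ`. -/
theorem steering_chords {P : RealParams} (h : P.Valid) (hs : ¬ IsSeparable P.rhoAB) :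
    IsUnit (rMatrix P.rhoAB).det ∧
      ∀ η : ℝ, P.IsAngle η →
        ∃ (pM pN pP pQ : ℝ) (rM rN rP rQ : E3),
          IsChordDecomposition (rot η '' steeringEllipsoid P.rhoAB)
            (rot η (bloch (ptraceFst P.rhoAB)))
            (EuclideanSpace.single 0 1) pM pN rM rN ∧
          IsChordDecomposition (rot η '' steeringEllipsoid P.rhoAB)
            (rot η (bloch (ptraceFst P.rhoAB)))
            (EuclideanSpace.single 1 1) pP pQ rP rQ ∧
          IsRealized P.rhoAB η pM pN rM rN ∧
          IsRealized P.rhoAB η pP pQ rP rQ ∧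
          ‖rM‖ ^ 2 = 1 - 4 * P.l0 * P.l1 * P.d ^ 2 * (P.a0 * P.b1 + P.a1 * P.b0) ^ 2 ∧
          ‖rN‖ ^ 2 = 1 - 4 * P.l0 * P.l1 * P.d ^ 2 * (P.a0 * P.b1 + P.a1 * P.b0) ^ 2 ∧
          ‖rP‖ ^ 2 = 1 - 4 * P.l0 * P.l1 * (P.a0 * P.b1 - P.a1 * P.b0) ^ 2 ∧
          ‖rQ‖ ^ 2 = 1 - 4 * P.l0 * P.l1 * (P.a0 * P.b1 - P.a1 * P.b0) ^ 2 ∧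
          chordEntropy pM pN rM rN =
            H ((1 + √(1 - 4 * P.l0 * P.l1 * P.d ^ 2 *
              (P.a0 * P.b1 + P.a1 * P.b0) ^ 2)) / 2) ∧
          chordEntropy pP pQ rP rQ =
            H ((1 + √(1 - 4 * P.l0 * P.l1 * (P.a0 * P.b1 - P.a1 * P.b0) ^ 2)) / 2) ∧
          (P.c ^ 2 * (P.a0 * P.b1 - P.a1 * P.b0) ^ 2 ≥
              4 * P.a0 * P.a1 * P.b0 * P.b1 * P.d ^ 2 →
            chordEntropy pM pN rM rN = eof (complementState P.purification) ∧
            IsLeast (avgEntropies P.rhoAB) (chordEntropy pM pN rM rN)) ∧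
          (P.c ^ 2 * (P.a0 * P.b1 - P.a1 * P.b0) ^ 2 <
              4 * P.a0 * P.a1 * P.b0 * P.b1 * P.d ^ 2 →
            chordEntropy pP pQ rP rQ = eof (complementState P.purification) ∧
            IsLeast (avgEntropies P.rhoAB) (chordEntropy pP pQ rP rQ)) := by
  have hT := RealParams.gram_tensor h
  rw [← RealParams.stateAB_tensor h, RealParams.purification_eq, eof_eq hT] at *
  have hdet : (rMatrix (stateAB P.tensor)).det ≠ 0 := fun h0 =>
    hs (isSeparable_of_det_rMatrix_eq_zero hT h0)
  have hR : IsUnit (rMatrix (stateAB P.tensor)).det := isUnit_iff_ne_zero.2 hdet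
  refine ⟨hR, fun η hη => ?_⟩
  have hK := RealParams.chord_direction h
  have hR22 : rMatrix (stateAB P.tensor) 2 2 ≠ 0 := by
    intro h0
    refine hdet ?_
    have e : rMatrix (stateAB P.tensor) 2 2 = -(tauC P.tensor 0 0 + tauC P.tensor 1 1) := by
      rw [rMatrix_entries]
      simp [entryAB, tauC]
      ring
    have e' : tauC P.tensor 0 0 + tauC P.tensor 1 1 = 0 := by linarith
    rw [det_rMatrix, e']
    ring
  -- The measurement is chosen to give a chord along the rotated `y₁` axis, with equal concurrences
  -- deduced afterwards. This order also works when `c f₃ = f₆ = 0` and the angle is arbitrary.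
  obtain ⟨x, hx, hx1, hxw⟩ := exists_isVonNeumann_orthogonal
    (-(rMatrix (stateAB P.tensor) 1 1 - rMatrix (stateAB P.tensor) 1 0 *
        rMatrix (stateAB P.tensor) 0 1) * Real.sin η + (rMatrix (stateAB P.tensor) 1 3 -
        rMatrix (stateAB P.tensor) 1 0 * rMatrix (stateAB P.tensor) 0 3) * Real.cos η)
    (-(rMatrix (stateAB P.tensor) 3 1 - rMatrix (stateAB P.tensor) 3 0 *
        rMatrix (stateAB P.tensor) 0 1) * Real.sin η + (rMatrix (stateAB P.tensor) 3 3 -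
        rMatrix (stateAB P.tensor) 3 0 * rMatrix (stateAB P.tensor) 0 3) * Real.cos η)
  have hz : x 0 * (2 * tau P.tensor 0 1 - 2 * tauTrace P.tensor * gram P.tensor 0 1) +
      x 2 * (tau P.tensor 0 0 - tau P.tensor 1 1 -
        tauTrace P.tensor * (gram P.tensor 0 0 - gram P.tensor 1 1)) = 0 := by
    -- By `chord_direction`, `-R₂₂` times the equal-concurrence functional is a multiple, possibly
    -- zero, of the chord-direction functional; `R₂₂ ≠ 0` can be cancelled.
    refine (mul_eq_zero.1 (?_ : -(rMatrix (stateAB P.tensor) 2 2) * _ = 0)).resolve_left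
      (neg_ne_zero.2 hR22)
    obtain ⟨k1, k3⟩ := hK
    obtain ⟨s1, s2⟩ := hη
    rw [← s2, show P.c * P.f3 = -(√(P.c ^ 2 * P.f3 ^ 2 + P.f6 ^ 2) * Real.sin η) by
      rw [s1, neg_neg]] at k1 k3
    linear_combination x 0 * k1 + x 2 * k3 + 2 * √(P.c ^ 2 * P.f3 ^ 2 + P.f6 ^ 2) * hxw
  have hMN := hasConcSq_of_orthogonal hT hx hx1 hz
  have hy := isVonNeumann_y
  have hPQ := hasConcSq_y hT hy (by simp) (by simp)
  have pM := trace_steer_effect_pos hR hx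
  have pN := trace_steer_effect_pos hR hx.neg
  have pP := trace_steer_effect_pos hR hy
  have pQ := trace_steer_effect_pos hR hy.neg
  obtain ⟨t₀, ht₀⟩ := bloch_plane_chord hT hx1 pM.ne' hxw
  have cMN := isChordDecomposition_of_measurement hT hR hx ht₀ η
  have cPQ := isChordDecomposition_of_measurement hT hR hy (bloch_y_chord hT) η
  rw [rot_direction] at cMN
  rw [rot_single_one] at cPQ
  rw [RealParams.tauTrace_tensor_sq h] at hMN
  rw [RealParams.disc_tensor h] at hPQ
  have hl := mul_pos h.1 h.2.1
  have nMN : 0 ≤ 4 * P.l0 * P.l1 * P.d ^ 2 * (P.a0 * P.b1 + P.a1 * P.b0) ^ 2 := by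
    have := mul_nonneg hl.le (sq_nonneg (P.d * (P.a0 * P.b1 + P.a1 * P.b0)))
    linarith
  have nPQ : 0 ≤ 4 * P.l0 * P.l1 * (P.a0 * P.b1 - P.a1 * P.b0) ^ 2 := by
    have := mul_nonneg hl.le (sq_nonneg (P.a0 * P.b1 - P.a1 * P.b0))
    linarith
  obtain ⟨lM, lN⟩ := hMN.norm_sq nMN hx pM pN
  obtain ⟨lP, lQ⟩ := hPQ.norm_sq nPQ hy pP pQ
  rw [← norm_rot η] at lM lN lP lQ
  have eMN := chordEntropy_eq (trace_effect_add hT x) lM lN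
  have ePQ := chordEntropy_eq (trace_effect_add hT !₂[0, 1 / 2, 0]) lP lQ
  refine ⟨_, _, _, _, _, _, _, _, cMN, cPQ, isRealized_of_measurement hx η,
    isRealized_of_measurement hy η, lM, lN, lP, lQ, eMN, ePQ, fun hi => ?_, fun hi => ?_⟩
  · rw [eMN, ← concEntropy_sqrt nMN, ← RealParams.concSq_tensor_of_le h hi]
    exact ⟨rfl, isLeast_avgEntropies hT⟩
  · rw [ePQ, ← concEntropy_sqrt nPQ, ← RealParams.concSq_tensor_of_lt h hi]
    exact ⟨rfl, isLeast_avgEntropies hT⟩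

/-! ### Separable states of rank two -/

/-- The coefficients of the purification of `sepState q α β`. -/
def sepTensor (q α β : ℝ) (a b c : Fin 2) : ℝ :=
  ![![![√q, √(1 - q) * (Real.cos α * Real.cos β)], ![0, √(1 - q) * (Real.cos α * Real.sin β)]],
    ![![0, √(1 - q) * (Real.sin α * Real.cos β)], ![0, √(1 - q) * (Real.sin α * Real.sin β)]]] a b c

theorem sepPurification_eq (q α β : ℝ) : sepPurification q α β = realVec (sepTensor q α β) := by
  funext ⟨a, b, c⟩
  fin_cases a <;> fin_cases b <;> fin_cases c <;>
    simp [sepPurification, realVec, sepTensor, tensorAB, QState.tensor, ket, qubit]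

section

variable {q α β : ℝ}

theorem sq_sqrt_weights (hq : q ∈ Set.Ioo (0 : ℝ) 1) : √q ^ 2 = q ∧ √(1 - q) ^ 2 = 1 - q :=
  ⟨Real.sq_sqrt hq.1.le, Real.sq_sqrt (by linarith [hq.2])⟩

theorem stateAB_sepTensor (hq : q ∈ Set.Ioo (0 : ℝ) 1) :
    stateAB (sepTensor q α β) = sepState q α β := by
  obtain ⟨h0, h1⟩ := sq_sqrt_weights hq
  have h0' : (√q : ℂ) * √q = q := by rw [← sq]; exact_mod_cast h0
  have h1' : (√(1 - q) : ℂ) ^ 2 = ((1 - q : ℝ) : ℂ) := by exact_mod_cast h1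
  push_cast at h1'
  ext ⟨a, b⟩ ⟨a', b'⟩
  fin_cases a <;> fin_cases b <;> fin_cases a' <;> fin_cases b' <;>
    simp [stateAB, ptraceC, proj, realVec, sepTensor, sepState, ket, qubit,
      Matrix.vecMulVec_apply, Complex.conj_ofReal, ← Complex.ofReal_cos, ← Complex.ofReal_sin,
      h0', ← h1'] <;>
    ring

theorem gram_sepTensor (hq : q ∈ Set.Ioo (0 : ℝ) 1) :
    gram (sepTensor q α β) 0 0 = q + (1 - q) * Real.cos α ^ 2 ∧
    gram (sepTensor q α β) 1 1 = (1 - q) * Real.sin α ^ 2 ∧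
    gram (sepTensor q α β) 0 1 = (1 - q) * (Real.cos α * Real.sin α) := by
  obtain ⟨h0, h1⟩ := sq_sqrt_weights hq
  have hβ := Real.sin_sq_add_cos_sq β
  refine ⟨?_, ?_, ?_⟩ <;> simp [gram, sepTensor, Fin.sum_univ_two]
  · linear_combination h0 + Real.cos α ^ 2 * h1 + √(1 - q) ^ 2 * Real.cos α ^ 2 * hβ
  · linear_combination Real.sin α ^ 2 * h1 + √(1 - q) ^ 2 * Real.sin α ^ 2 * hβ
  · linear_combination Real.cos α * Real.sin α * h1 +
      √(1 - q) ^ 2 * Real.cos α * Real.sin α * hβ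

theorem gram_sepTensor_trace (hq : q ∈ Set.Ioo (0 : ℝ) 1) :
    gram (sepTensor q α β) 0 0 + gram (sepTensor q α β) 1 1 = 1 := by
  obtain ⟨h0, h1, -⟩ := gram_sepTensor (α := α) (β := β) hq
  rw [h0, h1]
  linear_combination (1 - q) * Real.sin_sq_add_cos_sq α

/-- The second A-slice is a multiple of the product vector `φ ⊗ |1⟩`, hence the zero diagonal entry
and `det τ = -τ₀₁² ≤ 0`. -/
theorem tau_sepTensor (q α β : ℝ) :
    tau (sepTensor q α β) 0 0 = 2 * (√q * √(1 - q) * (Real.cos α * Real.sin β)) ∧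
    tau (sepTensor q α β) 1 1 = 0 ∧
    tau (sepTensor q α β) 0 1 = √q * √(1 - q) * (Real.sin α * Real.sin β) := by
  refine ⟨?_, ?_, ?_⟩ <;> simp [tau, sepTensor] <;> ring

theorem concSq_sepTensor (hq : q ∈ Set.Ioo (0 : ℝ) 1) :
    concSq (sepTensor q α β) = 4 * q * (1 - q) * Real.cos α ^ 2 * Real.sin β ^ 2 := by
  obtain ⟨h0, h1⟩ := sq_sqrt_weights hq
  obtain ⟨e0, e1, e2⟩ := tau_sepTensor q α β
  rw [concSq, if_pos, tauTrace, e0, e1]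
  · linear_combination 4 * Real.cos α ^ 2 * Real.sin β ^ 2 * (√(1 - q) ^ 2 * h0 + q * h1)
  · rw [tauDet, e1]
    nlinarith [sq_nonneg (tau (sepTensor q α β) 0 1)]

theorem sqrt_concSq_sepTensor (hq : q ∈ Set.Ioo (0 : ℝ) 1) (hα : α ∈ Set.Ioc 0 (Real.pi / 2))
    (hβ : β ∈ Set.Ioc 0 (Real.pi / 2)) :
    √(concSq (sepTensor q α β)) = 2 * √(q * (1 - q)) * Real.cos α * Real.sin β := by
  have hq' : 0 ≤ q * (1 - q) := mul_nonneg hq.1.le (by linarith [hq.2])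
  have hc : 0 ≤ Real.cos α :=
    Real.cos_nonneg_of_neg_pi_div_two_le_of_le (by linarith [hα.1, Real.pi_pos]) hα.2
  have hs : 0 ≤ Real.sin β :=
    Real.sin_nonneg_of_nonneg_of_le_pi hβ.1.le (by linarith [hβ.2, Real.pi_pos])
  rw [concSq_sepTensor hq]
  have := Real.sq_sqrt hq'
  rw [← Real.sqrt_sq (show 0 ≤ 2 * √(q * (1 - q)) * Real.cos α * Real.sin β by positivity)]
  congr 1
  linear_combination -4 * Real.cos α ^ 2 * Real.sin β ^ 2 * this

theorem mem_steeringLine (hβ : β ∈ Set.Ioc 0 (Real.pi / 2)) {y : E3} (h1 : y 1 = 0)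
    (h2 : y 2 * Real.cos β + y 0 * Real.sin β = Real.cos β) : y ∈ steeringLine β := by
  refine ⟨h1, h2, fun hne => ?_⟩
  have hc : Real.cos β ≠ 0 := (Real.cos_pos_of_mem_Ioo
    ⟨by linarith [hβ.1, Real.pi_pos], lt_of_le_of_ne hβ.2 hne⟩).ne'
  rw [Real.tan_eq_sin_div_cos]
  field_simp
  linarith

/-- Each row is a combination of the Bloch four-vectors of `|0⟩` and `φ`, and both of these states
lie on the line: `cos 2β cos β + sin 2β sin β = cos β`. -/
theorem rMatrix_sepTensor_line (q α β : ℝ) (μ : Fin 4) (hμ : μ ≠ 2) :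
    rMatrix (stateAB (sepTensor q α β)) μ 2 = 0 ∧
    rMatrix (stateAB (sepTensor q α β)) μ 3 * Real.cos β +
      rMatrix (stateAB (sepTensor q α β)) μ 1 * Real.sin β =
      rMatrix (stateAB (sepTensor q α β)) μ 0 * Real.cos β := by
  rw [rMatrix_entries]
  fin_cases μ
  · simp [entryAB, sepTensor]
    ring
  · simp [entryAB, sepTensor]
    ring
  · exact absurd rfl hμ
  · simp [entryAB, sepTensor]
    ring

/-- The A-states `|0⟩` and `ψ` are real, so `σ₂` has expectation zero in both. -/
theorem rMatrix_sepTensor_two (q α β : ℝ) (ν : Fin 4) :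
    rMatrix (stateAB (sepTensor q α β)) 2 ν = 0 := by
  rw [rMatrix_entries]
  fin_cases ν <;> simp [entryAB, sepTensor]
  ring

theorem bloch_reduced_mem_steeringLine (hq : q ∈ Set.Ioo (0 : ℝ) 1)
    (hβ : β ∈ Set.Ioc 0 (Real.pi / 2)) :
    bloch (ptraceFst (stateAB (sepTensor q α β))) ∈ steeringLine β := by
  obtain ⟨h1, h2⟩ := rMatrix_sepTensor_line q α β 0 (by decide)
  rw [rMatrix_zero_zero (gram_sepTensor_trace hq), one_mul] at h2
  refine mem_steeringLine hβ ?_ ?_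
  · rw [bloch_reduced]; exact h1
  · rw [bloch_reduced, bloch_reduced]; exact h2

/-- The probability is `q⟨0|M|0⟩ + (1-q)⟨ψ|M|ψ⟩`. A rank-one effect cannot annihilate both vectors,
which are independent because `sin α > 0`. -/
theorem trace_steer_sepTensor_pos (hq : q ∈ Set.Ioo (0 : ℝ) 1)
    (hα : α ∈ Set.Ioc 0 (Real.pi / 2)) {x : E3} (hx : IsVonNeumann x) :
    0 < (steer (sepTensor q α β) (effect x)).trace.re := by
  obtain ⟨h0, h1, h2⟩ := gram_sepTensor (α := α) (β := β) hq
  have hs : 0 < Real.sin α := Real.sin_pos_of_pos_of_lt_pi hα.1 (by linarith [hα.2, Real.pi_pos])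
  have hcs := Real.sin_sq_add_cos_sq α
  have hx' : x 0 ^ 2 + x 1 ^ 2 + x 2 ^ 2 = 1 / 4 := hx
  rw [trace_steer_effect, h0, h1, h2]
  set C := Real.cos α
  set S := Real.sin α
  have hr0 : 0 ≤ 1 / 2 + x 2 := by nlinarith [sq_nonneg (x 0), sq_nonneg (x 1)]
  have hr0' : 0 ≤ 1 / 2 - x 2 := by nlinarith [sq_nonneg (x 0), sq_nonneg (x 1)]
  -- Nonnegativity of `⟨ψ|M|ψ⟩`, by completing the square after multiplication by `⟨0|M|0⟩`.
  have hr1 : 0 ≤ C ^ 2 * (1 / 2 + x 2) + S ^ 2 * (1 / 2 - x 2) + 2 * (C * S) * x 0 := by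
    rcases hr0.eq_or_lt with h | h
    · have : x 0 = 0 := by nlinarith [sq_nonneg (x 0), sq_nonneg (x 1)]
      rw [← h, this]
      nlinarith [mul_nonneg (sq_nonneg S) hr0']
    · refine nonneg_of_mul_nonneg_right (a := 1 / 2 + x 2) ?_ h
      nlinarith [sq_nonneg (C * (1 / 2 + x 2) + S * x 0), mul_nonneg (sq_nonneg S)
        (sq_nonneg (x 1))]
  have e : (1 / 2 + x 2) * (q + (1 - q) * C ^ 2) + (1 / 2 - x 2) * ((1 - q) * S ^ 2) +
      2 * x 0 * ((1 - q) * (C * S)) = q * (1 / 2 + x 2) +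
      (1 - q) * (C ^ 2 * (1 / 2 + x 2) + S ^ 2 * (1 / 2 - x 2) + 2 * (C * S) * x 0) := by ring
  rw [e]
  have hq1 : 0 < 1 - q := by linarith [hq.2]
  rcases hr0.eq_or_lt with h | h
  -- If `⟨0|M|0⟩ = 0`, then `M = |1⟩⟨1|` and only `(1-q) sin² α` remains.
  · have h3 : x 0 = 0 := by nlinarith [sq_nonneg (x 0), sq_nonneg (x 1)]
    have h4 : 1 / 2 - x 2 = 1 := by linarith
    rw [← h, h3, h4]
    have := mul_pos hq1 (pow_pos hs 2)
    linarith
  · exact add_pos_of_pos_of_nonneg (mul_pos hq.1 h) (mul_nonneg hq1.le hr1)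

theorem bloch_postState_mem_steeringLine (hq : q ∈ Set.Ioo (0 : ℝ) 1)
    (hα : α ∈ Set.Ioc 0 (Real.pi / 2)) (hβ : β ∈ Set.Ioc 0 (Real.pi / 2)) {x : E3}
    (hx : IsVonNeumann x) :
    bloch (postState (stateAB (sepTensor q α β)) (effect x)) ∈ steeringLine β := by
  have hp := (trace_steer_sepTensor_pos (β := β) hq hα hx).ne'
  have h : ∀ i, (steer (sepTensor q α β) (effect x)).trace.re *
      bloch (postState (stateAB (sepTensor q α β)) (effect x)) i =
      bloch (steer (sepTensor q α β) (effect x)) i :=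
    fun i => congrArg (fun v : E3 => v i) (smul_bloch_postState hp)
  have ht := trace_steer_effect_rMatrix (sepTensor q α β) x
  have b0 := (h 0).trans (bloch_steer_effect _ x 0)
  have b1 := (h 1).trans (bloch_steer_effect _ x 1)
  have b2 := (h 2).trans (bloch_steer_effect _ x 2)
  simp only [Fin.succ_zero_eq_one, Fin.succ_one_eq_two, show (2 : Fin 3).succ = 3 from rfl,
    rMatrix_sepTensor_two] at ht b0 b1 b2
  obtain ⟨l0, m0⟩ := rMatrix_sepTensor_line q α β 0 (by decide)
  obtain ⟨l1, m1⟩ := rMatrix_sepTensor_line q α β 1 (by decide)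
  obtain ⟨l3, m3⟩ := rMatrix_sepTensor_line q α β 3 (by decide)
  refine mem_steeringLine hβ ?_ ?_ <;> refine mul_left_cancel₀ hp ?_
  · rw [b1, l0, l1, l3]; ring
  · linear_combination Real.cos β * b2 + Real.sin β * b0 - Real.cos β * ht + 1 / 2 * m0 +
      x 0 * m1 + x 2 * m3

theorem norm_bloch_reduced_sq (hq : q ∈ Set.Ioo (0 : ℝ) 1) :
    ‖bloch (ptraceFst (stateAB (sepTensor q α β)))‖ ^ 2 =
      1 - 4 * q * (1 - q) * Real.sin β ^ 2 := by
  obtain ⟨h0, h1⟩ := sq_sqrt_weights hq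
  have hcs := Real.sin_sq_add_cos_sq α
  have hH := (steer_posSemidef (sepTensor q α β) Matrix.PosSemidef.one).isHermitian
  rw [ptraceFst_stateAB, norm_bloch_sq hH, steer_one_trace (gram_sepTensor_trace hq),
    four_det_steer _ Matrix.isHermitian_one]
  simp [tau, tauDet, sepTensor]
  linear_combination 4 * Real.sin β ^ 2 * (√(1 - q) ^ 2 * h0 + q * h1) +
    4 * √q ^ 2 * √(1 - q) ^ 2 * Real.sin β ^ 2 * hcs

theorem four_det_of_norm_sq {T : Fin 2 → Fin 2 → Fin 2 → ℝ} {M : Matrix (Fin 2) (Fin 2) ℂ}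
    (hM : M.PosSemidef) (hp : 0 < (steer T M).trace.re) {κ : ℝ}
    (h : ‖bloch (postState (stateAB T) M)‖ ^ 2 = 1 - κ) :
    4 * (steer T M).det.re = κ * (steer T M).trace.re ^ 2 := by
  have hs := steer_posSemidef T hM
  have h1 := norm_bloch_sq hs.isHermitian
  rw [← smul_bloch_postState hp.ne', norm_smul, mul_pow, Real.norm_eq_abs, sq_abs, h] at h1
  linarith

/-- Equal lengths mean equal concurrences, so the bound on the average concurrence applies to each
outcome, and a larger concurrence means a shorter Bloch vector. -/
theorem norm_bloch_le_of_equiEntropy {T : Fin 2 → Fin 2 → Fin 2 → ℝ}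
    (hT : gram T 0 0 + gram T 1 1 = 1) {x : E3}
    (h : IsEquiEntropyMeasurement (stateAB T) x) :
    ‖bloch (postState (stateAB T) (effect x))‖ ≤ √(1 - concSq T) := by
  obtain ⟨hx, hp, hm, -, hn⟩ := h
  rw [postProb_stateAB] at hp hm
  have nP := norm_bloch_postState_sq (effect_posSemidef hx) hp
  have nM := norm_bloch_postState_sq (effect_posSemidef hx.neg) hm
  have h0 : 0 ≤ outcomeConc T (effect x) :=
    (conc_mem_Icc (steer_posSemidef T (effect_posSemidef hx))).1
  have h0' : 0 ≤ outcomeConc T (effect (-x)) :=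
    (conc_mem_Icc (steer_posSemidef T (effect_posSemidef hx.neg))).1
  have hC : outcomeConc T (effect x) = outcomeConc T (effect (-x)) := by
    rw [← hn, nP] at nM
    rw [← Real.sqrt_sq h0, ← Real.sqrt_sq h0', sub_right_inj.1 nM]
  have hb := sqrt_concSq_le_sum T (M := ![effect x, effect (-x)]) (isPOVM_effect hx).1
    (by rw [(isPOVM_effect hx).2, sub_self]; exact Matrix.PosSemidef.zero)
    (by rw [(isPOVM_effect hx).2, sub_self, steer_zero])
  rw [Fin.sum_univ_two] at hb
  simp only [Matrix.cons_val_zero, Matrix.cons_val_one] at hb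
  rw [← hC, ← add_mul, trace_effect_add hT, one_mul] at hb
  refine Real.le_sqrt_of_sq_le ?_
  rw [nP]
  have := pow_le_pow_left₀ (Real.sqrt_nonneg _) hb 2
  rw [Real.sq_sqrt (concSq_nonneg T)] at this
  linarith

theorem separable_rank_two (hq : q ∈ Set.Ioo (0 : ℝ) 1) (hα : α ∈ Set.Ioc 0 (Real.pi / 2))
    (hβ : β ∈ Set.Ioc 0 (Real.pi / 2)) :
    ptraceC (proj (sepPurification q α β)) = sepState q α β ∧
      concurrence (complementState (sepPurification q α β)) =
        2 * √(q * (1 - q)) * Real.cos α * Real.sin β ∧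
      IsLeast (avgEntropies (sepState q α β))
        (H ((1 + √(1 - 4 * q * (1 - q) * Real.cos α ^ 2 * Real.sin β ^ 2)) / 2)) ∧
      eof (complementState (sepPurification q α β)) =
        H ((1 + √(1 - 4 * q * (1 - q) * Real.cos α ^ 2 * Real.sin β ^ 2)) / 2) ∧
      bloch (ptraceFst (sepState q α β)) ∈ steeringLine β ∧
      (∀ x : E3, IsVonNeumann x →
        0 < postProb (sepState q α β) (effect x) ∧
        bloch (postState (sepState q α β) (effect x)) ∈ steeringLine β) ∧
      IsGreatest
        {r : ℝ | ∃ x : E3,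
          IsEquiEntropyMeasurement (sepState q α β) x ∧
          r = ‖bloch (postState (sepState q α β) (effect x))‖}
        (√(1 - 4 * q * (1 - q) * Real.cos α ^ 2 * Real.sin β ^ 2)) ∧
      (∀ x : E3, IsEquiEntropyMeasurement (sepState q α β) x →
        ‖bloch (postState (sepState q α β) (effect x))‖ =
          √(1 - 4 * q * (1 - q) * Real.cos α ^ 2 * Real.sin β ^ 2) →
        IsPOVM ![effect x, effect (-x)] ∧
        avgEntropy (sepState q α β) ![effect x, effect (-x)] =
          H ((1 + √(1 - 4 * q * (1 - q) * Real.cos α ^ 2 * Real.sin β ^ 2)) / 2)) := by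
  have hT := gram_sepTensor_trace (α := α) (β := β) hq
  have hBn := norm_bloch_reduced_sq (α := α) (β := β) hq
  have hκ := concSq_sepTensor (α := α) (β := β) hq
  have hκ0 := concSq_nonneg (sepTensor q α β)
  have hpos := fun x (hx : IsVonNeumann x) => trace_steer_sepTensor_pos (β := β) hq hα hx
  obtain ⟨x₀, hx₀, hc₀⟩ := exists_hasConcSq hT
  obtain ⟨n₀, n₁⟩ := hc₀.norm_sq hκ0 hx₀ (hpos _ hx₀) (hpos _ hx₀.neg)
  have hnn := congrArg Real.sqrt (n₀.trans n₁.symm)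
  rw [Real.sqrt_sq (norm_nonneg _), Real.sqrt_sq (norm_nonneg _)] at hnn
  have hκ1 : 0 ≤ 1 - concSq (sepTensor q α β) := by rw [← n₀]; exact sq_nonneg _
  -- Since `sin α > 0`, the vector `B` is strictly shorter than the claimed maximum.
  have hlt : concSq (sepTensor q α β) < 4 * q * (1 - q) * Real.sin β ^ 2 := by
    have hsα : 0 < Real.sin α :=
      Real.sin_pos_of_pos_of_lt_pi hα.1 (by linarith [hα.2, Real.pi_pos])
    have hsβ : 0 < Real.sin β :=
      Real.sin_pos_of_pos_of_lt_pi hβ.1 (by linarith [hβ.2, Real.pi_pos])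
    have hq1 : 0 < 1 - q := by linarith [hq.2]
    have : 0 < 4 * q * (1 - q) * Real.sin β ^ 2 * Real.sin α ^ 2 := by have := hq.1; positivity
    rw [hκ]
    linear_combination this +
      4 * q * (1 - q) * Real.sin β ^ 2 * Real.sin_sq_add_cos_sq α
  rw [show 1 - 4 * q * (1 - q) * Real.cos α ^ 2 * Real.sin β ^ 2 =
    1 - concSq (sepTensor q α β) by rw [hκ], ← concEntropy_sqrt hκ0, sepPurification_eq,
    ← stateAB_sepTensor hq, concurrence_eq hT, sqrt_concSq_sepTensor hq hα hβ, eof_eq hT,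
    ← sqrt_concSq_sepTensor hq hα hβ]
  refine ⟨rfl, rfl, isLeast_avgEntropies hT, rfl, bloch_reduced_mem_steeringLine hq hβ,
    fun x hx => ⟨by rw [postProb_stateAB]; exact hpos x hx,
      bloch_postState_mem_steeringLine hq hα hβ hx⟩, ⟨⟨x₀, ?_, ?_⟩, ?_⟩, ?_⟩
  · refine ⟨hx₀, by rw [postProb_stateAB]; exact hpos _ hx₀,
      by rw [postProb_stateAB]; exact hpos _ hx₀.neg, fun h => ?_,
      hnn⟩
    -- Coinciding outcomes would both equal their average `B`, which is too short.
    have hd := bloch_decomposition (hpos _ hx₀).ne' (hpos _ hx₀.neg).ne'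
    rw [← h, ← add_smul, trace_effect_add hT, one_smul] at hd
    rw [hd, n₀] at hBn
    linarith
  · rw [← n₀, Real.sqrt_sq (norm_nonneg _)]
  · rintro _ ⟨x, hx, rfl⟩
    exact norm_bloch_le_of_equiEntropy hT hx
  · rintro x ⟨hx, hp, hm, -, hn⟩ hr
    rw [postProb_stateAB] at hp hm
    refine ⟨isPOVM_effect hx, HasConcSq.avgEntropy_eq hT hx
      ⟨four_det_of_norm_sq (effect_posSemidef hx) hp ?_,
        four_det_of_norm_sq (effect_posSemidef hx.neg) hm ?_⟩⟩
    · rw [hr, Real.sq_sqrt hκ1]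
    · rw [← hn, hr, Real.sq_sqrt hκ1]

end

end QState

end

theorem mainTheorem4 :
    -- rank-two states with real parameters: concurrence and entanglement of formation
    (∀ P : QState.RealParams, P.Valid →
      QState.ptraceC (QState.proj P.purification) = P.rhoAB ∧
      (P.c ^ 2 * (P.a0 * P.b1 - P.a1 * P.b0) ^ 2 ≥ 4 * P.a0 * P.a1 * P.b0 * P.b1 * P.d ^ 2 →
        QState.concurrence (QState.complementState P.purification) ^ 2 =
          4 * P.l0 * P.l1 * P.d ^ 2 * (P.a0 * P.b1 + P.a1 * P.b0) ^ 2) ∧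
      (P.c ^ 2 * (P.a0 * P.b1 - P.a1 * P.b0) ^ 2 < 4 * P.a0 * P.a1 * P.b0 * P.b1 * P.d ^ 2 →
        QState.concurrence (QState.complementState P.purification) ^ 2 =
          4 * P.l0 * P.l1 * (P.a0 * P.b1 - P.a1 * P.b0) ^ 2) ∧
      QState.eof (QState.complementState P.purification) =
        QState.H ((1 + √(1 - QState.concurrence
          (QState.complementState P.purification) ^ 2)) / 2)) ∧
    -- entangled states: the two equi-entropy chords of the rotated steering ellipsoid
    (∀ P : QState.RealParams, P.Valid → ¬ QState.IsSeparable P.rhoAB →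
      IsUnit (QState.rMatrix P.rhoAB).det ∧
      ∀ η : ℝ, P.IsAngle η →
        ∃ (pM pN pP pQ : ℝ) (rM rN rP rQ : QState.E3),
          QState.IsChordDecomposition (QState.rot η '' QState.steeringEllipsoid P.rhoAB)
            (QState.rot η (QState.bloch (QState.ptraceFst P.rhoAB)))
            (EuclideanSpace.single 0 1) pM pN rM rN ∧
          QState.IsChordDecomposition (QState.rot η '' QState.steeringEllipsoid P.rhoAB)
            (QState.rot η (QState.bloch (QState.ptraceFst P.rhoAB)))
            (EuclideanSpace.single 1 1) pP pQ rP rQ ∧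
          QState.IsRealized P.rhoAB η pM pN rM rN ∧
          QState.IsRealized P.rhoAB η pP pQ rP rQ ∧
          ‖rM‖ ^ 2 = 1 - 4 * P.l0 * P.l1 * P.d ^ 2 * (P.a0 * P.b1 + P.a1 * P.b0) ^ 2 ∧
          ‖rN‖ ^ 2 = 1 - 4 * P.l0 * P.l1 * P.d ^ 2 * (P.a0 * P.b1 + P.a1 * P.b0) ^ 2 ∧
          ‖rP‖ ^ 2 = 1 - 4 * P.l0 * P.l1 * (P.a0 * P.b1 - P.a1 * P.b0) ^ 2 ∧
          ‖rQ‖ ^ 2 = 1 - 4 * P.l0 * P.l1 * (P.a0 * P.b1 - P.a1 * P.b0) ^ 2 ∧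
          QState.chordEntropy pM pN rM rN =
            QState.H ((1 + √(1 - 4 * P.l0 * P.l1 * P.d ^ 2 *
              (P.a0 * P.b1 + P.a1 * P.b0) ^ 2)) / 2) ∧
          QState.chordEntropy pP pQ rP rQ =
            QState.H ((1 + √(1 - 4 * P.l0 * P.l1 * (P.a0 * P.b1 - P.a1 * P.b0) ^ 2)) / 2) ∧
          (P.c ^ 2 * (P.a0 * P.b1 - P.a1 * P.b0) ^ 2 ≥
              4 * P.a0 * P.a1 * P.b0 * P.b1 * P.d ^ 2 →
            QState.chordEntropy pM pN rM rN =
              QState.eof (QState.complementState P.purification) ∧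
            IsLeast (QState.avgEntropies P.rhoAB) (QState.chordEntropy pM pN rM rN)) ∧
          (P.c ^ 2 * (P.a0 * P.b1 - P.a1 * P.b0) ^ 2 <
              4 * P.a0 * P.a1 * P.b0 * P.b1 * P.d ^ 2 →
            QState.chordEntropy pP pQ rP rQ =
              QState.eof (QState.complementState P.purification) ∧
            IsLeast (QState.avgEntropies P.rhoAB) (QState.chordEntropy pP pQ rP rQ))) ∧
    -- separable states of rank two
    (∀ q α β : ℝ, q ∈ Set.Ioo (0 : ℝ) 1 → α ∈ Set.Ioc 0 (Real.pi / 2) →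
      β ∈ Set.Ioc 0 (Real.pi / 2) →
      QState.ptraceC (QState.proj (QState.sepPurification q α β)) = QState.sepState q α β ∧
      QState.concurrence (QState.complementState (QState.sepPurification q α β)) =
        2 * √(q * (1 - q)) * Real.cos α * Real.sin β ∧
      IsLeast (QState.avgEntropies (QState.sepState q α β))
        (QState.H ((1 + √(1 - 4 * q * (1 - q) * Real.cos α ^ 2 * Real.sin β ^ 2)) / 2)) ∧
      QState.eof (QState.complementState (QState.sepPurification q α β)) =
        QState.H ((1 + √(1 - 4 * q * (1 - q) * Real.cos α ^ 2 * Real.sin β ^ 2)) / 2) ∧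
      QState.bloch (QState.ptraceFst (QState.sepState q α β)) ∈ QState.steeringLine β ∧
      (∀ x : QState.E3, QState.IsVonNeumann x →
        0 < QState.postProb (QState.sepState q α β) (QState.effect x) ∧
        QState.bloch (QState.postState (QState.sepState q α β) (QState.effect x)) ∈
          QState.steeringLine β) ∧
      IsGreatest
        {r : ℝ | ∃ x : QState.E3,
          QState.IsEquiEntropyMeasurement (QState.sepState q α β) x ∧
          r = ‖QState.bloch (QState.postState (QState.sepState q α β) (QState.effect x))‖}
        (√(1 - 4 * q * (1 - q) * Real.cos α ^ 2 * Real.sin β ^ 2)) ∧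
      (∀ x : QState.E3, QState.IsEquiEntropyMeasurement (QState.sepState q α β) x →
        ‖QState.bloch (QState.postState (QState.sepState q α β) (QState.effect x))‖ =
          √(1 - 4 * q * (1 - q) * Real.cos α ^ 2 * Real.sin β ^ 2) →
        QState.IsPOVM ![QState.effect x, QState.effect (-x)] ∧
        QState.avgEntropy (QState.sepState q α β) ![QState.effect x, QState.effect (-x)] =
          QState.H ((1 + √(1 - 4 * q * (1 - q) * Real.cos α ^ 2 * Real.sin β ^ 2)) / 2))) :=
  ⟨fun _ h => QState.RealParams.rank_two_concurrence h,
    fun _ h hs => QState.steering_chords h hs,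
    fun _ _ _ hq hα hβ => QState.separable_rank_two hq hα hβ⟩
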